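/- Fix $m\ge 2$. Let $\mathbf{Loc}$ be the category of oriented and time-oriented globally hyperbolic Lorentzian manifolds of dimension $m$, whose morphisms $f:M\to N$ are the orientation and time-orientation preserving isometric embeddings with open and causally convex image. For $\overline M\in\mathbf{Loc}$, let $\mathbf{Loc}/\overline M$ be the slice category. **Field theory.** Let $F_0,F_1$ be finite-rank real vector bundles with fiber metrics $h_0,h_1$, natural on $\mathbf{Loc}$ (each morphism $f:M\to N$ is covered functorially by fiberwise isometric vector bundle maps $F_n(M)\to F_n(N)$). Write $\mathfrak F_n(M)=\Gamma^\infty(M,F_n)$, $f^*$ for the induced pullback of sections, $f_*$ for the pushforward (extension by zero) of compactly supported sections, and $\langle s,s'\rangle=\int_M h_n(s,s')\,\mathrm{vol}_M$ whenever $s,s'$ have compactly overlapping supports. Let $Q_M:\mathfrak F_1(M)\to\mathfrak F_0(M)$ and $P_M:\mathfrak F_0(M)\to\mathfrak F_0(M)$ be linear differential operators, natural on $\mathbf{Loc}$ (i.e. commuting with all $f^*$), with $P$ formally self-adjoint and $PQ=0$. Let $Q^*$ be the formal adjoint of $Q$. The solution complex is $$\mathfrak{Sol}(M)=\big(\mathfrak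 F_1(M)\xleftarrow{\,Q^*\,}\mathfrak F_0(M)\xleftarrow{\,P\,}\mathfrak F_0(M)\xleftarrow{\,Q\,}\mathfrak F_1(M)\big)$$ in degrees $-2,-1,0,1$. For $S\in\{\mathrm c,\mathrm{pc},\mathrm{fc}\}$ let $$\mathfrak L_S(M)=\big(\mathfrak F_{1,S}(M)\xleftarrow{\,-Q^*\,}\mathfrak F_{0,S}(M)\xleftarrow{\,P\,}\mathfrak F_{0,S}(M)\xleftarrow{\,-Q\,}\mathfrak F_{1,S}(M)\big)$$ in degrees $-1,0,1,2$, where $\mathrm c$ denotes compactly supported sections and $\mathrm{pc}$/$\mathrm{fc}$ denotes sections of past/future compact support (supported in $J_M^{\pm}(\Sigma)$ for some Cauchy surface $\Sigma$). Put $\mathfrak L=\mathfrak L_{\mathrm c}$. Let $\iota:\mathfrak L(M)\to\mathfrak L_{\mathrm{pc}/\mathrm{fc}}(M)$ be the inclusion, and let $j_{\mathrm{pc}/\mathrm{fc}}:\mathfrak L_{\mathrm{pc}/\mathrm{fc}}(M)\to\mathfrak{Sol}(M)[1]$ be the chain map given by the inclusions of sections in degrees $-1,0$ and by minus the inclusions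 in degrees $1,2$; here $V[1]_n=V_{n-1}$ with differential $-\mathrm d$. The integration pairings define evaluation chain maps $\langle\cdot,\cdot\rangle:\mathfrak L(M)\otimes\mathfrak{Sol}(M)\to\mathbb R$ and, through the symmetric braiding, $\langle\cdot,\cdot\rangle:\mathfrak{Sol}(M)\otimes\mathfrak L(M)\to\mathbb R$. **Trivializations.** A retarded/advanced trivialization on $M$ is a contracting homotopy $\Lambda^\pm$ of $\mathfrak L_{\mathrm{pc}/\mathrm{fc}}(M)$, i.e. a degree $1$ map with $\mathrm d\Lambda^\pm+\Lambda^\pm\mathrm d=\mathrm{id}$. A pair $\Lambda^\pm$ defines a chain map $$\Lambda:=j_{\mathrm{pc}}\Lambda^+\iota-j_{\mathrm{fc}}\Lambda^-\iota:\mathfrak L(M)\to\mathfrak{Sol}(M),$$ and the pair is compatible if $\langle a,\Lambda b\rangle=-\langle\Lambda a,b\rangle$ for all $a,b\in\mathfrak L(M)$. It then defines the unshifted Poisson structure $\tau(a,b)=\langle a,\Lambda b\rangle$, a graded antisymmetric chain map $\mathfrak L(M)\otimes\mathfrak L(M)\to\mathbb R$. A $\mathbf{Loc}/\overline M$-natural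 compatible pair is a family of compatible pairs $\Lambda_M^\pm$, one for each object $(M\to\overline M)$ of $\mathbf{Loc}/\overline M$, such that $$f^*\,(j_{\mathrm{pc}/\mathrm{fc}}\,\Lambda_N^\pm\,\iota)\,f_*=j_{\mathrm{pc}/\mathrm{fc}}\,\Lambda_M^\pm\,\iota$$ for every morphism $f:M\to N$ of $\mathbf{Loc}/\overline M$. It defines a functor $(\mathfrak L,\tau)$ from $\mathbf{Loc}/\overline M$ to the category of unshifted Poisson complexes, that is, real chain complexes $V$ with a graded antisymmetric chain map $\tau:V\otimes V\to\mathbb R$, with the chain maps preserving $\tau$ as morphisms. **Quantization.** For an unshifted Poisson complex $(V,\tau)$, let $\mathfrak{CCR}(V,\tau)$ be the differential graded unital associative $*$-algebra over $\mathbb C$ given by the tensor algebra of $V\otimes\mathbb C$, with $v^*=v$ for $v\in V$ (and $(ab)^*=(-1)^{|a||b|}b^*a^*$), modulo the relations $$v_1v_2-(-1)^{|v_1||v_2|}v_2v_1=i\,\tau(v_1,v_2)\,\mathbb 1$$ for homogeneous $v_1,v_2\in V$. This is functorial with values in the category $\mathbf{dg}^*\mathbf{Alg}_{\mathbb C}$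 of differential graded unital associative $*$-algebras. A morphism of $\mathbf{Fun}(\mathbf{Loc}/\overline M,\mathbf{dg}^*\mathbf{Alg}_{\mathbb C})$ is a natural weak equivalence if the chain maps underlying all of its components are quasi-isomorphisms. **Statement.** Let $\overline M\in\mathbf{Loc}$, let $\Lambda^\pm$ and $\widetilde\Lambda^\pm$ be two $\mathbf{Loc}/\overline M$-natural compatible pairs of retarded/advanced trivializations, and let $\tau$ and $\widetilde\tau$ be the corresponding $\mathbf{Loc}/\overline M$-natural unshifted Poisson structures. Then the functors $\mathfrak{CCR}(\mathfrak L,\tau)$ and $\mathfrak{CCR}(\mathfrak L,\widetilde\tau)$ are connected by a zig-zag of natural weak equivalences in $\mathbf{Fun}(\mathbf{Loc}/\overline M,\mathbf{dg}^*\mathbf{Alg}_{\mathbb C})$. -/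

import Mathlib

open CategoryTheory

universe u

namespace HomotopyAQFT
open scoped TensorProduct DirectSum

/-! ### Differential graded `*`-algebras over `ℂ` -/

/-- A differential graded unital associative `*`-algebra over `ℂ` (homological grading): a
`ℤ`-graded algebra with a differential of degree `-1` that is a graded derivation, and a
`ℂ`-antilinear, degree preserving involution that commutes with the differential and reverses
products up to the Koszul sign. -/
structure DGStarAlg where
  carrier : Type u
  [ring : Ring carrier]
  [algebra : Algebra ℂ carrier]
  grading : ℤ → Submodule ℂ carrier
  [graded : GradedAlgebra grading]
  d : carrier →ₗ[ℂ] carrier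
  d_mem : ∀ {n : ℤ} {a : carrier}, a ∈ grading n → d a ∈ grading (n - 1)
  d_d : ∀ a, d (d a) = 0
  leibniz : ∀ {n : ℤ} {a : carrier} (b : carrier), a ∈ grading n →
    d (a * b) = d a * b + n.negOnePow • (a * d b)
  star : carrier →ₗ⋆[ℂ] carrier
  star_mem : ∀ {n : ℤ} {a : carrier}, a ∈ grading n → star a ∈ grading n
  star_star : ∀ a, star (star a) = a
  star_mul : ∀ {p q : ℤ} {a b : carrier}, a ∈ grading p → b ∈ grading q →
    star (a * b) = (p * q).negOnePow • (star b * star a)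
  star_d : ∀ a, star (d a) = d (star a)

namespace DGStarAlg

attribute [instance] ring algebra graded

/-- Morphisms of differential graded `*`-algebras: unital algebra homomorphisms that preserve
degrees, the differential and the involution. -/
@[ext]
structure Hom (A B : DGStarAlg.{u}) where
  toAlgHom : A.carrier →ₐ[ℂ] B.carrier
  map_mem : ∀ {n : ℤ} {a : A.carrier}, a ∈ A.grading n → toAlgHom a ∈ B.grading n
  map_d : ∀ a, toAlgHom (A.d a) = B.d (toAlgHom a)
  map_star : ∀ a, toAlgHom (A.star a) = B.star (toAlgHom a)

instance : Category DGStarAlg.{u} where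
  Hom := Hom
  id A := ⟨AlgHom.id ℂ _, fun h => h, fun _ => rfl, fun _ => rfl⟩
  comp f g := ⟨g.toAlgHom.comp f.toAlgHom, fun h => g.map_mem (f.map_mem h),
    fun a => by simp [f.map_d, g.map_d], fun a => by simp [f.map_star, g.map_star]⟩

@[ext]
theorem hom_ext {A B : DGStarAlg.{u}} {f g : A ⟶ B} (h : f.toAlgHom = g.toAlgHom) : f = g :=
  Hom.ext h

/-- The component `A_i → A_j` of the differential (zero unless `j = i - 1`). -/
noncomputable def dComp (A : DGStarAlg.{u}) (i j : ℤ) : A.grading i →ₗ[ℂ] A.grading j where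
  toFun a := DirectSum.decompose A.grading (A.d a) j
  map_add' a b := by simp [DirectSum.decompose_add]
  map_smul' c a := by simp [DirectSum.decompose_smul]; rfl

theorem coe_dComp (A : DGStarAlg.{u}) {i j : ℤ} (h : j + 1 = i) (a : A.grading i) :
    (A.dComp i j a : A.carrier) = A.d a := by
  have := A.d_mem a.2
  rw [show i - 1 = j by omega] at this
  simp [dComp, DirectSum.decompose_of_mem_same A.grading this]

/-- The underlying chain complex of a differential graded `*`-algebra. -/
noncomputable def complex (A : DGStarAlg.{u}) : ChainComplex (ModuleCat.{u} ℂ) ℤ where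
  X n := ModuleCat.of ℂ (A.grading n)
  d i j := ModuleCat.ofHom (A.dComp i j)
  shape i j h := by
    have hne : i - 1 ≠ j := fun e => h (show j + 1 = i by omega)
    refine ModuleCat.hom_ext (LinearMap.ext fun a => Subtype.ext ?_)
    exact DirectSum.decompose_of_mem_ne A.grading (A.d_mem a.2) hne
  d_comp_d' i j k hij hjk := by
    refine ModuleCat.hom_ext (LinearMap.ext fun a => Subtype.ext ?_)
    change (A.dComp j k (A.dComp i j a) : A.carrier) = 0
    rw [coe_dComp A hjk, coe_dComp A hij, A.d_d]

/-- The chain map underlying a morphism of differential graded `*`-algebras. -/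
noncomputable def complexMap {A B : DGStarAlg.{u}} (f : A ⟶ B) : A.complex ⟶ B.complex where
  f n := ModuleCat.ofHom
    ((f.toAlgHom.toLinearMap.restrict (fun _ h => f.map_mem h) : A.grading n →ₗ[ℂ] B.grading n))
  comm' i j hij := by
    refine ModuleCat.hom_ext (LinearMap.ext fun a => Subtype.ext ?_)
    refine (coe_dComp B hij _).trans ?_
    refine ((f.map_d _).symm.trans ?_)
    exact congrArg f.toAlgHom (coe_dComp A hij a).symm

/-- Weak equivalences of differential graded `*`-algebras: the underlying chain map is a
quasi-isomorphism. -/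
def weakEquivalences : MorphismProperty DGStarAlg.{u} := fun _ _ f => QuasiIso (complexMap f)

end DGStarAlg

/-! ### Unshifted Poisson complexes -/

/-- An unshifted Poisson complex: a chain complex `V` of real vector spaces with a chain map
`τ : V ∧ V → ℝ`, i.e. a chain map `V ⊗ V → ℝ` (so it is supported in total degree zero and
annihilates boundaries) that is graded antisymmetric. -/
structure PoCh where
  V : ChainComplex (ModuleCat.{u} ℝ) ℤ
  τ : ∀ p q : ℤ, V.X p →ₗ[ℝ] V.X q →ₗ[ℝ] ℝ
  τ_degree : ∀ (p q : ℤ) (a : V.X p) (b : V.X q), p + q ≠ 0 → τ p q a b = 0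
  τ_d : ∀ (p q : ℤ) (a : V.X p) (b : V.X q),
    τ (p - 1) q (V.d p (p - 1) a) b + p.negOnePow • τ p (q - 1) a (V.d q (q - 1) b) = 0
  τ_antisymm : ∀ (p q : ℤ) (a : V.X p) (b : V.X q),
    τ q p b a = -((p * q).negOnePow • τ p q a b)

namespace PoCh

/-- Morphisms of unshifted Poisson complexes: chain maps preserving the Poisson structures. -/
@[ext]
structure Hom (A B : PoCh.{u}) where
  toChainMap : A.V ⟶ B.V
  map_τ : ∀ (p q : ℤ) (a : A.V.X p) (b : A.V.X q),
    B.τ p q (toChainMap.f p a) (toChainMap.f q b) = A.τ p q a b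

instance : Category PoCh.{u} where
  Hom := Hom
  id A := ⟨𝟙 A.V, fun p q a b => by simp⟩
  comp f g := ⟨f.toChainMap ≫ g.toChainMap, fun p q a b => by
    simp [g.map_τ, f.map_τ]⟩

@[ext]
theorem hom_ext {A B : PoCh.{u}} {f g : A ⟶ B} (h : f.toChainMap = g.toChainMap) : f = g :=
  Hom.ext h

@[simp] theorem id_toChainMap (A : PoCh.{u}) : Hom.toChainMap (𝟙 A) = 𝟙 A.V := rfl
@[simp] theorem comp_toChainMap {A B C : PoCh.{u}} (f : A ⟶ B) (g : B ⟶ C) :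
    Hom.toChainMap (f ≫ g) = f.toChainMap ≫ g.toChainMap := rfl

end PoCh

/-! ### The CCR algebra of an unshifted Poisson complex -/

namespace CCR

variable (P : PoCh.{u})

/-- The complexification `V_ℂ` of a chain complex `V`, as a (direct sum of graded pieces)
complex vector space. -/
abbrev Complexification : Type u := ⨁ n : ℤ, (ℂ ⊗[ℝ] (P.V.X n))

/-- The inclusion of `V_n` into the tensor algebra `⨁ V_ℂ^{⊗ k}`. -/
noncomputable def tgen (n : ℤ) (v : P.V.X n) : TensorAlgebra ℂ (Complexification P) :=
  TensorAlgebra.ι ℂ (DirectSum.lof ℂ ℤ (fun n => (ℂ ⊗[ℝ] (P.V.X n))) n (1 ⊗ₜ v))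

/-- The (graded) canonical commutation relations. -/
inductive Rel : TensorAlgebra ℂ (Complexification P) → TensorAlgebra ℂ (Complexification P) → Prop
  | ccr (p q : ℤ) (v : P.V.X p) (w : P.V.X q) :
      Rel (tgen P p v * tgen P q w - (p * q).negOnePow • (tgen P q w * tgen P p v))
        (algebraMap ℂ _ (Complex.I * (P.τ p q v w : ℝ)))

/-- The algebra underlying `CCR(V, τ)`: the quotient of the tensor algebra by the two-sided ideal
generated by the canonical commutation relations. -/
def Alg : Type u := RingQuot (Rel P)

noncomputable instance : Ring (Alg P) := inferInstanceAs (Ring (RingQuot (Rel P)))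
noncomputable instance : Algebra ℂ (Alg P) := inferInstanceAs (Algebra ℂ (RingQuot (Rel P)))

/-- The quotient map. -/
noncomputable def proj : TensorAlgebra ℂ (Complexification P) →ₐ[ℂ] Alg P :=
  RingQuot.mkAlgHom ℂ (Rel P)

/-- The generator of `CCR(V, τ)` associated with `v ∈ V_n`. -/
noncomputable def gen (n : ℤ) : P.V.X n →ₗ[ℝ] Alg P where
  toFun v := proj P (tgen P n v)
  map_add' v w := by simp [tgen, TensorProduct.tmul_add]
  map_smul' r v := by
    have : (1 : ℂ) ⊗ₜ[ℝ] (r • v) = (r : ℂ) • ((1 : ℂ) ⊗ₜ[ℝ] v) := by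
      rw [TensorProduct.tmul_smul, TensorProduct.smul_tmul', TensorProduct.smul_tmul']; simp
    simp only [tgen, this, map_smul, RingHom.id_apply]
    rw [← Complex.coe_smul]

theorem gen_apply (n : ℤ) (v : P.V.X n) : gen P n v = proj P (tgen P n v) := rfl

theorem gen_ccr (p q : ℤ) (v : P.V.X p) (w : P.V.X q) :
    gen P p v * gen P q w - (p * q).negOnePow • (gen P q w * gen P p v)
      = algebraMap ℂ _ (Complex.I * (P.τ p q v w : ℝ)) := by
  have := RingQuot.mkAlgHom_rel ℂ (Rel.ccr (P := P) p q v w)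
  have h2 : proj P _ = proj P _ := this
  simpa [Units.smul_def, gen_apply] using h2

variable {P}

/-- The universal property of the CCR algebra. -/
noncomputable def lift {B : Type*} [Ring B] [Algebra ℂ B] (φ : ∀ n : ℤ, P.V.X n →ₗ[ℝ] B)
    (h : ∀ (p q : ℤ) (v : P.V.X p) (w : P.V.X q),
      φ p v * φ q w - (p * q).negOnePow • (φ q w * φ p v)
        = algebraMap ℂ B (Complex.I * (P.τ p q v w : ℝ))) : Alg P →ₐ[ℂ] B :=
  RingQuot.liftAlgHom ℂ ⟨TensorAlgebra.lift ℂ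
    (DirectSum.toModule ℂ ℤ B fun n => (φ n).liftBaseChange ℂ), by
    rintro _ _ ⟨p, q, v, w⟩
    simpa [tgen, Units.smul_def] using h p q v w⟩

@[simp] theorem lift_gen {B : Type*} [Ring B] [Algebra ℂ B] (φ : ∀ n : ℤ, P.V.X n →ₗ[ℝ] B)
    (h) (n : ℤ) (v : P.V.X n) : lift φ h (gen P n v) = φ n v := by
  simp only [lift, gen, proj, LinearMap.coe_mk, AddHom.coe_mk]
  erw [RingQuot.liftAlgHom_mkAlgHom_apply]
  simp [tgen]

theorem algHom_ext {B : Type*} [Ring B] [Algebra ℂ B] {f g : Alg P →ₐ[ℂ] B}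
    (h : ∀ (n : ℤ) (v : P.V.X n), f (gen P n v) = g (gen P n v)) : f = g := by
  refine RingQuot.ringQuot_ext' ℂ f g ?_
  refine TensorAlgebra.hom_ext ?_
  refine DirectSum.linearMap_ext ℂ fun n => ?_
  refine TensorProduct.AlgebraTensorModule.curry_injective ?_
  refine LinearMap.ext_ring ?_
  ext v
  exact h n v

end CCR
end HomotopyAQFT

namespace HomotopyAQFT
open scoped TensorProduct DirectSum
namespace CCR
variable (P : PoCh.{u})

/-- The product of the generators in a list of homogeneous elements. -/
noncomputable def word (l : List (Σ n : ℤ, P.V.X n)) : Alg P :=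
  (l.map fun s => gen P s.1 s.2).prod

/-- The degree `n` part of `CCR(V, τ)`: the span of all words of total degree `n`. -/
noncomputable def gr (n : ℤ) : Submodule ℂ (Alg P) :=
  Submodule.span ℂ {x | ∃ l : List (Σ n : ℤ, P.V.X n), (l.map Sigma.fst).sum = n ∧ word P l = x}

theorem word_mem (l : List (Σ n : ℤ, P.V.X n)) : word P l ∈ gr P (l.map Sigma.fst).sum :=
  Submodule.subset_span ⟨l, rfl, rfl⟩

theorem gen_mem (n : ℤ) (v : P.V.X n) : gen P n v ∈ gr P n := by
  simpa [word] using word_mem P [⟨n, v⟩]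

instance : SetLike.GradedMonoid (gr P) where
  one_mem := by simpa [word] using word_mem P []
  mul_mem p q a b ha hb := by
    have : gr P p * gr P q ≤ gr P (p + q) := by
      rw [gr, gr, Submodule.span_mul_span]
      refine Submodule.span_le.2 ?_
      rintro _ ⟨_, ⟨l, hl, rfl⟩, _, ⟨l', hl', rfl⟩, rfl⟩
      have := word_mem P (l ++ l')
      simpa [word, hl, hl'] using this
    exact this (Submodule.mul_mem_mul ha hb)

theorem of_mul_of {p q n : ℤ} (h : p + q = n) (a : gr P p) (b : gr P q) :
    DirectSum.of (fun i => gr P i) p a * DirectSum.of (fun i => gr P i) q b =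
      DirectSum.of (fun i => gr P i) n ⟨a * b, h ▸ SetLike.mul_mem_graded a.2 b.2⟩ := by
  subst h
  exact DirectSum.of_mul_of _ _

/-- The decomposition of the CCR algebra into its homogeneous parts. -/
noncomputable def decomposeHom : Alg P →ₐ[ℂ] ⨁ n, gr P n :=
  lift (fun n =>
    { toFun := fun v => DirectSum.of (fun i => gr P i) n ⟨gen P n v, gen_mem P n v⟩
      map_add' := fun v w => by
        rw [← map_add]; congr 1; exact Subtype.ext (map_add (gen P n) v w)
      map_smul' := fun r v => by
        have : (⟨gen P n (r • v), gen_mem P n _⟩ : gr P n) = (r : ℂ) • ⟨gen P n v, gen_mem P n v⟩ :=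
          Subtype.ext (by simp)
        rw [this, ← DirectSum.lof_eq_of ℂ, map_smul]; rfl })
    (fun p q v w => by
      have h2 := gen_ccr P p q v w
      simp only [LinearMap.coe_mk, AddHom.coe_mk]
      rw [of_mul_of P rfl, of_mul_of P (add_comm q p), Units.smul_def,
        ← map_zsmul (DirectSum.of (fun i => gr P i) (p + q))]
      refine (map_sub (DirectSum.lof ℂ ℤ (fun i => gr P i) (p + q)) _ _).symm.trans ?_
      rw [DirectSum.lof_eq_of]
      by_cases h : p + q = 0
      · rw [DirectSum.algebraMap_apply]
        refine DirectSum.of_eq_of_gradedMonoid_eq (Sigma.subtype_ext h ?_)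
        rw [Units.smul_def] at h2
        exact h2
      · have h0 := P.τ_degree p q v w h
        rw [h0] at h2 ⊢
        simp only [Complex.ofReal_zero, mul_zero, map_zero] at h2 ⊢
        rw [← map_zero (DirectSum.of (fun i => gr P i) (p + q))]
        congr 1
        exact Subtype.ext (by simpa [Units.smul_def] using h2))

@[simp] theorem decomposeHom_gen (n : ℤ) (v : P.V.X n) :
    decomposeHom P (gen P n v) = DirectSum.of (fun i => gr P i) n ⟨gen P n v, gen_mem P n v⟩ := by
  simp [decomposeHom]

theorem decomposeHom_word (l : List (Σ n : ℤ, P.V.X n)) :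
    decomposeHom P (word P l) = DirectSum.of (fun i => gr P i) _ ⟨word P l, word_mem P l⟩ := by
  induction l with
  | nil => simp only [word, List.map_nil, List.prod_nil, map_one]; rfl
  | cons s l ih =>
    have : word P (s :: l) = gen P s.1 s.2 * word P l := by simp [word]
    refine (congrArg (decomposeHom P) this).trans ?_
    rw [map_mul, ih, decomposeHom_gen, of_mul_of P (n := (List.map Sigma.fst (s :: l)).sum)
      (by simp)]
    simp only [this]

noncomputable instance : GradedAlgebra (gr P) :=
  GradedAlgebra.ofAlgHom (gr P) (decomposeHom P)
    (algHom_ext fun n v => by simp)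
    (fun i x => by
      obtain ⟨x, hx⟩ := x
      simp only
      induction hx using Submodule.span_induction with
      | mem x h =>
        obtain ⟨l, rfl, rfl⟩ := h
        exact decomposeHom_word P l
      | zero => rw [map_zero]; exact (map_zero (DirectSum.of (fun i => gr P i) i)).symm
      | add x y hx hy ihx ihy => rw [map_add, ihx, ihy, ← map_add]; rfl
      | smul c x hx ih => rw [map_smul, ih, ← DirectSum.lof_eq_of ℂ, ← map_smul]; rfl)

end CCR
end HomotopyAQFT

namespace HomotopyAQFT
open scoped TensorProduct DirectSum
namespace CCR
variable (P : PoCh.{u})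

variable {P} in
theorem induction {C : Alg P → Prop} (h0 : ∀ c : ℂ, C (algebraMap ℂ _ c))
    (hg : ∀ (n : ℤ) (v : P.V.X n), C (gen P n v)) (ha : ∀ a b, C a → C b → C (a + b))
    (hm : ∀ a b, C a → C b → C (a * b)) (a : Alg P) : C a := by
  let S : Subalgebra ℂ (Alg P) :=
    { carrier := {a | C a}
      mul_mem' := fun {a b} => hm a b
      add_mem' := fun {a b} => ha a b
      algebraMap_mem' := h0 }
  let φ : Alg P →ₐ[ℂ] S := lift
    (fun n => { toFun := fun v => ⟨gen P n v, hg n v⟩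
                map_add' := fun v w => Subtype.ext (map_add (gen P n) v w)
                map_smul' := fun r v => Subtype.ext (map_smul (gen P n) r v) })
    (fun p q v w => Subtype.ext (by
      have h2 := gen_ccr P p q v w
      rw [Units.smul_def] at h2 ⊢
      exact h2))
  have h : S.val.comp φ = AlgHom.id ℂ _ := algHom_ext fun n v => by
    rw [AlgHom.comp_apply, lift_gen]; rfl
  have h2 := AlgHom.congr_fun h a
  rw [← AlgHom.id_apply (R := ℂ) a, ← h2]
  exact (φ a).2

theorem map_units_smul {A B : Type*} [AddCommGroup A] [AddCommGroup B] (f : A →+ B) (ε : ℤˣ)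
    (a : A) : f (ε • a) = ε • f a := by
  rw [Units.smul_def, Units.smul_def, map_zsmul]

/-- The additive map `r ↦ i r 1`. -/
noncomputable def scal : ℝ →+ Alg P where
  toFun r := algebraMap ℂ _ (Complex.I * (r : ℝ))
  map_zero' := by simp
  map_add' r s := by simp [mul_add]

theorem gen_mul_eq (p q : ℤ) (v : P.V.X p) (w : P.V.X q) :
    gen P p v * gen P q w = (p * q).negOnePow • (gen P q w * gen P p v)
      + algebraMap ℂ _ (Complex.I * (P.τ p q v w : ℝ)) := by
  rw [← gen_ccr P p q v w]; abel

/-- The parity automorphism, multiplication by `(-1)^n` in degree `n`. -/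
noncomputable def parity : Alg P →ₐ[ℂ] Alg P :=
  lift (fun n => n.negOnePow • gen P n) (fun p q v w => by
    have h2 := gen_ccr P p q v w
    by_cases h : p + q = 0
    · obtain rfl : q = -p := by omega
      have hs : ∀ x : Alg P, (p.negOnePow : ℤˣ) • p.negOnePow • x = x := fun x => by
        rw [smul_smul, Int.units_mul_self, one_smul]
      simp only [LinearMap.smul_apply, smul_mul_smul_comm, Int.negOnePow_neg,
        Int.units_mul_self, one_smul]
      exact h2
    · have h0 := P.τ_degree p q v w h
      rw [h0] at h2 ⊢
      simp only [Complex.ofReal_zero, mul_zero, map_zero] at h2 ⊢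
      simp only [LinearMap.smul_apply, smul_mul_smul_comm]
      rw [sub_eq_zero] at h2
      rw [h2, smul_comm, mul_comm p.negOnePow, sub_self])

@[simp] theorem parity_gen (n : ℤ) (v : P.V.X n) :
    parity P (gen P n v) = n.negOnePow • gen P n v := by simp [parity]

/-- Induction on homogeneous elements of `CCR(V, τ)`. -/
theorem gr_induction {C : ℤ → Alg P → Prop}
    (h1 : C 0 1) (hmul : ∀ (p n : ℤ) (v : P.V.X p) (a : Alg P), a ∈ gr P n → C n a →
      C (p + n) (gen P p v * a))
    (h0 : ∀ n, C n 0) (ha : ∀ n a b, C n a → C n b → C n (a + b))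
    (hs : ∀ n (c : ℂ) a, C n a → C n (c • a)) {n : ℤ} {a : Alg P} (h : a ∈ gr P n) : C n a := by
  have hw : ∀ l : List (Σ n : ℤ, P.V.X n), C (l.map Sigma.fst).sum (word P l) := by
    intro l
    induction l with
    | nil => simpa [word] using h1
    | cons s l ih => simpa [word] using hmul s.1 _ s.2 _ (word_mem P l) ih
  induction h using Submodule.span_induction with
  | mem x h =>
    obtain ⟨l, rfl, rfl⟩ := h
    exact hw l
  | zero => exact h0 n
  | add x y _ _ hx hy => exact ha n x y hx hy
  | smul c x _ hx => exact hs n c x hx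

theorem parity_of_mem {n : ℤ} {a : Alg P} (h : a ∈ gr P n) : parity P a = n.negOnePow • a := by
  refine gr_induction P (C := fun n a => parity P a = n.negOnePow • a) ?_ ?_ ?_ ?_ ?_ h
  · simp
  · intro p n v a _ ih
    rw [map_mul, parity_gen, ih, smul_mul_smul_comm, Int.negOnePow_add]
  · simp
  · intro n a b h1 h2; rw [map_add, h1, h2, smul_add]
  · intro n c a h1; rw [map_smul, h1, smul_comm]

theorem upper_add {A : Type*} [Ring A] (a a' b b' c c' : A) :
    !![a + a', b + b'; 0, c + c'] = !![a, b; 0, c] + !![a', b'; 0, c'] := by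
  ext i j; fin_cases i <;> fin_cases j <;> simp

theorem upper_smul {A : Type*} [Ring A] [Module ℝ A] (r : ℝ) (a b c : A) :
    !![r • a, r • b; 0, r • c] = r • !![a, b; 0, c] := by
  ext i j; fin_cases i <;> fin_cases j <;> simp

theorem upper_rel {A : Type*} [Ring A] [Algebra ℂ A] {a x a' b y b' : A} {ε : ℤˣ} {c : ℂ}
    (h1 : a * b - ε • (b * a) = algebraMap ℂ A c)
    (h2 : a * y + x * b' - ε • (b * x + y * a') = 0)
    (h3 : a' * b' - ε • (b' * a') = algebraMap ℂ A c) :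
    !![a, x; 0, a'] * !![b, y; 0, b'] - ε • (!![b, y; 0, b'] * !![a, x; 0, a']) =
      algebraMap ℂ (Matrix (Fin 2) (Fin 2) A) c := by
  rw [Matrix.mul_fin_two, Matrix.mul_fin_two]
  ext i j; fin_cases i <;> fin_cases j
  · simpa [Units.smul_def, Matrix.algebraMap_matrix_apply] using h1
  · simpa [Units.smul_def, Matrix.algebraMap_matrix_apply] using h2
  · simp [Units.smul_def, Matrix.algebraMap_matrix_apply]
  · simpa [Units.smul_def, Matrix.algebraMap_matrix_apply] using h3

theorem dHom_rel (p q : ℤ) (v : P.V.X p) (w : P.V.X q) :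
    p.negOnePow • gen P p v * gen P (q - 1) (P.V.d q (q - 1) w)
      + gen P (p - 1) (P.V.d p (p - 1) v) * gen P q w
      - (p * q).negOnePow • (q.negOnePow • gen P q w * gen P (p - 1) (P.V.d p (p - 1) v)
      + gen P (q - 1) (P.V.d q (q - 1) w) * gen P p v) = 0 := by
  have h2 := gen_mul_eq P (p - 1) q (P.V.d p (p - 1) v) w
  have h3 := gen_mul_eq P p (q - 1) v (P.V.d q (q - 1) w)
  have h4 := P.τ_d p q v w
  have s1 : ((p - 1) * q).negOnePow = (p * q).negOnePow * q.negOnePow := by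
    rw [sub_mul, one_mul, Int.negOnePow_sub]
  have s2 : (p * (q - 1)).negOnePow = (p * q).negOnePow * p.negOnePow := by
    rw [mul_sub, mul_one, Int.negOnePow_sub]
  rw [smul_mul_assoc, smul_mul_assoc, h2, h3, s1, s2, smul_add, smul_add, smul_smul, smul_smul,
    mul_left_comm, Int.units_mul_self, mul_one]
  have : algebraMap ℂ (Alg P)
        (Complex.I * (P.τ (p - 1) q (P.V.d p (p - 1) v) w : ℝ))
      + p.negOnePow • algebraMap ℂ (Alg P)
        (Complex.I * (P.τ p (q - 1) v (P.V.d q (q - 1) w) : ℝ)) = 0 := by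
    have h7 := congrArg (scal P) h4
    rwa [map_add, map_units_smul, map_zero] at h7
  refine Eq.trans ?_ this
  abel

/-- The algebra map `a ↦ (parity a, d a; 0, a)` used to define the differential. -/
noncomputable def dHom : Alg P →ₐ[ℂ] Matrix (Fin 2) (Fin 2) (Alg P) :=
  lift (fun n =>
    { toFun := fun v => !![n.negOnePow • gen P n v, gen P (n - 1) (P.V.d n (n - 1) v);
                           0, gen P n v]
      map_add' := fun v w => by
        rw [map_add, map_add, map_add, smul_add, upper_add]
      map_smul' := fun r v => by
        rw [map_smul, map_smul, map_smul, smul_comm n.negOnePow r (gen P n v), upper_smul]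
        rfl })
    (fun p q v w => upper_rel (by
        have h5 := congrArg (parity P) (gen_ccr P p q v w)
        rw [map_sub, map_mul, parity_gen, parity_gen, AlgHom.commutes,
          Units.smul_def (p * q).negOnePow, map_zsmul, map_mul, parity_gen, parity_gen,
          ← Units.smul_def] at h5
        exact h5)
      (dHom_rel P p q v w) (gen_ccr P p q v w))

end CCR
end HomotopyAQFT

namespace HomotopyAQFT
open scoped TensorProduct DirectSum
namespace CCR
variable (P : PoCh.{u})

theorem dHom_apply (a : Alg P) :
    dHom P a 0 0 = parity P a ∧ dHom P a 1 0 = 0 ∧ dHom P a 1 1 = a := by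
  induction a using CCR.induction with
  | h0 c => simp [Matrix.algebraMap_matrix_apply]
  | hg n v => simp [dHom]
  | ha a b iha ihb => simp [iha, ihb]
  | hm a b iha ihb => simp [Matrix.mul_apply, Fin.sum_univ_two, iha, ihb]

/-- The differential of `CCR(V, τ)`: the graded derivation extending the differential of `V`. -/
noncomputable def d : Alg P →ₗ[ℂ] Alg P where
  toFun a := dHom P a 0 1
  map_add' a b := by simp
  map_smul' c a := by simp

@[simp] theorem d_gen (n : ℤ) (v : P.V.X n) :
    d P (gen P n v) = gen P (n - 1) (P.V.d n (n - 1) v) := by simp [d, dHom]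

theorem d_mul (a b : Alg P) : d P (a * b) = d P a * b + parity P a * d P b := by
  simp [d, Matrix.mul_apply, Fin.sum_univ_two, dHom_apply, add_comm]

theorem d_algebraMap (c : ℂ) : d P (algebraMap ℂ _ c) = 0 := by
  simp [d, Matrix.algebraMap_matrix_apply]

theorem leibniz {n : ℤ} {a : Alg P} (b : Alg P) (h : a ∈ gr P n) :
    d P (a * b) = d P a * b + n.negOnePow • (a * d P b) := by
  rw [d_mul, parity_of_mem P h, smul_mul_assoc]

theorem d_one : d P 1 = 0 := by simpa using d_algebraMap P 1

theorem d_mem {n : ℤ} {a : Alg P} (h : a ∈ gr P n) : d P a ∈ gr P (n - 1) := by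
  refine gr_induction P (C := fun n a => d P a ∈ gr P (n - 1)) ?_ ?_ ?_ ?_ ?_ h
  · rw [d_one]; exact Submodule.zero_mem _
  · intro p n v a ha ih
    rw [leibniz P a (gen_mem P p v), d_gen]
    refine Submodule.add_mem _ ?_ ?_
    · have := SetLike.mul_mem_graded (gen_mem P (p - 1) (P.V.d p (p - 1) v)) ha
      rwa [show p - 1 + n = p + n - 1 by ring] at this
    · have := SetLike.mul_mem_graded (gen_mem P p v) ih
      rw [show p + (n - 1) = p + n - 1 by ring] at this
      rw [Units.smul_def]
      exact zsmul_mem this _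
  · intro n; rw [map_zero]; exact Submodule.zero_mem _
  · intro n a b ha hb; rw [map_add]; exact Submodule.add_mem _ ha hb
  · intro n c a ha; rw [map_smul]; exact Submodule.smul_mem _ _ ha

theorem d_d_of_mem {n : ℤ} {a : Alg P} (h : a ∈ gr P n) : d P (d P a) = 0 := by
  refine gr_induction P (C := fun n a => d P (d P a) = 0) ?_ ?_ ?_ ?_ ?_ h
  · rw [d_one, map_zero]
  · intro p n v a ha ih
    have hz : P.V.d (p - 1) (p - 1 - 1) (P.V.d p (p - 1) v) = 0 := by
      have := P.V.d_comp_d p (p - 1) (p - 1 - 1)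
      exact congrArg (fun f => f.hom v) this
    have hu := map_units_smul (d P).toAddMonoidHom p.negOnePow (gen P p v * d P a)
    simp only [LinearMap.toAddMonoidHom_coe] at hu
    rw [leibniz P a (gen_mem P p v), d_gen, map_add, hu, leibniz P _ (gen_mem P p v), ih,
      leibniz P _ (gen_mem P (p - 1) _), d_gen, hz, d_gen, Int.negOnePow_sub]
    simp
  · intro n; simp
  · intro n a b ha hb; rw [map_add, map_add, ha, hb, add_zero]
  · intro n c a ha; rw [map_smul, map_smul, ha, smul_zero]

open Classical in
variable {P} in
theorem ext_of_mem {B : Type*} [AddCommGroup B] {f g : Alg P →+ B}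
    (h : ∀ (n : ℤ) (a : Alg P), a ∈ gr P n → f a = g a) (a : Alg P) : f a = g a := by
  rw [← DirectSum.sum_support_decompose (gr P) a, map_sum, map_sum]
  exact Finset.sum_congr rfl fun i _ => h i _ (SetLike.coe_mem _)

theorem d_d (a : Alg P) : d P (d P a) = 0 :=
  ext_of_mem (f := (d P ∘ₗ d P).toAddMonoidHom) (g := 0)
    (fun _ _ h => d_d_of_mem P h) a

/-- The opposite algebra with the conjugate complex structure. -/
def ConjOp (A : Type*) : Type _ := Aᵐᵒᵖ

noncomputable instance (A : Type*) [Ring A] : Ring (ConjOp A) := inferInstanceAs (Ring Aᵐᵒᵖ)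

/-- The additive identification of `A` with its conjugate opposite algebra. -/
def toConjOp {A : Type*} [Ring A] : A ≃+ ConjOp A := MulOpposite.opAddEquiv

theorem toConjOp_mul {A : Type*} [Ring A] (a b : A) :
    toConjOp (a * b) = toConjOp b * toConjOp a := rfl

noncomputable instance (A : Type*) [Ring A] [Algebra ℂ A] : Algebra ℂ (ConjOp A) :=
  RingHom.toAlgebra'
    { toFun := fun c => toConjOp (algebraMap ℂ A (starRingEnd ℂ c))
      map_one' := by rw [map_one, map_one]; rfl
      map_mul' := fun a b => by rw [← toConjOp_mul, mul_comm a, map_mul, map_mul]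
      map_zero' := by simp
      map_add' := fun a b => by simp }
    (fun c x => by
      obtain ⟨x, rfl⟩ := (toConjOp (A := A)).surjective x
      change toConjOp _ * toConjOp x = toConjOp x * toConjOp _
      rw [← toConjOp_mul, ← toConjOp_mul, Algebra.commutes])

theorem algebraMap_conjOp {A : Type*} [Ring A] [Algebra ℂ A] (c : ℂ) :
    algebraMap ℂ (ConjOp A) c = toConjOp (algebraMap ℂ A (starRingEnd ℂ c)) := rfl

theorem toConjOp_smul {A : Type*} [Ring A] [Algebra ℂ A] (c : ℂ) (a : A) :
    toConjOp (c • a) = (starRingEnd ℂ c) • toConjOp a := by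
  rw [Algebra.smul_def (A := ConjOp A), algebraMap_conjOp, Complex.conj_conj, ← toConjOp_mul,
    ← Algebra.commutes, ← Algebra.smul_def]

/-- The sign `(-1)^{n(n-1)/2}` picked up by reversing `n` odd elements. -/
def revSign (n : ℤ) : ℤˣ := (n * (n - 1) / 2).negOnePow

theorem revSign_add (p q : ℤ) :
    revSign (p + q) = (p * q).negOnePow * (revSign p * revSign q) := by
  have hp : (2 : ℤ) ∣ p * (p - 1) := (Int.even_mul_pred_self p).two_dvd
  have hq : (2 : ℤ) ∣ q * (q - 1) := (Int.even_mul_pred_self q).two_dvd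
  obtain ⟨a, ha⟩ := hp
  obtain ⟨b, hb⟩ := hq
  have hpq : (p + q) * (p + q - 1) = 2 * (p * q + (a + b)) := by linear_combination ha + hb
  rw [revSign, revSign, revSign, ha, hb, hpq]
  simp [Int.negOnePow_add]

@[simp] theorem revSign_zero : revSign 0 = 1 := by simp [revSign]

theorem revSign_mul_self (p : ℤ) : revSign p * revSign p = 1 := Int.units_mul_self _

/-- The antilinear anti-automorphism `v ↦ (-1)^{n(n-1)/2} v`, `v ∈ V_n`. -/
noncomputable def dagger : Alg P →ₐ[ℂ] ConjOp (Alg P) :=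
  lift (fun n =>
    { toFun := fun v => toConjOp (revSign n • gen P n v)
      map_add' := fun v w => by simp
      map_smul' := fun r v => by
        have h : revSign n • gen P n (r • v) = (r : ℂ) • revSign n • gen P n v := by
          rw [map_smul, smul_comm, Complex.coe_smul]
        rw [h, toConjOp_smul, Complex.conj_ofReal]; rfl })
    (fun p q v w => by
      have h2 := gen_ccr P q p w v
      have hu : ∀ (ε : ℤˣ) (a : Alg P), ε • toConjOp a = toConjOp (ε • a) := fun ε a =>
        (map_units_smul (toConjOp (A := Alg P)).toAddMonoidHom ε a).symm
      simp only [LinearMap.coe_mk, AddHom.coe_mk]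
      rw [← toConjOp_mul, ← toConjOp_mul, smul_mul_smul_comm, smul_mul_smul_comm,
        hu, mul_comm p q, mul_comm (revSign p) (revSign q), smul_comm, ← map_sub, ← smul_sub, h2,
        P.τ_antisymm p q v w]
      have h3 : algebraMap ℂ (ConjOp (Alg P)) (Complex.I * (P.τ p q v w : ℝ)) =
        toConjOp (algebraMap ℂ _ (-(Complex.I * (P.τ p q v w : ℝ)))) := by
        rw [algebraMap_conjOp]; simp
      rw [h3]
      congr 1
      by_cases h : p + q = 0
      · have hs : revSign q * revSign p * (p * q).negOnePow = 1 := by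
          rw [mul_comm (revSign q), mul_comm, ← revSign_add, h, revSign_zero]
        have : algebraMap ℂ (Alg P)
            (Complex.I * ((-((p * q).negOnePow • P.τ p q v w) : ℝ) : ℂ)) =
          (p * q).negOnePow • algebraMap ℂ (Alg P) (-(Complex.I * (P.τ p q v w : ℝ))) := by
          refine (map_neg (scal P) _).trans ?_
          rw [map_units_smul, map_neg, smul_neg]; rfl
        rw [this, smul_smul, hs, one_smul]
      · simp [P.τ_degree p q v w h])

@[simp] theorem dagger_gen (n : ℤ) (v : P.V.X n) :
    dagger P (gen P n v) = toConjOp (revSign n • gen P n v) := by simp [dagger]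

end CCR
end HomotopyAQFT

namespace HomotopyAQFT
open scoped TensorProduct DirectSum
namespace CCR
variable (P : PoCh.{u})

theorem toConjOp_units {A : Type*} [Ring A] (ε : ℤˣ) (a : A) :
    toConjOp (ε • a) = ε • toConjOp a :=
  map_units_smul (toConjOp (A := A)).toAddMonoidHom ε a

/-- The operator multiplying the degree `n` part by `(-1)^{n(n-1)/2}`. -/
noncomputable def revOp : Alg P →ₗ[ℂ] Alg P :=
  DirectSum.toModule ℂ ℤ (Alg P) (fun n => revSign n • (gr P n).subtype) ∘ₗ
    (DirectSum.decomposeLinearEquiv (gr P)).toLinearMap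

theorem revOp_of_mem {n : ℤ} {a : Alg P} (h : a ∈ gr P n) : revOp P a = revSign n • a := by
  have h1 : DirectSum.decompose (gr P) a = DirectSum.lof ℂ ℤ (fun n => gr P n) n ⟨a, h⟩ :=
    DirectSum.decompose_of_mem (gr P) h
  simp only [revOp, LinearMap.comp_apply, LinearEquiv.coe_coe,
    DirectSum.decomposeLinearEquiv_apply]
  rw [h1, DirectSum.toModule_lof]
  rfl

/-- The `*`-involution of `CCR(V, τ)`: it is antilinear, reverses products up to the Koszul sign,
and satisfies `v^* = v` for `v ∈ V`. -/
noncomputable def star : Alg P →ₗ⋆[ℂ] Alg P where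
  toFun a := revOp P (toConjOp.symm (dagger P a))
  map_add' a b := by simp
  map_smul' c a := by
    have : toConjOp.symm (c • dagger P a) = (starRingEnd ℂ c) • toConjOp.symm (dagger P a) := by
      rw [AddEquiv.symm_apply_eq, toConjOp_smul, Complex.conj_conj, AddEquiv.apply_symm_apply]
    rw [map_smul, this, map_smul]

theorem dagger_mem {n : ℤ} {a : Alg P} (h : a ∈ gr P n) :
    toConjOp.symm (dagger P a) ∈ gr P n := by
  refine gr_induction P (C := fun n a => toConjOp.symm (dagger P a) ∈ gr P n) ?_ ?_ ?_ ?_ ?_ h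
  · rw [map_one]
    exact SetLike.GradedOne.one_mem
  · intro p n v a ha ih
    have : toConjOp.symm (dagger P (gen P p v * a)) =
        revSign p • (toConjOp.symm (dagger P a) * gen P p v) := by
      rw [AddEquiv.symm_apply_eq, toConjOp_units, toConjOp_mul, AddEquiv.apply_symm_apply,
        map_mul, dagger_gen, toConjOp_units, smul_mul_assoc]
    rw [this, Units.smul_def]
    have h2 := SetLike.mul_mem_graded ih (gen_mem P p v)
    rw [add_comm] at h2
    exact zsmul_mem h2 _
  · intro n; rw [map_zero, map_zero]; exact Submodule.zero_mem _
  · intro n a b ha hb; rw [map_add, map_add]; exact Submodule.add_mem _ ha hb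
  · intro n c a ha
    have : toConjOp.symm (c • dagger P a) = (starRingEnd ℂ c) • toConjOp.symm (dagger P a) := by
      rw [AddEquiv.symm_apply_eq, toConjOp_smul, Complex.conj_conj, AddEquiv.apply_symm_apply]
    rw [map_smul, this]
    exact Submodule.smul_mem _ _ ha

theorem star_of_mem {n : ℤ} {a : Alg P} (h : a ∈ gr P n) :
    star P a = revSign n • toConjOp.symm (dagger P a) :=
  revOp_of_mem P (dagger_mem P h)

theorem star_mem {n : ℤ} {a : Alg P} (h : a ∈ gr P n) : star P a ∈ gr P n := by
  rw [star_of_mem P h, Units.smul_def]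
  exact zsmul_mem (dagger_mem P h) _

@[simp] theorem star_gen (n : ℤ) (v : P.V.X n) : star P (gen P n v) = gen P n v := by
  rw [star_of_mem P (gen_mem P n v), dagger_gen, AddEquiv.symm_apply_apply, smul_smul,
    revSign_mul_self, one_smul]

theorem star_one : star P 1 = 1 := by
  rw [star_of_mem P SetLike.GradedOne.one_mem, map_one, revSign_zero, one_smul]; rfl

theorem star_mul {p q : ℤ} {a b : Alg P} (ha : a ∈ gr P p) (hb : b ∈ gr P q) :
    star P (a * b) = (p * q).negOnePow • (star P b * star P a) := by
  rw [star_of_mem P (SetLike.mul_mem_graded ha hb), star_of_mem P ha, star_of_mem P hb,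
    smul_mul_smul_comm, smul_smul, mul_comm (revSign q), ← revSign_add]
  congr 1
  rw [AddEquiv.symm_apply_eq, toConjOp_mul, AddEquiv.apply_symm_apply, AddEquiv.apply_symm_apply,
    map_mul]

theorem star_units (ε : ℤˣ) (a : Alg P) : star P (ε • a) = ε • star P a :=
  map_units_smul (star P).toAddMonoidHom ε a

theorem d_units (ε : ℤˣ) (a : Alg P) : d P (ε • a) = ε • d P a :=
  map_units_smul (d P).toAddMonoidHom ε a

theorem star_star (a : Alg P) : star P (star P a) = a := by
  refine ext_of_mem (f := (star P).toAddMonoidHom.comp (star P).toAddMonoidHom)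
    (g := AddMonoidHom.id _) (fun n a h => ?_) a
  change star P (star P a) = a
  refine gr_induction P (C := fun n a => star P (star P a) = a) ?_ ?_ ?_ ?_ ?_ h
  · rw [star_one, star_one]
  · intro p n v a ha ih
    rw [star_mul P (gen_mem P p v) ha, star_units, star_gen,
      star_mul P (star_mem P ha) (gen_mem P p v), ih, star_gen, smul_smul, mul_comm n p,
      Int.units_mul_self, one_smul]
  · intro n; simp
  · intro n a b ha hb; rw [map_add, map_add, ha, hb]
  · intro n c a ha; rw [LinearMap.map_smulₛₗ, LinearMap.map_smulₛₗ, ha, Complex.conj_conj]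

theorem star_d (a : Alg P) : star P (d P a) = d P (star P a) := by
  refine ext_of_mem (f := (star P).toAddMonoidHom.comp (d P).toAddMonoidHom)
    (g := (d P).toAddMonoidHom.comp (star P).toAddMonoidHom) (fun n a h => ?_) a
  change star P (d P a) = d P (star P a)
  refine gr_induction P (C := fun n a => star P (d P a) = d P (star P a)) ?_ ?_ ?_ ?_ ?_ h
  · rw [star_one, d_one, map_zero]
  · intro p n v a ha ih
    have s1 : ((p - 1) * n).negOnePow = (p * n).negOnePow * n.negOnePow := by
      rw [sub_mul, one_mul, Int.negOnePow_sub]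
    have s2 : p.negOnePow * (p * (n - 1)).negOnePow = (p * n).negOnePow := by
      rw [mul_sub, mul_one, Int.negOnePow_sub, mul_left_comm, Int.units_mul_self, mul_one]
    rw [leibniz P a (gen_mem P p v), d_gen, map_add, star_units,
      star_mul P (gen_mem P (p - 1) _) ha, star_mul P (gen_mem P p v) (d_mem P ha),
      star_mul P (gen_mem P p v) ha, d_units, leibniz P _ (star_mem P ha), star_gen, star_gen,
      d_gen, ih, smul_smul, s1, s2, smul_add, smul_smul, add_comm]
  · intro n; simp
  · intro n a b ha hb; rw [map_add, map_add, ha, hb, map_add, map_add]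
  · intro n c a ha; rw [map_smul, LinearMap.map_smulₛₗ, LinearMap.map_smulₛₗ, ha, map_smul]

/-- The differential graded `*`-algebra `CCR(V, τ)`. -/
noncomputable def obj : DGStarAlg.{u} where
  carrier := Alg P
  grading := gr P
  d := d P
  d_mem := d_mem P
  d_d := d_d P
  leibniz := leibniz P
  star := star P
  star_mem := star_mem P
  star_star := star_star P
  star_mul := star_mul P
  star_d := star_d P

variable {P} {P' P'' : PoCh.{u}}

/-- The algebra map induced by a morphism of unshifted Poisson complexes. -/
noncomputable def mapAlg (f : P ⟶ P') : Alg P →ₐ[ℂ] Alg P' :=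
  lift (fun n => gen P' n ∘ₗ (f.toChainMap.f n).hom) (fun p q v w => by
    have := gen_ccr P' p q (f.toChainMap.f p v) (f.toChainMap.f q w)
    rw [f.map_τ] at this
    exact this)

@[simp] theorem mapAlg_gen (f : P ⟶ P') (n : ℤ) (v : P.V.X n) :
    mapAlg f (gen P n v) = gen P' n (f.toChainMap.f n v) := by
  rw [mapAlg, lift_gen]; rfl

theorem mapAlg_mem (f : P ⟶ P') {n : ℤ} {a : Alg P} (h : a ∈ gr P n) :
    mapAlg f a ∈ gr P' n := by
  refine gr_induction P (C := fun n a => mapAlg f a ∈ gr P' n) ?_ ?_ ?_ ?_ ?_ h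
  · rw [map_one]; exact SetLike.GradedOne.one_mem
  · intro p n v a ha ih
    rw [map_mul, mapAlg_gen]
    exact SetLike.mul_mem_graded (gen_mem P' p _) ih
  · intro n; rw [map_zero]; exact Submodule.zero_mem _
  · intro n a b ha hb; rw [map_add]; exact Submodule.add_mem _ ha hb
  · intro n c a ha; rw [map_smul]; exact Submodule.smul_mem _ _ ha

theorem mapAlg_units (f : P ⟶ P') (ε : ℤˣ) (a : Alg P) : mapAlg f (ε • a) = ε • mapAlg f a :=
  map_units_smul (mapAlg f).toLinearMap.toAddMonoidHom ε a

theorem mapAlg_d (f : P ⟶ P') (a : Alg P) : mapAlg f (d P a) = d P' (mapAlg f a) := by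
  refine ext_of_mem (f := (mapAlg f).toLinearMap.toAddMonoidHom.comp (d P).toAddMonoidHom)
    (g := (d P').toAddMonoidHom.comp (mapAlg f).toLinearMap.toAddMonoidHom) (fun n a h => ?_) a
  change mapAlg f (d P a) = d P' (mapAlg f a)
  refine gr_induction P (C := fun n a => mapAlg f (d P a) = d P' (mapAlg f a)) ?_ ?_ ?_ ?_ ?_ h
  · rw [d_one, map_zero, map_one (mapAlg f), d_one]
  · intro p n v a ha ih
    have hc : f.toChainMap.f (p - 1) (P.V.d p (p - 1) v) =
        P'.V.d p (p - 1) (f.toChainMap.f p v) := by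
      have := f.toChainMap.comm p (p - 1)
      exact (congrArg (fun f => f.hom v) this).symm
    rw [leibniz P a (gen_mem P p v), d_gen, map_add, map_mul, map_mul, mapAlg_units, mapAlg_gen,
      mapAlg_gen, leibniz P' _ (gen_mem P' p _), d_gen, map_mul, mapAlg_gen, ih, hc]
  · intro n; simp
  · intro n a b ha hb; rw [map_add, map_add, ha, hb, map_add, map_add]
  · intro n c a ha; rw [map_smul, map_smul, map_smul, map_smul, ha]

theorem mapAlg_star (f : P ⟶ P') (a : Alg P) : mapAlg f (star P a) = star P' (mapAlg f a) := by
  refine ext_of_mem (f := (mapAlg f).toLinearMap.toAddMonoidHom.comp (star P).toAddMonoidHom)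
    (g := (star P').toAddMonoidHom.comp (mapAlg f).toLinearMap.toAddMonoidHom)
    (fun n a h => ?_) a
  change mapAlg f (star P a) = star P' (mapAlg f a)
  refine gr_induction P (C := fun n a => mapAlg f (star P a) = star P' (mapAlg f a))
    ?_ ?_ ?_ ?_ ?_ h
  · rw [star_one, map_one (mapAlg f), star_one]
  · intro p n v a ha ih
    rw [star_mul P (gen_mem P p v) ha, mapAlg_units, map_mul, star_gen, ih, map_mul, mapAlg_gen,
      star_mul P' (gen_mem P' p _) (mapAlg_mem f ha), star_gen]
  · intro n; simp
  · intro n a b ha hb; rw [map_add, map_add, ha, hb, map_add, map_add]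
  · intro n c a ha; rw [LinearMap.map_smulₛₗ, map_smul, map_smul, LinearMap.map_smulₛₗ, ha]

end CCR

/-- The CCR quantization functor. -/
noncomputable def ccrFunctor : PoCh.{u} ⥤ DGStarAlg.{u} where
  obj := CCR.obj
  map f := ⟨CCR.mapAlg f, CCR.mapAlg_mem f, CCR.mapAlg_d f, CCR.mapAlg_star f⟩
  map_id P := DGStarAlg.hom_ext (CCR.algHom_ext fun n v => by
    refine (CCR.mapAlg_gen _ n v).trans ?_
    rfl)
  map_comp f g := DGStarAlg.hom_ext (CCR.algHom_ext fun n v => by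
    refine (CCR.mapAlg_gen _ n v).trans ?_
    refine Eq.trans ?_ (congrArg (CCR.mapAlg g) (CCR.mapAlg_gen f n v)).symm
    refine Eq.trans ?_ (CCR.mapAlg_gen g n _).symm
    rfl)

/-! ### Natural weak equivalences -/

/-- Natural weak equivalences between functors to differential graded `*`-algebras: all components
are weak equivalences. -/
def natWeakEquivalences (C : Type*) [Category C] : MorphismProperty (C ⥤ DGStarAlg.{u}) :=
  fun _ _ η => ∀ X : C, DGStarAlg.weakEquivalences (η.app X)

/-- Two functors are related by a (finite) zig-zag of natural weak equivalences. -/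
def NatZigzag {C : Type*} [Category C] (F G : C ⥤ DGStarAlg.{u}) : Prop :=
  Relation.EqvGen (fun F G : C ⥤ DGStarAlg.{u} => ∃ η : F ⟶ G, natWeakEquivalences C η) F G

end HomotopyAQFT

namespace HomotopyAQFT
open scoped TensorProduct DirectSum Manifold ContDiff Topology

/-! ### Globally hyperbolic Lorentzian manifolds -/

/-- An oriented and time-oriented Lorentzian manifold of dimension `m` (smooth, Hausdorff, second
countable, without boundary; not necessarily connected). The metric has signature `(+,-,…,-)`: there
are timelike vectors (`T`), and the metric is negative definite on the orthogonal complement of each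
timelike vector. The time-orientation is represented by a timelike vector field `T`. -/
structure LorentzManifold (m : ℕ) where
  carrier : Type u
  [topology : TopologicalSpace carrier]
  [charted : ChartedSpace (EuclideanSpace ℝ (Fin m)) carrier]
  [manifold : IsManifold (𝓡 m) ∞ carrier]
  [hausdorff : T2Space carrier]
  [secondCountable : SecondCountableTopology carrier]
  /-- the Lorentzian metric -/
  g : ∀ x : carrier, TangentSpace (𝓡 m) x →L[ℝ] TangentSpace (𝓡 m) x →L[ℝ] ℝ
  g_smooth : ContMDiff (𝓡 m)
    ((𝓡 m).prod 𝓘(ℝ, EuclideanSpace ℝ (Fin m) →L[ℝ] EuclideanSpace ℝ (Fin m) →L[ℝ] ℝ)) ∞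
    (fun x => Bundle.TotalSpace.mk'
      (EuclideanSpace ℝ (Fin m) →L[ℝ] EuclideanSpace ℝ (Fin m) →L[ℝ] ℝ)
      (E := fun x : carrier => TangentSpace (𝓡 m) x →L[ℝ] TangentSpace (𝓡 m) x →L[ℝ] ℝ) x (g x))
  g_symm : ∀ x v w, g x v w = g x w v
  g_neg : ∀ x v w, 0 < g x v v → g x v w = 0 → w ≠ 0 → g x w w < 0
  /-- the orientation -/
  orientation : ∀ x : carrier, Orientation ℝ (TangentSpace (𝓡 m) x) (Fin m)
  /-- the orientation is locally constant in local trivializations of the tangent bundle -/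
  orientation_locallyConstant : ∀ x₀ : carrier, ∀ᶠ x in 𝓝 x₀, ∃ hx :
      x ∈ (trivializationAt (EuclideanSpace ℝ (Fin m)) (TangentSpace (𝓡 m)) x₀).baseSet,
    Orientation.map (Fin m) ((trivializationAt (EuclideanSpace ℝ (Fin m))
        (TangentSpace (𝓡 m)) x₀).continuousLinearEquivAt ℝ x hx).toLinearEquiv (orientation x) =
      Orientation.map (Fin m) ((trivializationAt (EuclideanSpace ℝ (Fin m))
        (TangentSpace (𝓡 m)) x₀).continuousLinearEquivAt ℝ x₀
          (FiberBundle.mem_baseSet_trivializationAt' x₀)).toLinearEquiv (orientation x₀)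
  /-- a future directed timelike vector field -/
  T : ∀ x : carrier, TangentSpace (𝓡 m) x
  T_smooth : ContMDiff (𝓡 m) ((𝓡 m).prod 𝓘(ℝ, EuclideanSpace ℝ (Fin m))) ∞
    (fun x => Bundle.TotalSpace.mk' (EuclideanSpace ℝ (Fin m))
      (E := fun x : carrier => TangentSpace (𝓡 m) x) x (T x))
  T_timelike : ∀ x, 0 < g x (T x) (T x)

attribute [instance] LorentzManifold.topology LorentzManifold.charted LorentzManifold.manifold
  LorentzManifold.hausdorff LorentzManifold.secondCountable

namespace LorentzManifold

variable {m : ℕ}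

instance : CoeSort (LorentzManifold.{u} m) (Type u) := ⟨carrier⟩

/-- Future directed causal vectors. -/
def FutureCausal (M : LorentzManifold.{u} m) (x : M) (v : TangentSpace (𝓡 m) x) : Prop :=
  0 ≤ M.g x v v ∧ 0 < M.g x (M.T x) v

/-- Future directed timelike vectors. -/
def FutureTimelike (M : LorentzManifold.{u} m) (x : M) (v : TangentSpace (𝓡 m) x) : Prop :=
  0 < M.g x v v ∧ 0 < M.g x (M.T x) v

/-- The velocity of a curve `γ` (relative to the parameter domain `s`) at parameter `t`. -/
noncomputable def velocity (M : LorentzManifold.{u} m) (γ : ℝ → M) (s : Set ℝ) (t : ℝ) :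
    TangentSpace (𝓡 m) (γ t) :=
  mfderivWithin 𝓘(ℝ, ℝ) (𝓡 m) γ s t (1 : ℝ)

/-- `γ : [a,b] → M` is a future directed causal `C¹`-curve. -/
def IsCausalCurve (M : LorentzManifold.{u} m) (γ : ℝ → M) (a b : ℝ) : Prop :=
  a < b ∧ ContMDiffOn 𝓘(ℝ, ℝ) (𝓡 m) 1 γ (Set.Icc a b) ∧
    ∀ t ∈ Set.Icc a b, M.FutureCausal (γ t) (M.velocity γ (Set.Icc a b) t)

/-- The causal relation: `q` can be reached from `p` along a future directed causal curve that
is piecewise `C¹` (or `q = p`). -/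
def CausalLE (M : LorentzManifold.{u} m) : M → M → Prop :=
  Relation.ReflTransGen fun p q => ∃ (γ : ℝ → M) (a b : ℝ),
    M.IsCausalCurve γ a b ∧ γ a = p ∧ γ b = q

/-- The causal future `J⁺(S)`. -/
def causalFuture (M : LorentzManifold.{u} m) (S : Set M) : Set M := {q | ∃ p ∈ S, M.CausalLE p q}

/-- The causal past `J⁻(S)`. -/
def causalPast (M : LorentzManifold.{u} m) (S : Set M) : Set M := {p | ∃ q ∈ S, M.CausalLE p q}

/-- A subset is causally convex if it contains all causal curves connecting two of its points. -/
def CausallyConvex (M : LorentzManifold.{u} m) (U : Set M) : Prop :=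
  ∀ p ∈ U, ∀ q ∈ U, ∀ z, M.CausalLE p z → M.CausalLE z q → z ∈ U

/-- An inextendible future directed timelike `C¹`-curve. -/
def IsInextendibleTimelike (M : LorentzManifold.{u} m) (γ : ℝ → M) : Prop :=
  ContMDiff 𝓘(ℝ, ℝ) (𝓡 m) 1 γ ∧ (∀ t, M.FutureTimelike (γ t) (M.velocity γ Set.univ t)) ∧
    (¬ ∃ x, Filter.Tendsto γ Filter.atTop (𝓝 x)) ∧ ¬ ∃ x, Filter.Tendsto γ Filter.atBot (𝓝 x)

/-- A Cauchy surface: a subset that is met exactly once by each inextendible timelike curve. -/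
def IsCauchySurface (M : LorentzManifold.{u} m) (S : Set M) : Prop :=
  ∀ γ : ℝ → M, M.IsInextendibleTimelike γ → ∃! t, γ t ∈ S

/-- Global hyperbolicity: there exists a Cauchy surface. -/
def GloballyHyperbolic (M : LorentzManifold.{u} m) : Prop := ∃ S, M.IsCauchySurface S

theorem futureCausal_or (M : LorentzManifold.{u} m) {x : M} {v : TangentSpace (𝓡 m) x}
    (h : 0 ≤ M.g x v v) (hv : v ≠ 0) : M.FutureCausal x v ∨ M.FutureCausal x (-v) := by
  rcases lt_trichotomy (M.g x (M.T x) v) 0 with h1 | h1 | h1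
  · exact Or.inr ⟨by simpa using h, by simpa using h1⟩
  · exact absurd (M.g_neg x _ v (M.T_timelike x) h1 hv) (not_lt.2 h)
  · exact Or.inl ⟨h, h1⟩

theorem FutureCausal.ne_zero {M : LorentzManifold.{u} m} {x : M} {v : TangentSpace (𝓡 m) x}
    (h : M.FutureCausal x v) : v ≠ 0 := by
  rintro rfl
  simpa using h.2

/-- Morphisms `M → N`: orientation and time-orientation preserving isometric open embeddings with
causally convex image. -/
@[ext]
structure Hom (M N : LorentzManifold.{u} m) where
  toFun : M → N
  diffeo : IsLocalDiffeomorph (𝓡 m) (𝓡 m) ∞ toFun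
  injective : Function.Injective toFun
  isometric : ∀ x v w, N.g (toFun x) (mfderiv (𝓡 m) (𝓡 m) toFun x v)
    (mfderiv (𝓡 m) (𝓡 m) toFun x w) = M.g x v w
  orientation : ∀ x, Orientation.map (Fin m)
    (diffeo.mfderivToContinuousLinearEquiv (by simp) x).toLinearEquiv (M.orientation x) =
      N.orientation (toFun x)
  timeOrientation : ∀ x v, M.FutureCausal x v →
    N.FutureCausal (toFun x) (mfderiv (𝓡 m) (𝓡 m) toFun x v)
  convex : N.CausallyConvex (Set.range toFun)

namespace Hom

variable {M N K : LorentzManifold.{u} m}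

theorem contMDiff (f : Hom M N) : ContMDiff (𝓡 m) (𝓡 m) ∞ f.toFun := f.diffeo.contMDiff

theorem mdiff (f : Hom M N) : MDifferentiable (𝓡 m) (𝓡 m) f.toFun :=
  f.diffeo.mdifferentiable (by simp)

theorem isOpenEmbedding (f : Hom M N) : Topology.IsOpenEmbedding f.toFun :=
  .of_continuous_injective_isOpenMap f.contMDiff.continuous f.injective f.diffeo.isOpenMap

theorem futureCausal_iff (f : Hom M N) (x : M) (v : TangentSpace (𝓡 m) x) :
    N.FutureCausal (f.toFun x) (mfderiv (𝓡 m) (𝓡 m) f.toFun x v) ↔ M.FutureCausal x v := by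
  refine ⟨fun h => ?_, f.timeOrientation x v⟩
  have h0 : 0 ≤ M.g x v v := by rw [← f.isometric]; exact h.1
  have hv : v ≠ 0 := by
    rintro rfl
    exact h.ne_zero (map_zero _)
  rcases M.futureCausal_or h0 hv with h1 | h1
  · exact h1
  · have h2 := (f.timeOrientation x _ h1).2
    rw [map_neg, map_neg] at h2
    have := h.2
    linarith

/-- the inverse of a morphism, defined on the image -/
noncomputable def inv (f : Hom M N) [Nonempty M] : N → M := Function.invFun f.toFun

theorem inv_apply (f : Hom M N) [Nonempty M] (x : M) : f.inv (f.toFun x) = x :=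
  Function.leftInverse_invFun f.injective x

theorem inv_eventuallyEq (f : Hom M N) [Nonempty M] (x : M) :
    f.inv =ᶠ[𝓝 (f.toFun x)] (f.diffeo x).localInverse := by
  have h := (f.diffeo x).localInverse_eventuallyEq_right
  filter_upwards [h] with y hy
  have hy' : f.toFun ((f.diffeo x).localInverse y) = y := hy
  rw [← hy', f.inv_apply, hy']

theorem contMDiffAt_inv (f : Hom M N) [Nonempty M] (x : M) :
    ContMDiffAt (𝓡 m) (𝓡 m) ∞ f.inv (f.toFun x) :=
  ((f.diffeo x).localInverse_contMDiffAt).congr_of_eventuallyEq (f.inv_eventuallyEq x)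

end Hom

end LorentzManifold
end HomotopyAQFT

namespace HomotopyAQFT
open scoped TensorProduct DirectSum Manifold ContDiff Topology
namespace LorentzManifold
variable {m : ℕ}

theorem uniqueMDiff_Icc {a b t : ℝ} (hab : a < b) (ht : t ∈ Set.Icc a b) :
    UniqueMDiffWithinAt 𝓘(ℝ, ℝ) (Set.Icc a b) t :=
  (uniqueDiffOn_Icc hab t ht).uniqueMDiffWithinAt

theorem IsCausalCurve.mdiff {M : LorentzManifold.{u} m} {γ : ℝ → M} {a b : ℝ}
    (h : M.IsCausalCurve γ a b) {t : ℝ} (ht : t ∈ Set.Icc a b) :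
    MDifferentiableWithinAt 𝓘(ℝ, ℝ) (𝓡 m) γ (Set.Icc a b) t :=
  (h.2.1 t ht).mdifferentiableWithinAt (by simp)

/-- Restriction of a causal curve. -/
theorem IsCausalCurve.mono {M : LorentzManifold.{u} m} {γ : ℝ → M} {a b a' b' : ℝ}
    (h : M.IsCausalCurve γ a b) (ha : a ≤ a') (hab : a' < b') (hb : b' ≤ b) :
    M.IsCausalCurve γ a' b' := by
  have hs : Set.Icc a' b' ⊆ Set.Icc a b := Set.Icc_subset_Icc ha hb
  refine ⟨hab, h.2.1.mono hs, fun t ht => ?_⟩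
  have := h.2.2 t (hs ht)
  have e : M.velocity γ (Set.Icc a' b') t = M.velocity γ (Set.Icc a b) t := by
    unfold velocity
    rw [mfderivWithin_subset hs (uniqueMDiff_Icc hab ht) (h.mdiff (hs ht))]
  rw [e]
  exact this

theorem IsCausalCurve.le {M : LorentzManifold.{u} m} {γ : ℝ → M} {a b : ℝ}
    (h : M.IsCausalCurve γ a b) : M.CausalLE (γ a) (γ b) :=
  Relation.ReflTransGen.single ⟨γ, a, b, h, rfl, rfl⟩

theorem IsCausalCurve.le_left {M : LorentzManifold.{u} m} {γ : ℝ → M} {a b : ℝ}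
    (h : M.IsCausalCurve γ a b) {t : ℝ} (ht : t ∈ Set.Icc a b) : M.CausalLE (γ a) (γ t) := by
  rcases ht.1.eq_or_lt with rfl | h1
  · exact Relation.ReflTransGen.refl
  · exact (h.mono le_rfl h1 ht.2).le

theorem IsCausalCurve.le_right {M : LorentzManifold.{u} m} {γ : ℝ → M} {a b : ℝ}
    (h : M.IsCausalCurve γ a b) {t : ℝ} (ht : t ∈ Set.Icc a b) : M.CausalLE (γ t) (γ b) := by
  rcases ht.2.eq_or_lt with rfl | h1
  · exact Relation.ReflTransGen.refl
  · exact (h.mono ht.1 h1 le_rfl).le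

namespace Hom
variable {M N K : LorentzManifold.{u} m}

/-- A causal curve within the image of a morphism lifts. -/
theorem lift_curve (f : Hom M N) [Nonempty M] {γ : ℝ → N} {a b : ℝ} (h : N.IsCausalCurve γ a b)
    (him : ∀ t ∈ Set.Icc a b, γ t ∈ Set.range f.toFun) :
    M.IsCausalCurve (fun t => f.inv (γ t)) a b := by
  have key : ∀ t ∈ Set.Icc a b, f.toFun (f.inv (γ t)) = γ t := by
    intro t ht
    obtain ⟨x, hx⟩ := him t ht
    rw [← hx, f.inv_apply]
  have hinv : ∀ t ∈ Set.Icc a b, ContMDiffAt (𝓡 m) (𝓡 m) 1 f.inv (γ t) := by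
    intro t ht
    obtain ⟨x, hx⟩ := him t ht
    rw [← hx]
    exact (f.contMDiffAt_inv x).of_le (by simp)
  have hc : ContMDiffOn 𝓘(ℝ, ℝ) (𝓡 m) 1 (fun t => f.inv (γ t)) (Set.Icc a b) := fun t ht =>
    (hinv t ht).comp_contMDiffWithinAt t (h.2.1 t ht)
  refine ⟨h.1, hc, fun t ht => ?_⟩
  rw [← f.futureCausal_iff]
  have h2 := h.2.2 t ht
  have hd : MDifferentiableWithinAt 𝓘(ℝ, ℝ) (𝓡 m) (fun t => f.inv (γ t)) (Set.Icc a b) t :=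
    (hc t ht).mdifferentiableWithinAt (by simp)
  have e : mfderivWithin 𝓘(ℝ, ℝ) (𝓡 m) (f.toFun ∘ fun t => f.inv (γ t)) (Set.Icc a b) t =
      (mfderiv (𝓡 m) (𝓡 m) f.toFun (f.inv (γ t))).comp
        (mfderivWithin 𝓘(ℝ, ℝ) (𝓡 m) (fun t => f.inv (γ t)) (Set.Icc a b) t) :=
    mfderiv_comp_mfderivWithin t (f.mdiff _) hd (uniqueMDiff_Icc h.1 ht)
  have e2 : mfderivWithin 𝓘(ℝ, ℝ) (𝓡 m) (f.toFun ∘ fun t => f.inv (γ t)) (Set.Icc a b) t =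
      mfderivWithin 𝓘(ℝ, ℝ) (𝓡 m) γ (Set.Icc a b) t :=
    mfderivWithin_congr (fun s hs => key s hs) (key t ht)
  have e3 : mfderiv (𝓡 m) (𝓡 m) f.toFun (f.inv (γ t))
      (M.velocity (fun t => f.inv (γ t)) (Set.Icc a b) t) = N.velocity γ (Set.Icc a b) t := by
    have := congrArg (fun L => L (1 : ℝ)) (e.symm.trans e2)
    exact this
  have gen : ∀ (y : N) (hy : y = γ t) (v : TangentSpace (𝓡 m) y)
      (hv : v = N.velocity γ (Set.Icc a b) t), N.FutureCausal y v := by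
    rintro y rfl v rfl
    exact h2
  exact gen _ (key t ht) _ e3

/-- Morphisms reflect the causal relation. -/
theorem causalLE_of_map (f : Hom M N) {p q : M} (h : N.CausalLE (f.toFun p) (f.toFun q)) :
    M.CausalLE p q := by
  have : Nonempty M := ⟨p⟩
  suffices H : ∀ y, N.CausalLE (f.toFun p) y → N.CausalLE y (f.toFun q) →
      M.CausalLE p (f.inv y) by
    have := H _ h Relation.ReflTransGen.refl
    rwa [f.inv_apply] at this
  intro y hy
  induction hy with
  | refl => intro _; rw [f.inv_apply]; exact Relation.ReflTransGen.refl
  | tail h1 h2 ih =>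
    intro h3
    obtain ⟨γ, a, b, hγ, rfl, rfl⟩ := h2
    refine (ih (hγ.le.trans h3)).trans ?_
    refine (f.lift_curve hγ fun t ht => ?_).le
    exact f.convex _ ⟨p, rfl⟩ _ ⟨q, rfl⟩ _ (Relation.ReflTransGen.trans h1 (hγ.le_left ht))
      ((hγ.le_right ht).trans h3)

theorem mfderiv_comp' (f : Hom M N) (g : Hom N K) (x : M) :
    mfderiv (𝓡 m) (𝓡 m) (g.toFun ∘ f.toFun) x =
      (mfderiv (𝓡 m) (𝓡 m) g.toFun (f.toFun x)).comp (mfderiv (𝓡 m) (𝓡 m) f.toFun x) :=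
  mfderiv_comp x (g.mdiff _) (f.mdiff _)

theorem _root_.HomotopyAQFT.orientation_map_congr {V W : Type*} [AddCommGroup V] [Module ℝ V]
    [AddCommGroup W] [Module ℝ W] {n : ℕ} {e e' : V ≃ₗ[ℝ] W} (h : ∀ v, e v = e' v)
    (o : Orientation ℝ V (Fin n)) : Orientation.map (Fin n) e o = Orientation.map (Fin n) e' o := by
  rw [LinearEquiv.ext h]

theorem _root_.HomotopyAQFT.orientation_map_map {V W U : Type*} [AddCommGroup V] [Module ℝ V]
    [AddCommGroup W] [Module ℝ W] [AddCommGroup U] [Module ℝ U] {n : ℕ} (e : V ≃ₗ[ℝ] W)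
    (e' : W ≃ₗ[ℝ] U) (o : Orientation ℝ V (Fin n)) :
    Orientation.map (Fin n) e' (Orientation.map (Fin n) e o) =
      Orientation.map (Fin n) (e.trans e') o := by
  induction o using Module.Ray.ind with
  | h v hv =>
    rw [Orientation.map_apply, Orientation.map_apply, Orientation.map_apply]
    congr 1

/-- The identity morphism. -/
def id (M : LorentzManifold.{u} m) : Hom M M where
  toFun x := x
  diffeo := (Diffeomorph.refl (𝓡 m) M ∞).isLocalDiffeomorph
  injective := fun _ _ h => h
  isometric x v w := by
    have : mfderiv (𝓡 m) (𝓡 m) (fun x : M => x) x = .id ℝ _ := mfderiv_id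
    rw [this]; rfl
  orientation x := by
    have : mfderiv (𝓡 m) (𝓡 m) (fun x : M => x) x = .id ℝ _ := mfderiv_id
    refine Eq.trans (orientation_map_congr (e' := LinearEquiv.refl ℝ _) (fun v => ?_) _) ?_
    · change mfderiv (𝓡 m) (𝓡 m) (fun x : M => x) x v = v
      rw [this]; rfl
    · rw [Orientation.map_refl]; rfl
  timeOrientation x v h := by
    have : mfderiv (𝓡 m) (𝓡 m) (fun x : M => x) x = .id ℝ _ := mfderiv_id
    rw [this]; exact h
  convex := fun p _ q _ z _ _ => ⟨z, rfl⟩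

/-- Composition of morphisms. -/
def comp (f : Hom M N) (g : Hom N K) : Hom M K where
  toFun := g.toFun ∘ f.toFun
  diffeo := fun x => IsLocalDiffeomorphAt.comp (hf := f.diffeo x) (hg := g.diffeo _)
  injective := g.injective.comp f.injective
  isometric x v w := by
    rw [mfderiv_comp']
    exact (g.isometric _ _ _).trans (f.isometric _ _ _)
  orientation x := by
    refine Eq.trans ?_ (g.orientation (f.toFun x))
    rw [← f.orientation x, orientation_map_map]
    refine orientation_map_congr (fun v => ?_) _
    change mfderiv (𝓡 m) (𝓡 m) (g.toFun ∘ f.toFun) x v =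
      mfderiv (𝓡 m) (𝓡 m) g.toFun (f.toFun x) (mfderiv (𝓡 m) (𝓡 m) f.toFun x v)
    rw [mfderiv_comp']; rfl
  timeOrientation x v h := by
    rw [mfderiv_comp']
    exact g.timeOrientation _ _ (f.timeOrientation _ _ h)
  convex := by
    rintro _ ⟨p, rfl⟩ _ ⟨q, rfl⟩ z h1 h2
    obtain ⟨z, rfl⟩ := g.convex _ ⟨_, rfl⟩ _ ⟨_, rfl⟩ z h1 h2
    obtain ⟨z, rfl⟩ := f.convex _ ⟨p, rfl⟩ _ ⟨q, rfl⟩ z (g.causalLE_of_map h1)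
      (g.causalLE_of_map h2)
    exact ⟨z, rfl⟩

end Hom
end LorentzManifold

/-- The category `Loc` of oriented and time-oriented globally hyperbolic Lorentzian manifolds of
dimension `m`. -/
structure Loc (m : ℕ) extends LorentzManifold.{u} m where
  globallyHyperbolic : toLorentzManifold.GloballyHyperbolic

instance (m : ℕ) : Category (Loc.{u} m) where
  Hom M N := LorentzManifold.Hom M.toLorentzManifold N.toLorentzManifold
  id M := LorentzManifold.Hom.id M.toLorentzManifold
  comp f g := LorentzManifold.Hom.comp f g
  id_comp _ := rfl
  comp_id _ := rfl
  assoc _ _ _ := rfl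

end HomotopyAQFT

namespace HomotopyAQFT
open scoped TensorProduct DirectSum Manifold ContDiff Topology
namespace LorentzManifold
open MeasureTheory
variable {m : ℕ}

/-! ### The volume measure -/

instance (M : LorentzManifold.{u} m) : MeasurableSpace M := borel M
instance (M : LorentzManifold.{u} m) : BorelSpace M := ⟨rfl⟩

/-- The map `ℝᵐ → T_x M` sending the standard basis to the coordinate vectors at `x` of the
preferred chart at `x₀` (zero outside of the chart domain). -/
noncomputable def coord (M : LorentzManifold.{u} m) (x₀ x : M) :
    EuclideanSpace ℝ (Fin m) →L[ℝ] TangentSpace (𝓡 m) x :=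
  (trivializationAt (EuclideanSpace ℝ (Fin m)) (TangentSpace (𝓡 m)) x₀).symmL ℝ x

/-- The standard basis of `ℝᵐ`. -/
noncomputable def stdBasis (m : ℕ) : Module.Basis (Fin m) ℝ (EuclideanSpace ℝ (Fin m)) :=
  (EuclideanSpace.basisFun (Fin m) ℝ).toBasis

/-- The Gram matrix of the metric in the preferred chart at `x₀`. -/
noncomputable def gram (M : LorentzManifold.{u} m) (x₀ x : M) : Matrix (Fin m) (Fin m) ℝ :=
  .of fun i j => M.g x (M.coord x₀ x (stdBasis m i)) (M.coord x₀ x (stdBasis m j))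

/-- The density `√|det g|` in the preferred chart at `x₀`. -/
noncomputable def density (M : LorentzManifold.{u} m) (x₀ x : M) : ℝ :=
  Real.sqrt |(M.gram x₀ x).det|

/-- The volume measure `√|det g| dx¹⋯dxᵐ` on the domain of the preferred chart at `x₀`. -/
noncomputable def chartVolume (M : LorentzManifold.{u} m) (x₀ : M) : Measure M :=
  (((volume : Measure (EuclideanSpace ℝ (Fin m))).restrict (chartAt _ x₀).target).withDensity
    fun u => ENNReal.ofReal (M.density x₀ ((chartAt _ x₀).symm u))).map (chartAt _ x₀).symm

theorem mem_baseSet {M : LorentzManifold.{u} m} {x₀ x : M}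
    (hx : x ∈ (chartAt (EuclideanSpace ℝ (Fin m)) x₀).source) :
    x ∈ (trivializationAt (EuclideanSpace ℝ (Fin m)) (TangentSpace (𝓡 m)) x₀).baseSet := hx

theorem smoothOn_coord (M : LorentzManifold.{u} m) (x₀ : M) (i : Fin m) :
    ContMDiffOn (𝓡 m) ((𝓡 m).prod 𝓘(ℝ, EuclideanSpace ℝ (Fin m))) ∞
      (fun x => Bundle.TotalSpace.mk' (EuclideanSpace ℝ (Fin m))
      (E := fun x : M => TangentSpace (𝓡 m) x) x (M.coord x₀ x (stdBasis m i)))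
      (chartAt (EuclideanSpace ℝ (Fin m)) x₀).source := by
  have := (trivializationAt (EuclideanSpace ℝ (Fin m)) (TangentSpace (𝓡 m))
    x₀).contMDiffOn_localFrame_baseSet (I := 𝓡 m) ∞ (stdBasis m) i
  refine this.congr fun x hx => ?_
  rw [Bundle.Trivialization.localFrame_apply_of_mem_baseSet _ _ hx]
  simp [Bundle.Trivialization.basisAt, coord, Bundle.Trivialization.symmL_apply _ hx]

theorem smoothOn_gram (M : LorentzManifold.{u} m) (x₀ : M) (i j : Fin m) :
    ContMDiffOn (𝓡 m) 𝓘(ℝ, ℝ) ∞ (fun x => M.gram x₀ x i j)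
      (chartAt (EuclideanSpace ℝ (Fin m)) x₀).source := by
  intro x hx
  have : ContMDiffWithinAt (𝓡 m) ((𝓡 m).prod 𝓘(ℝ)) ∞
      (fun y => Bundle.TotalSpace.mk' ℝ (E := Bundle.Trivial M ℝ) y
        (M.g y (M.coord x₀ y (stdBasis m i)) (M.coord x₀ y (stdBasis m j))))
      (chartAt (EuclideanSpace ℝ (Fin m)) x₀).source x := by
    apply ContMDiffWithinAt.clm_bundle_apply₂ (F₁ := EuclideanSpace ℝ (Fin m))
      (F₂ := EuclideanSpace ℝ (Fin m))
    · exact M.g_smooth.contMDiffAt.contMDiffWithinAt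
    · exact M.smoothOn_coord x₀ i x hx
    · exact M.smoothOn_coord x₀ j x hx
  simp only [Bundle.contMDiffWithinAt_totalSpace] at this
  exact this.2

theorem g_nondegenerate (M : LorentzManifold.{u} m) {x : M} {v : TangentSpace (𝓡 m) x}
    (h : ∀ w, M.g x v w = 0) : v = 0 := by
  by_contra hv
  have h1 : M.g x (M.T x) v = 0 := by rw [M.g_symm, h]
  have := M.g_neg x _ v (M.T_timelike x) h1 hv
  rw [h] at this
  exact lt_irrefl _ this

/-- the metric pulled back to `ℝᵐ` along the preferred chart at `x₀` -/
noncomputable def coordForm (M : LorentzManifold.{u} m) (x₀ x : M) :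
    LinearMap.BilinForm ℝ (EuclideanSpace ℝ (Fin m)) :=
  LinearMap.mk₂ ℝ (fun v w => M.g x (M.coord x₀ x v) (M.coord x₀ x w))
    (by intros; simp) (by intros; simp) (by intros; simp) (by intros; simp)

theorem gram_eq (M : LorentzManifold.{u} m) (x₀ x : M) :
    M.gram x₀ x = LinearMap.BilinForm.toMatrix (stdBasis m) (M.coordForm x₀ x) := by
  ext i j
  simp [gram, coordForm]

theorem coord_bijective (M : LorentzManifold.{u} m) {x₀ x : M}
    (hx : x ∈ (chartAt (EuclideanSpace ℝ (Fin m)) x₀).source) :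
    Function.Bijective (M.coord x₀ x) := by
  refine Function.bijective_iff_has_inverse.2 ⟨(trivializationAt (EuclideanSpace ℝ (Fin m))
    (TangentSpace (𝓡 m)) x₀).continuousLinearMapAt ℝ x, fun v => ?_, fun v => ?_⟩
  · exact Bundle.Trivialization.continuousLinearMapAt_symmL (R := ℝ) _ (mem_baseSet hx) v
  · exact Bundle.Trivialization.symmL_continuousLinearMapAt (R := ℝ) _ (mem_baseSet hx) v

theorem det_gram_ne_zero (M : LorentzManifold.{u} m) {x₀ x : M}
    (hx : x ∈ (chartAt (EuclideanSpace ℝ (Fin m)) x₀).source) : (M.gram x₀ x).det ≠ 0 := by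
  rw [gram_eq]
  refine (LinearMap.BilinForm.nondegenerate_iff_det_ne_zero (stdBasis m)).1 ?_
  have key : ∀ v, (∀ w, M.coordForm x₀ x v w = 0) → v = 0 := by
    intro v hv
    refine (M.coord_bijective hx).1 ?_
    rw [map_zero]
    refine M.g_nondegenerate fun w => ?_
    obtain ⟨w, rfl⟩ := (M.coord_bijective hx).2 w
    exact hv w
  refine ⟨fun v hv => key v hv, fun v hv => key v fun w => ?_⟩
  have := hv w
  exact (M.g_symm x _ _).trans this

theorem smoothOn_density (M : LorentzManifold.{u} m) (x₀ : M) :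
    ContMDiffOn (𝓡 m) 𝓘(ℝ, ℝ) ∞ (M.density x₀)
      (chartAt (EuclideanSpace ℝ (Fin m)) x₀).source := by
  have hdet : ContMDiffOn (𝓡 m) 𝓘(ℝ, ℝ) ∞ (fun x => (M.gram x₀ x).det)
      (chartAt (EuclideanSpace ℝ (Fin m)) x₀).source := by
    simp only [Matrix.det_apply']
    refine contMDiffOn_finsetSum fun σ _ => ?_
    have : ContMDiffOn (𝓡 m) 𝓘(ℝ, ℝ) ∞ (fun x => ∏ i, M.gram x₀ x (σ i) i)
        (chartAt (EuclideanSpace ℝ (Fin m)) x₀).source :=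
      contMDiffOn_finsetProd fun i _ => M.smoothOn_gram x₀ _ _
    exact contMDiffOn_const.mul this
  intro x hx
  have h0 := M.det_gram_ne_zero hx
  have : ContDiffAt ℝ ∞ (fun t : ℝ => Real.sqrt |t|) ((M.gram x₀ x).det) := by
    exact (contDiffAt_abs h0).sqrt (abs_pos.2 h0).ne'
  exact ContMDiffAt.comp_contMDiffWithinAt (g := fun t : ℝ => Real.sqrt |t|) x this.contMDiffAt (hdet x hx)

theorem density_pos (M : LorentzManifold.{u} m) {x₀ x : M}
    (hx : x ∈ (chartAt (EuclideanSpace ℝ (Fin m)) x₀).source) : 0 < M.density x₀ x :=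
  Real.sqrt_pos.2 (abs_pos.2 (M.det_gram_ne_zero hx))

theorem aemeasurable_chart_symm (M : LorentzManifold.{u} m) (x₀ : M) :
    AEMeasurable (chartAt (EuclideanSpace ℝ (Fin m)) x₀).symm
      (((volume : Measure (EuclideanSpace ℝ (Fin m))).restrict (chartAt _ x₀).target).withDensity
        fun u => ENNReal.ofReal (M.density x₀ ((chartAt _ x₀).symm u))) := by
  refine AEMeasurable.mono_ac ?_ (withDensity_absolutelyContinuous _ _)
  exact ((chartAt _ x₀).continuousOn_symm).aemeasurable (chartAt _ x₀).open_target.measurableSet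

theorem chartVolume_apply (M : LorentzManifold.{u} m) (x₀ : M) {A : Set M} (hA : MeasurableSet A) :
    M.chartVolume x₀ A =
      ∫⁻ u in (chartAt (EuclideanSpace ℝ (Fin m)) x₀).symm ⁻¹' A ∩
        (chartAt (EuclideanSpace ℝ (Fin m)) x₀).target,
          ENNReal.ofReal (M.density x₀ ((chartAt _ x₀).symm u)) := by
  rw [chartVolume, Measure.map_apply_of_aemeasurable (M.aemeasurable_chart_symm x₀) hA,
    withDensity_apply', Measure.restrict_restrict' (chartAt _ x₀).open_target.measurableSet]

/-- the derivative of a morphism in charts -/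
noncomputable def Hom.chartDeriv {M N : LorentzManifold.{u} m} (f : Hom M N) (x₀ : M) (y₀ : N)
    (x : M) : EuclideanSpace ℝ (Fin m) →L[ℝ] EuclideanSpace ℝ (Fin m) :=
  ((trivializationAt (EuclideanSpace ℝ (Fin m)) (TangentSpace (𝓡 m)) y₀).continuousLinearMapAt ℝ
    (f.toFun x)).comp ((mfderiv (𝓡 m) (𝓡 m) f.toFun x).comp (M.coord x₀ x))

theorem Hom.coord_chartDeriv {M N : LorentzManifold.{u} m} (f : Hom M N) {x₀ : M} {y₀ : N}
    {x : M} (hy : f.toFun x ∈ (chartAt (EuclideanSpace ℝ (Fin m)) y₀).source)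
    (v : EuclideanSpace ℝ (Fin m)) :
    N.coord y₀ (f.toFun x) (f.chartDeriv x₀ y₀ x v) =
      mfderiv (𝓡 m) (𝓡 m) f.toFun x (M.coord x₀ x v) := by
  exact (trivializationAt (EuclideanSpace ℝ (Fin m)) (TangentSpace (𝓡 m))
    y₀).symmL_continuousLinearMapAt (R := ℝ) (mem_baseSet hy) _

theorem Hom.density_eq {M N : LorentzManifold.{u} m} (f : Hom M N) {x₀ : M} {y₀ : N}
    {x : M} (hy : f.toFun x ∈ (chartAt (EuclideanSpace ℝ (Fin m)) y₀).source) :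
    M.density x₀ x = |(f.chartDeriv x₀ y₀ x).det| * N.density y₀ (f.toFun x) := by
  have h1 : M.coordForm x₀ x = (N.coordForm y₀ (f.toFun x)).comp
      (f.chartDeriv x₀ y₀ x).toLinearMap (f.chartDeriv x₀ y₀ x).toLinearMap := by
    refine LinearMap.ext₂ fun v w => ?_
    change M.g x (M.coord x₀ x v) (M.coord x₀ x w) = N.g (f.toFun x)
      (N.coord y₀ (f.toFun x) (f.chartDeriv x₀ y₀ x v))
      (N.coord y₀ (f.toFun x) (f.chartDeriv x₀ y₀ x w))
    rw [f.coord_chartDeriv hy, f.coord_chartDeriv hy, f.isometric]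
  have h2 : (M.gram x₀ x).det = (f.chartDeriv x₀ y₀ x).det ^ 2 * (N.gram y₀ (f.toFun x)).det := by
    rw [gram_eq, gram_eq, h1, LinearMap.BilinForm.toMatrix_comp (stdBasis m) (stdBasis m),
      Matrix.det_mul, Matrix.det_mul, Matrix.det_transpose, LinearMap.det_toMatrix]
    simp only [ContinuousLinearMap.det]
    ring
  rw [density, density, h2, abs_mul, Real.sqrt_mul (abs_nonneg _), abs_pow, Real.sqrt_sq
    (abs_nonneg _)]

theorem Hom.hasFDerivAt {M N : LorentzManifold.{u} m} (f : Hom M N) {x₀ : M} {y₀ : N}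
    {x : M} (hx : x ∈ (chartAt (EuclideanSpace ℝ (Fin m)) x₀).source)
    (hy : f.toFun x ∈ (chartAt (EuclideanSpace ℝ (Fin m)) y₀).source) :
    HasFDerivAt (chartAt (EuclideanSpace ℝ (Fin m)) y₀ ∘ f.toFun ∘
      (chartAt (EuclideanSpace ℝ (Fin m)) x₀).symm) (f.chartDeriv x₀ y₀ x)
        (chartAt (EuclideanSpace ℝ (Fin m)) x₀ x) := by
  set φ := chartAt (EuclideanSpace ℝ (Fin m)) x₀ with hφ
  have e : φ.symm (φ x) = x := φ.left_inv hx
  have h1 : HasMFDerivAt (𝓡 m) (𝓡 m) φ.symm (φ x) (M.coord x₀ x) := by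
    have h0 : MDifferentiableAt (𝓡 m) (𝓡 m) φ.symm (φ x) :=
      (mdifferentiable_chart (I := 𝓡 m) x₀).mdifferentiableAt_symm (φ.map_source hx)
    have := h0.hasMFDerivAt
    have h2 : M.coord x₀ x = mfderiv (𝓡 m) (𝓡 m) φ.symm (φ x) := by
      have := TangentBundle.symmL_trivializationAt (I := 𝓡 m) (x₀ := x₀) (x := x) hx
      simp only [modelWithCornersSelf_coe, Set.range_id, mfderivWithin_univ] at this
      exact this
    rw [h2]
    exact this
  have h2 : HasMFDerivAt (𝓡 m) (𝓡 m) f.toFun (φ.symm (φ x))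
      (mfderiv (𝓡 m) (𝓡 m) f.toFun x) := by
    rw [e]; exact (f.mdiff x).hasMFDerivAt
  have h3 : HasMFDerivAt (𝓡 m) (𝓡 m) (chartAt (EuclideanSpace ℝ (Fin m)) y₀)
      (f.toFun (φ.symm (φ x)))
      ((trivializationAt (EuclideanSpace ℝ (Fin m)) (TangentSpace (𝓡 m))
        y₀).continuousLinearMapAt ℝ (f.toFun x)) := by
    rw [e, TangentBundle.continuousLinearMapAt_trivializationAt hy]
    exact (mdifferentiableAt_atlas (I := 𝓡 m) (chart_mem_atlas _ y₀) hy).hasMFDerivAt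
  have h4 := HasMFDerivAt.comp (φ x) h3 (HasMFDerivAt.comp (φ x) h2 h1)
  exact h4.hasFDerivAt

theorem Hom.chartVolume_image {M N : LorentzManifold.{u} m} (f : Hom M N) {x₀ : M} {y₀ : N}
    {A : Set M} (hA : MeasurableSet A)
    (hx : A ⊆ (chartAt (EuclideanSpace ℝ (Fin m)) x₀).source)
    (hy : f.toFun '' A ⊆ (chartAt (EuclideanSpace ℝ (Fin m)) y₀).source) :
    N.chartVolume y₀ (f.toFun '' A) = M.chartVolume x₀ A := by
  have hA' : MeasurableSet (f.toFun '' A) := f.isOpenEmbedding.measurableEmbedding.measurableSet_image.2 hA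
  rw [chartVolume_apply _ _ hA, chartVolume_apply _ _ hA']
  set φ := chartAt (EuclideanSpace ℝ (Fin m)) x₀
  set ψ := chartAt (EuclideanSpace ℝ (Fin m)) y₀
  have hU : MeasurableSet (φ.symm ⁻¹' A ∩ φ.target) := by
    have h1 : MeasurableSet ((φ.target.domRestrict φ.symm) ⁻¹' A) :=
      φ.continuousOn_symm.domRestrict.measurable hA
    have h2 := φ.open_target.measurableSet.subtype_image h1
    convert h2 using 1
    ext v
    simp [and_comm, Set.domRestrict]
  have himg : ψ.symm ⁻¹' (f.toFun '' A) ∩ ψ.target =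
      (ψ ∘ f.toFun ∘ φ.symm) '' (φ.symm ⁻¹' A ∩ φ.target) := by
    ext v
    constructor
    · rintro ⟨⟨x, hxA, hxv⟩, hv⟩
      refine ⟨φ x, ⟨?_, φ.map_source (hx hxA)⟩, ?_⟩
      · simpa [φ.left_inv (hx hxA)] using hxA
      · simp [φ.left_inv (hx hxA), hxv, ψ.right_inv hv]
    · rintro ⟨u, ⟨hu, hut⟩, rfl⟩
      have h3 : f.toFun (φ.symm u) ∈ ψ.source := hy ⟨_, hu, rfl⟩
      refine ⟨?_, ψ.map_source h3⟩
      simp only [Function.comp, Set.mem_preimage, ψ.left_inv h3]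
      exact ⟨_, hu, rfl⟩
  have hinj : Set.InjOn (ψ ∘ f.toFun ∘ φ.symm) (φ.symm ⁻¹' A ∩ φ.target) := by
    rintro u ⟨hu, hut⟩ v ⟨hv, hvt⟩ h
    have h3 : f.toFun (φ.symm u) ∈ ψ.source := hy ⟨_, hu, rfl⟩
    have h4 : f.toFun (φ.symm v) ∈ ψ.source := hy ⟨_, hv, rfl⟩
    exact φ.symm.injOn hut hvt (f.injective (ψ.injOn h3 h4 h))
  rw [himg, lintegral_image_eq_lintegral_abs_det_fderiv_mul volume hU
    (f' := fun u => f.chartDeriv x₀ y₀ (φ.symm u)) ?_ hinj]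
  · refine setLIntegral_congr_fun hU ?_
    rintro u ⟨hu, hut⟩
    have h3 : f.toFun (φ.symm u) ∈ ψ.source := hy ⟨_, hu, rfl⟩
    simp only [Function.comp, ψ.left_inv h3]
    rw [f.density_eq (x₀ := x₀) (y₀ := y₀) h3, ENNReal.ofReal_mul (abs_nonneg _)]
  · rintro u ⟨hu, hut⟩
    have h3 : f.toFun (φ.symm u) ∈ ψ.source := hy ⟨_, hu, rfl⟩
    have := f.hasFDerivAt (x₀ := x₀) (y₀ := y₀) (φ.map_target hut) h3
    have e : φ (φ.symm u) = u := φ.right_inv hut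
    rw [show chartAt (EuclideanSpace ℝ (Fin m)) x₀ (φ.symm u) = u from e] at this
    exact this.hasFDerivWithinAt

end LorentzManifold
end HomotopyAQFT

namespace HomotopyAQFT
open scoped TensorProduct DirectSum Manifold ContDiff Topology
namespace LorentzManifold
open MeasureTheory
variable {m : ℕ}

theorem continuousOn_density_symm (M : LorentzManifold.{u} m) (x : M) :
    ContinuousOn (fun u => M.density x ((chartAt (EuclideanSpace ℝ (Fin m)) x).symm u))
      (chartAt (EuclideanSpace ℝ (Fin m)) x).target :=
  (M.smoothOn_density x).continuousOn.comp (chartAt _ x).continuousOn_symm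
    (chartAt (EuclideanSpace ℝ (Fin m)) x).mapsTo_symm

theorem chartVolume_inter_source (M : LorentzManifold.{u} m) (x₀ : M) {A : Set M}
    (hA : MeasurableSet A) :
    M.chartVolume x₀ (A ∩ (chartAt (EuclideanSpace ℝ (Fin m)) x₀).source) =
      M.chartVolume x₀ A := by
  rw [chartVolume_apply _ _ hA, chartVolume_apply _ _
    (hA.inter (chartAt _ x₀).open_source.measurableSet)]
  congr 2
  ext v
  simp only [Set.mem_inter_iff, Set.mem_preimage]
  constructor
  · rintro ⟨⟨h1, h2⟩, h3⟩; exact ⟨h1, h3⟩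
  · rintro ⟨h1, h3⟩; exact ⟨⟨h1, (chartAt _ x₀).map_target h3⟩, h3⟩

theorem chartVolume_eq (M : LorentzManifold.{u} m) {x₀ y₀ : M} {A : Set M}
    (hA : MeasurableSet A) (hx : A ⊆ (chartAt (EuclideanSpace ℝ (Fin m)) x₀).source)
    (hy : A ⊆ (chartAt (EuclideanSpace ℝ (Fin m)) y₀).source) :
    M.chartVolume y₀ A = M.chartVolume x₀ A := by
  have e : (Hom.id M).toFun '' A = A := Set.image_id A
  have := (Hom.id M).chartVolume_image hA hx (y₀ := y₀) (by rwa [e])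
  rwa [e] at this

theorem exists_volume (M : LorentzManifold.{u} m) : ∃ μ : Measure M, ∀ x₀ : M,
    μ.restrict (chartAt (EuclideanSpace ℝ (Fin m)) x₀).source = M.chartVolume x₀ := by
  rcases isEmpty_or_nonempty M with h | h
  · exact ⟨0, fun x => (h.false x).elim⟩
  obtain ⟨s, hs, hsu⟩ := TopologicalSpace.countable_cover_nhds
    (f := fun x : M => (chartAt (EuclideanSpace ℝ (Fin m)) x).source)
    (fun x => chart_source_mem_nhds _ x)
  have hne : s.Nonempty := by
    obtain ⟨x⟩ := h
    have : x ∈ ⋃ x ∈ s, (chartAt (EuclideanSpace ℝ (Fin m)) x).source := by rw [hsu]; trivial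
    simp only [Set.mem_iUnion] at this
    obtain ⟨y, hy, _⟩ := this
    exact ⟨y, hy⟩
  obtain ⟨x, rfl⟩ := hs.exists_eq_range hne
  let S : ℕ → Set M := fun n => (chartAt (EuclideanSpace ℝ (Fin m)) (x n)).source
  have hSm : ∀ n, MeasurableSet (S n) := fun n => (chartAt _ (x n)).open_source.measurableSet
  have hSu : ⋃ n, S n = Set.univ := by rw [← hsu]; simp [S]
  have hDm : ∀ n, MeasurableSet (disjointed S n) := fun n => MeasurableSet.disjointed hSm n
  refine ⟨Measure.sum fun n => (M.chartVolume (x n)).restrict (disjointed S n), fun x₀ => ?_⟩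
  ext A hA
  have hS₀ : MeasurableSet (chartAt (EuclideanSpace ℝ (Fin m)) x₀).source :=
    (chartAt _ x₀).open_source.measurableSet
  rw [Measure.restrict_apply hA, Measure.sum_apply _ (hA.inter hS₀),
    ← M.chartVolume_inter_source x₀ hA]
  set B := A ∩ (chartAt (EuclideanSpace ℝ (Fin m)) x₀).source with hB
  have hBm : MeasurableSet B := hA.inter hS₀
  have : ∀ n, (M.chartVolume (x n)).restrict (disjointed S n) B =
      M.chartVolume x₀ (B ∩ disjointed S n) := by
    intro n
    rw [Measure.restrict_apply hBm]
    exact M.chartVolume_eq (hBm.inter (hDm n)) (fun y hy => hy.1.2)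
      (fun y hy => disjointed_subset S n hy.2)
  simp only [this]
  rw [← measure_iUnion, ← Set.inter_iUnion, iUnion_disjointed, hSu, Set.inter_univ]
  · exact fun i j hij => (disjoint_disjointed S hij).mono Set.inter_subset_right Set.inter_subset_right
  · exact fun n => hBm.inter (hDm n)

/-- The volume measure: the (unique) measure that is given by `√|det g| dx¹⋯dxᵐ` on each of the
preferred charts. -/
noncomputable def volumeMeasure (M : LorentzManifold.{u} m) : Measure M :=
  Classical.choose M.exists_volume

theorem volume_restrict (M : LorentzManifold.{u} m) (x₀ : M) :
    M.volumeMeasure.restrict (chartAt (EuclideanSpace ℝ (Fin m)) x₀).source = M.chartVolume x₀ :=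
  Classical.choose_spec M.exists_volume x₀

theorem volume_apply (M : LorentzManifold.{u} m) (x₀ : M) {A : Set M} (hA : MeasurableSet A)
    (hx : A ⊆ (chartAt (EuclideanSpace ℝ (Fin m)) x₀).source) :
    M.volumeMeasure A = M.chartVolume x₀ A := by
  rw [← volume_restrict, Measure.restrict_apply hA, Set.inter_eq_left.2 hx]

theorem Hom.volume_image {M N : LorentzManifold.{u} m} (f : Hom M N) {A : Set M}
    (hA : MeasurableSet A) : N.volumeMeasure (f.toFun '' A) = M.volumeMeasure A := by
  rcases isEmpty_or_nonempty M with h | h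
  · have : A = ∅ := Set.eq_empty_of_isEmpty A
    simp [this]
  let U : M → Set M := fun x => (chartAt (EuclideanSpace ℝ (Fin m)) x).source ∩
    f.toFun ⁻¹' (chartAt (EuclideanSpace ℝ (Fin m)) (f.toFun x)).source
  have hUo : ∀ x, IsOpen (U x) := fun x => (chartAt _ x).open_source.inter
    ((chartAt _ _).open_source.preimage f.contMDiff.continuous)
  obtain ⟨s, hs, hsu⟩ := TopologicalSpace.countable_cover_nhds (f := U)
    (fun x => (hUo x).mem_nhds ⟨mem_chart_source _ x, mem_chart_source _ _⟩)
  have hne : s.Nonempty := by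
    obtain ⟨x⟩ := h
    have : x ∈ ⋃ x ∈ s, U x := by rw [hsu]; trivial
    simp only [Set.mem_iUnion] at this
    obtain ⟨y, hy, _⟩ := this
    exact ⟨y, hy⟩
  obtain ⟨x, rfl⟩ := hs.exists_eq_range hne
  let S : ℕ → Set M := fun n => U (x n)
  have hSm : ∀ n, MeasurableSet (S n) := fun n => (hUo _).measurableSet
  have hSu : ⋃ n, S n = Set.univ := by rw [← hsu]; simp [S]
  have hDm : ∀ n, MeasurableSet (disjointed S n) := fun n => MeasurableSet.disjointed hSm n
  have hA2 : A = ⋃ n, A ∩ disjointed S n := by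
    rw [← Set.inter_iUnion, iUnion_disjointed, hSu, Set.inter_univ]
  have hd : Pairwise (Function.onFun Disjoint fun n => A ∩ disjointed S n) := fun i j hij =>
    (disjoint_disjointed S hij).mono Set.inter_subset_right Set.inter_subset_right
  have hm : ∀ n, MeasurableSet (A ∩ disjointed S n) := fun n => hA.inter (hDm n)
  rw [hA2, Set.image_iUnion, measure_iUnion _ fun n =>
    f.isOpenEmbedding.measurableEmbedding.measurableSet_image.2 (hm n), measure_iUnion hd hm]
  · refine tsum_congr fun n => ?_
    have h1 : A ∩ disjointed S n ⊆ (chartAt (EuclideanSpace ℝ (Fin m)) (x n)).source :=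
      fun y hy => (disjointed_subset S n hy.2).1
    have h2 : f.toFun '' (A ∩ disjointed S n) ⊆
        (chartAt (EuclideanSpace ℝ (Fin m)) (f.toFun (x n))).source := by
      rintro _ ⟨y, hy, rfl⟩
      exact (disjointed_subset S n hy.2).2
    rw [M.volume_apply _ (hm n) h1, N.volume_apply _
      (f.isOpenEmbedding.measurableEmbedding.measurableSet_image.2 (hm n)) h2,
      f.chartVolume_image (hm n) h1 h2]
  · exact fun i j hij => (Set.disjoint_image_iff f.injective).2 (hd hij)

instance (M : LorentzManifold.{u} m) : IsLocallyFiniteMeasure M.volumeMeasure where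
  finiteAtNhds x := by
    set φ := chartAt (EuclideanSpace ℝ (Fin m)) x with hφ
    have hc : ContinuousAt (fun u => M.density x (φ.symm u)) (φ x) := by
      have h1 : ContinuousAt (M.density x) (φ.symm (φ x)) := by
        rw [φ.left_inv (mem_chart_source _ x)]
        exact (M.smoothOn_density x).continuousOn.continuousAt (chart_source_mem_nhds _ x)
      exact h1.comp (φ.continuousAt_symm (φ.map_source (mem_chart_source _ x)))
    have h2 : ∀ᶠ u in 𝓝 (φ x), M.density x (φ.symm u) < M.density x (φ.symm (φ x)) + 1 :=
      hc.eventually_lt continuousAt_const (by simp)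
    have h3 := (volume : Measure (EuclideanSpace ℝ (Fin m))).finiteAt_nhds (φ x)
    obtain ⟨V, hV, hVf⟩ := h3
    have h4 : ∀ᶠ y in 𝓝 x, y ∈ φ.source ∧ φ y ∈ V ∧
        M.density x (φ.symm (φ y)) < M.density x (φ.symm (φ x)) + 1 := by
      have hφc := φ.continuousAt (mem_chart_source _ x)
      exact Filter.Eventually.and (chart_source_mem_nhds _ x) (Filter.Eventually.and (hφc hV) (hφc.eventually h2))
    obtain ⟨W, hW, hWo, hxW⟩ := eventually_nhds_iff.1 h4
    refine ⟨W, hWo.mem_nhds hxW, ?_⟩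
    rw [M.volume_apply x hWo.measurableSet fun y hy => (hW y hy).1,
      M.chartVolume_apply x hWo.measurableSet]
    have hS : MeasurableSet (φ.symm ⁻¹' W ∩ φ.target) := by
      rw [Set.inter_comm]
      exact (φ.isOpen_inter_preimage_symm hWo).measurableSet
    calc ∫⁻ u in φ.symm ⁻¹' W ∩ φ.target, ENNReal.ofReal (M.density x (φ.symm u))
        ≤ ∫⁻ u in φ.symm ⁻¹' W ∩ φ.target,
            ENNReal.ofReal (M.density x (φ.symm (φ x)) + 1) := by
          refine setLIntegral_mono' hS fun u hu => ENNReal.ofReal_le_ofReal ?_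
          have := (hW _ hu.1).2.2
          rw [φ.right_inv hu.2] at this
          exact this.le
      _ = ENNReal.ofReal (M.density x (φ.symm (φ x)) + 1) * volume (φ.symm ⁻¹' W ∩ φ.target) := by
          simp
      _ < ⊤ := by
          refine ENNReal.mul_lt_top (by simp) ((measure_mono fun u hu => ?_).trans_lt hVf)
          have := (hW _ hu.1).2.1
          rwa [φ.right_inv hu.2] at this

instance (M : LorentzManifold.{u} m) : Measure.IsOpenPosMeasure M.volumeMeasure where
  open_pos U hU := by
    rintro ⟨x, hx⟩
    set φ := chartAt (EuclideanSpace ℝ (Fin m)) x with hφ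
    have hUo : IsOpen (U ∩ φ.source) := hU.inter φ.open_source
    have hVo : IsOpen (φ.target ∩ φ.symm ⁻¹' (U ∩ φ.source)) := φ.isOpen_inter_preimage_symm hUo
    refine ne_of_gt (lt_of_lt_of_le ?_ (measure_mono (Set.inter_subset_left (t := φ.source))))
    rw [M.volume_apply x hUo.measurableSet Set.inter_subset_right,
      M.chartVolume_apply x hUo.measurableSet, Set.inter_comm]
    refine pos_iff_ne_zero.2 fun h0 => ?_
    have hd := M.continuousOn_density_symm x
    have hae := (setLIntegral_eq_zero_iff' hVo.measurableSet
      ((hd.mono Set.inter_subset_left).aemeasurable hVo.measurableSet).ennreal_ofReal).1 h0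
    have hpos : volume (φ.target ∩ φ.symm ⁻¹' (U ∩ φ.source)) ≠ 0 := by
      refine (hVo.measure_pos _ ⟨φ x, φ.map_source (mem_chart_source _ x), ?_⟩).ne'
      change φ.symm (φ x) ∈ U ∩ φ.source
      rw [φ.left_inv (mem_chart_source _ x)]
      exact ⟨hx, mem_chart_source _ x⟩
    refine hpos (measure_mono_null (fun u hu => ?_) (ae_iff.1 hae))
    intro h
    have h1 := h hu
    simp only [ENNReal.ofReal_eq_zero] at h1
    exact absurd (M.density_pos (x₀ := x) hu.2.2) (not_lt.2 h1)

theorem integral_eq_chart (M : LorentzManifold.{u} m) (x₀ : M) {f : M → ℝ} (hfc : Continuous f)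
    (hf : ∀ x ∉ (chartAt (EuclideanSpace ℝ (Fin m)) x₀).source, f x = 0) :
    ∫ x, f x ∂M.volumeMeasure = ∫ u in (chartAt (EuclideanSpace ℝ (Fin m)) x₀).target,
      M.density x₀ ((chartAt _ x₀).symm u) * f ((chartAt _ x₀).symm u) := by
  set φ := chartAt (EuclideanSpace ℝ (Fin m)) x₀ with hφ
  rw [← setIntegral_eq_integral_of_forall_compl_eq_zero hf, volume_restrict, chartVolume,
    integral_map (M.aemeasurable_chart_symm x₀) hfc.aestronglyMeasurable,
    integral_withDensity_eq_integral_toReal_smul₀]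
  · refine integral_congr_ae (ae_of_all _ fun u => ?_)
    change (ENNReal.ofReal (M.density x₀ (φ.symm u))).toReal * f (φ.symm u) = _
    rw [ENNReal.toReal_ofReal (show 0 ≤ M.density x₀ (φ.symm u) from Real.sqrt_nonneg _)]
  · exact ((M.continuousOn_density_symm x₀).aemeasurable φ.open_target.measurableSet).ennreal_ofReal
  · exact ae_of_all _ fun u => ENNReal.ofReal_lt_top

end LorentzManifold
end HomotopyAQFT

namespace HomotopyAQFT
open scoped TensorProduct DirectSum Manifold ContDiff Topology
open MeasureTheory
variable {m : ℕ}

theorem LorentzManifold.integral_image {M N : LorentzManifold.{u} m}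
    (f : LorentzManifold.Hom M N) {F : N → ℝ} (hF : ∀ y ∉ Set.range f.toFun, F y = 0) :
    ∫ y, F y ∂N.volumeMeasure = ∫ x, F (f.toFun x) ∂M.volumeMeasure := by
  have hemb := f.isOpenEmbedding.measurableEmbedding
  have h1 : M.volumeMeasure.map f.toFun = N.volumeMeasure.restrict (Set.range f.toFun) := by
    ext A hA
    rw [Measure.map_apply hemb.measurable hA, Measure.restrict_apply hA,
      ← f.volume_image (hemb.measurable hA), Set.image_preimage_eq_inter_range]
  rw [← setIntegral_eq_integral_of_forall_compl_eq_zero hF, ← h1, hemb.integral_map]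

instance (M : LorentzManifold.{u} m) : LocallyCompactSpace M :=
  ChartedSpace.locallyCompactSpace (EuclideanSpace ℝ (Fin m)) M

/-! ### Vector bundles with fiber metric -/

/-- A finite-rank real smooth vector bundle with (nondegenerate, not necessarily positive definite)
fiber metric. -/
structure MetricBundle (M : LorentzManifold.{u} m) where
  rank : ℕ
  fiber : M → Type u
  [addCommGroup : ∀ x, AddCommGroup (fiber x)]
  [module : ∀ x, Module ℝ (fiber x)]
  [fiberTopology : ∀ x, TopologicalSpace (fiber x)]
  [totalTopology : TopologicalSpace (Bundle.TotalSpace (EuclideanSpace ℝ (Fin rank)) fiber)]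
  [fiberBundle : FiberBundle (EuclideanSpace ℝ (Fin rank)) fiber]
  [vectorBundle : VectorBundle ℝ (EuclideanSpace ℝ (Fin rank)) fiber]
  [smoothBundle : ContMDiffVectorBundle ∞ (EuclideanSpace ℝ (Fin rank)) fiber (𝓡 m)]
  /-- the fiber metric -/
  h : ∀ x, fiber x →ₗ[ℝ] fiber x →ₗ[ℝ] ℝ
  h_symm : ∀ x v w, h x v w = h x w v
  h_nondegenerate : ∀ x v, (∀ w, h x v w = 0) → v = 0
  h_smooth : ∀ s t : ContMDiffSection (𝓡 m) (EuclideanSpace ℝ (Fin rank)) ∞ fiber,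
    ContMDiff (𝓡 m) 𝓘(ℝ, ℝ) ∞ fun x => h x (s x) (t x)

attribute [instance] MetricBundle.addCommGroup MetricBundle.module MetricBundle.fiberTopology
  MetricBundle.totalTopology MetricBundle.fiberBundle MetricBundle.vectorBundle
  MetricBundle.smoothBundle

namespace MetricBundle

variable {M : LorentzManifold.{u} m}

/-- The model fiber. -/
abbrev model (F : MetricBundle M) : Type := EuclideanSpace ℝ (Fin F.rank)

/-- The vector space of smooth sections. -/
abbrev Sections (F : MetricBundle M) : Type u :=
  ContMDiffSection (𝓡 m) F.model ∞ F.fiber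

/-- The support of a section. -/
def supp {F : MetricBundle M} (s : F.Sections) : Set M := closure {x | s x ≠ 0}

/-- The fiber metric applied to two sections. -/
noncomputable def metric {F : MetricBundle M} (s t : F.Sections) (x : M) : ℝ := F.h x (s x) (t x)

/-- The integration pairing `⟨s, t⟩ = ∫_M h(s, t) vol_M`. -/
noncomputable def pairing {F : MetricBundle M} (s t : F.Sections) : ℝ :=
  ∫ x, metric s t x ∂M.volumeMeasure

theorem notMem_supp {F : MetricBundle M} {s : F.Sections} {x : M} :
    x ∉ supp s ↔ ∀ᶠ y in 𝓝 x, s y = 0 := by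
  rw [supp, mem_closure_iff_frequently, Filter.not_frequently]
  simp

theorem supp_subset_of {F G : MetricBundle M} {s : F.Sections} {t : G.Sections}
    (h : ∀ x, (∀ᶠ y in 𝓝 x, s y = 0) → t x = 0) : supp t ⊆ supp s := by
  intro x hx
  by_contra hs
  exact notMem_supp.2 ((notMem_supp.1 hs).eventually_nhds.mono fun y hy => h y hy) hx

theorem isClosed_supp {F : MetricBundle M} (s : F.Sections) : IsClosed (supp s) := isClosed_closure

theorem eq_zero_of_notMem {F : MetricBundle M} {s : F.Sections} {x : M} (h : x ∉ supp s) :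
    s x = 0 := (notMem_supp.1 h).self_of_nhds

theorem supp_zero {F : MetricBundle M} : supp (0 : F.Sections) = ∅ := by
  simp [supp]

theorem supp_add {F : MetricBundle M} (s t : F.Sections) : supp (s + t) ⊆ supp s ∪ supp t := by
  intro x hx
  by_contra h
  rw [Set.mem_union, not_or] at h
  refine notMem_supp.2 ?_ hx
  filter_upwards [notMem_supp.1 h.1, notMem_supp.1 h.2] with y h1 h2
  simp [h1, h2]

theorem supp_smul {F : MetricBundle M} (c : ℝ) (s : F.Sections) : supp (c • s) ⊆ supp s :=
  supp_subset_of fun x hx => by simp [hx.self_of_nhds]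

theorem metric_symm {F : MetricBundle M} (s t : F.Sections) : metric s t = metric t s :=
  funext fun _ => F.h_symm _ _ _

theorem pairing_symm {F : MetricBundle M} (s t : F.Sections) : pairing s t = pairing t s := by
  rw [pairing, pairing, metric_symm]

theorem continuous_metric {F : MetricBundle M} (s t : F.Sections) : Continuous (metric s t) :=
  (F.h_smooth s t).continuous

theorem tsupport_metric {F : MetricBundle M} (s t : F.Sections) :
    tsupport (metric s t) ⊆ supp s ∩ supp t := by
  refine closure_minimal (fun x hx => ⟨subset_closure ?_, subset_closure ?_⟩)
    ((isClosed_supp s).inter (isClosed_supp t))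
  · intro h
    exact hx (by simp [metric, h])
  · intro h
    exact hx (by simp [metric, h])

theorem integrable_metric {F : MetricBundle M} (s t : F.Sections)
    (h : IsCompact (supp s ∩ supp t)) : Integrable (metric s t) M.volumeMeasure :=
  (continuous_metric s t).integrable_of_hasCompactSupport
    (h.of_isClosed_subset isClosed_closure (tsupport_metric s t))

/-- Compactly supported sections. -/
def compactSections (F : MetricBundle M) : Submodule ℝ F.Sections where
  carrier := {s | IsCompact (supp s)}
  add_mem' {s t} hs ht := (hs.union ht).of_isClosed_subset (isClosed_supp _) (supp_add s t)
  zero_mem' := by simp [supp_zero]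
  smul_mem' c s hs := hs.of_isClosed_subset (isClosed_supp _) (supp_smul c s)

/-- Sections with past compact support: those supported in `J⁺(Σ)` for some Cauchy surface `Σ`.
(These form a vector space that contains the compactly supported sections; the generated subspace
is taken in order to have this by definition.) -/
noncomputable def pastCompactSections (F : MetricBundle M) : Submodule ℝ F.Sections :=
  Submodule.span ℝ {s | ∃ S, M.IsCauchySurface S ∧ supp s ⊆ M.causalFuture S} ⊔ F.compactSections

/-- Sections with future compact support: those supported in `J⁻(Σ)` for some Cauchy surface `Σ`.
(These form a vector space that contains the compactly supported sections; the generated subspace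
is taken in order to have this by definition.) -/
noncomputable def futureCompactSections (F : MetricBundle M) : Submodule ℝ F.Sections :=
  Submodule.span ℝ {s | ∃ S, M.IsCauchySurface S ∧ supp s ⊆ M.causalPast S} ⊔ F.compactSections

section pairing
variable {F : MetricBundle M}

theorem pairing_add_right (s t t' : F.Sections) (h : IsCompact (supp s ∩ supp t))
    (h' : IsCompact (supp s ∩ supp t')) : pairing s (t + t') = pairing s t + pairing s t' := by
  rw [pairing, pairing, pairing, ← integral_add (integrable_metric s t h)
    (integrable_metric s t' h')]
  refine integral_congr_ae (ae_of_all _ fun x => ?_)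
  simp [metric]

theorem pairing_smul_right (s t : F.Sections) (c : ℝ) : pairing s (c • t) = c * pairing s t := by
  rw [pairing, pairing, ← integral_const_mul]
  refine integral_congr_ae (ae_of_all _ fun x => ?_)
  simp [metric]

theorem isCompact_left {s : F.Sections} (hs : s ∈ F.compactSections) (t : F.Sections) :
    IsCompact (supp s ∩ supp t) := hs.inter_right (isClosed_supp t)

/-- The integration pairing between compactly supported and arbitrary sections. -/
noncomputable def pairingL (F : MetricBundle M) : F.compactSections →ₗ[ℝ] F.Sections →ₗ[ℝ] ℝ :=
  LinearMap.mk₂ ℝ (fun s t => pairing (s : F.Sections) t)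
    (fun s s' t => by
      have h := pairing_add_right t s.1 s'.1
        (by rw [Set.inter_comm]; exact isCompact_left s.2 t)
        (by rw [Set.inter_comm]; exact isCompact_left s'.2 t)
      rw [pairing_symm, pairing_symm s.1, pairing_symm s'.1]
      exact h)
    (fun c s t => by
      rw [pairing_symm, pairing_symm s.1]
      exact pairing_smul_right t s.1 c)
    (fun s t t' => pairing_add_right s.1 t t' (isCompact_left s.2 t) (isCompact_left s.2 t'))
    (fun c s t => pairing_smul_right s.1 t c)

end pairing

/-! ### Differential operators -/

/-- The local representative of a section in the preferred chart and the preferred trivialization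
at `x₀`. -/
noncomputable def localRep {F : MetricBundle M} (x₀ : M) (s : F.Sections)
    (p : EuclideanSpace ℝ (Fin m)) : F.model :=
  (trivializationAt F.model F.fiber x₀ ⟨(chartAt _ x₀).symm p, s ((chartAt _ x₀).symm p)⟩).2

/-- A linear map `D` between spaces of sections is a linear differential operator (of order at
most `k`) if, locally near each point, `D s = ∑_{j ≤ k} A_j(∂^j s)` for smooth coefficients `A_j`,
where `∂^j s` denotes the `j`-th derivative of `s` in a chart and a trivialization. -/
def IsDiffOp {F G : MetricBundle M} (D : F.Sections →ₗ[ℝ] G.Sections) : Prop :=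
  ∃ k : ℕ, ∀ x₀ : M, ∃ U : Set (EuclideanSpace ℝ (Fin m)), IsOpen U ∧ chartAt _ x₀ x₀ ∈ U ∧
    ∃ A : (j : ℕ) → EuclideanSpace ℝ (Fin m) →
      (EuclideanSpace ℝ (Fin m) [×j]→L[ℝ] F.model) →L[ℝ] G.model,
      (∀ j, ContDiffOn ℝ ∞ (A j) U) ∧
      ∀ s : F.Sections, ∀ p ∈ U, localRep x₀ (D s) p =
        ∑ j ∈ Finset.range (k + 1), A j p (iteratedFDeriv ℝ j (localRep x₀ s) p)

theorem IsDiffOp.local {F G : MetricBundle M} {D : F.Sections →ₗ[ℝ] G.Sections} (hD : IsDiffOp D)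
    {s : F.Sections} {x : M} (hs : ∀ᶠ y in 𝓝 x, s y = 0) : D s x = 0 := by
  obtain ⟨k, hk⟩ := hD
  obtain ⟨U, hU, hxU, A, hA, h⟩ := hk x
  have h1 := h s _ hxU
  set φ := chartAt (EuclideanSpace ℝ (Fin m)) x with hφ
  have hx := φ.left_inv (mem_chart_source _ x)
  have h0 : localRep x s =ᶠ[𝓝 (φ x)] fun _ => 0 := by
    have hc : Filter.Tendsto φ.symm (𝓝 (φ x)) (𝓝 x) := by
      have := φ.continuousAt_symm (φ.map_source (mem_chart_source _ x))
      rwa [ContinuousAt, hx] at this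
    have hb := (trivializationAt F.model F.fiber x).open_baseSet.mem_nhds
      (FiberBundle.mem_baseSet_trivializationAt' x)
    filter_upwards [hc.eventually hs, hc.eventually hb] with p hp hpb
    rw [localRep, hp]
    exact ((trivializationAt F.model F.fiber x).linear ℝ hpb).map_zero
  have h2 : ∀ j, iteratedFDeriv ℝ j (localRep x s) (φ x) = 0 := fun j => by
    rw [(h0.iteratedFDeriv ℝ j).self_of_nhds]
    simp
  rw [Finset.sum_eq_zero fun j _ => by rw [h2, map_zero]] at h1
  rw [localRep, ← hφ, hx] at h1
  have hb := FiberBundle.mem_baseSet_trivializationAt' (F := G.model) (E := G.fiber) x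
  have := ((trivializationAt G.model G.fiber x).continuousLinearEquivAt ℝ x hb).injective
  refine this ?_
  rw [map_zero]
  exact h1

theorem IsDiffOp.supp_subset {F G : MetricBundle M} {D : F.Sections →ₗ[ℝ] G.Sections}
    (hD : IsDiffOp D) (s : F.Sections) : supp (D s) ⊆ supp s :=
  supp_subset_of fun _ h => hD.local h

end MetricBundle
end HomotopyAQFT

namespace HomotopyAQFT
open scoped TensorProduct DirectSum Manifold ContDiff Topology
open MeasureTheory

/-! ### Existence of formal adjoints -/

section euclidean

variable {m : ℕ} {Y : Type*} [NormedAddCommGroup Y] [NormedSpace ℝ Y]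

theorem sum_coord_smul (L : EuclideanSpace ℝ (Fin m) →L[ℝ] Y) :
    L = ∑ i, (LinearMap.toContinuousLinearMap ((LorentzManifold.stdBasis m).coord i)).smulRight
      (L (LorentzManifold.stdBasis m i)) := by
  ext v
  conv_lhs => rw [← (LorentzManifold.stdBasis m).sum_repr v, map_sum]
  simp

theorem exists_adjoint_fderiv
    (C : EuclideanSpace ℝ (Fin m) → ((EuclideanSpace ℝ (Fin m) →L[ℝ] Y) →L[ℝ] ℝ))
    (hC : ContDiff ℝ ∞ C) (hCs : HasCompactSupport C) :
    ∃ w : EuclideanSpace ℝ (Fin m) → (Y →L[ℝ] ℝ),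
      ContDiff ℝ ∞ w ∧ tsupport w ⊆ tsupport C ∧
      ∀ f : EuclideanSpace ℝ (Fin m) → Y, ContDiff ℝ ∞ f →
        ∫ p, C p (fderiv ℝ f p) = ∫ p, w p (f p) := by
  let sm (i : Fin m) : Y →L[ℝ] (EuclideanSpace ℝ (Fin m) →L[ℝ] Y) :=
    ContinuousLinearMap.smulRightL ℝ _ _
      (LinearMap.toContinuousLinearMap ((LorentzManifold.stdBasis m).coord i))
  obtain ⟨C', hC'def⟩ : ∃ C' : Fin m → EuclideanSpace ℝ (Fin m) → (Y →L[ℝ] ℝ),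
    ∀ i p, C' i p = (C p).comp (sm i) := ⟨_, fun _ _ => rfl⟩
  have hC' : ∀ i, ContDiff ℝ ∞ (C' i) := fun i => by
    rw [show C' i = fun p => (C p).comp (sm i) from funext fun p => hC'def i p]
    exact hC.clm_comp contDiff_const
  have hC'z : ∀ i p, C p = 0 → C' i p = 0 := fun i p h => by rw [hC'def, h]; simp
  have hC's : ∀ i, tsupport (C' i) ⊆ tsupport C := fun i =>
    closure_mono fun p hp h => hp (hC'z i p h)
  have hC'c : ∀ i, HasCompactSupport (C' i) := fun i =>
    hCs.of_isClosed_subset isClosed_closure (hC's i)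
  refine ⟨fun p => ∑ i, -(fderiv ℝ (C' i) p (LorentzManifold.stdBasis m i)), ?_, ?_, ?_⟩
  · refine ContDiff.sum fun i _ => ContDiff.neg ?_
    exact ((hC' i).fderiv_right (by simp)).clm_apply contDiff_const
  · refine closure_minimal (fun p hp => ?_) isClosed_closure
    by_contra h
    refine hp ?_
    refine Finset.sum_eq_zero fun i _ => ?_
    rw [image_eq_zero_of_notMem_tsupport (f := fderiv ℝ (C' i))]
    · simp
    · exact fun h' => h (hC's i (tsupport_fderiv_subset ℝ h'))
  intro f hf
  have e1 : ∀ p, C p (fderiv ℝ f p) =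
      ∑ i, C' i p (fderiv ℝ f p (LorentzManifold.stdBasis m i)) := by
    intro p
    conv_lhs => rw [sum_coord_smul (fderiv ℝ f p), map_sum]
    refine Finset.sum_congr rfl fun i _ => ?_
    rw [hC'def]
    rfl
  have hint1 : ∀ i, Integrable (fun p =>
      C' i p (fderiv ℝ f p (LorentzManifold.stdBasis m i))) volume := by
    intro i
    refine Continuous.integrable_of_hasCompactSupport ?_ ?_
    · exact (hC' i).continuous.clm_apply
        ((hf.continuous_fderiv (by simp)).clm_apply continuous_const)
    · exact (hC'c i).mono fun p hp h => hp (by simp [h])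
  have hint2 : ∀ i, Integrable (fun p =>
      fderiv ℝ (C' i) p (LorentzManifold.stdBasis m i) (f p)) volume := by
    intro i
    refine Continuous.integrable_of_hasCompactSupport ?_ ?_
    · exact (((hC' i).continuous_fderiv (by simp)).clm_apply continuous_const).clm_apply
        hf.continuous
    · exact ((hC'c i).fderiv ℝ).mono fun p hp h => hp (by simp [h])
  have hint3 : ∀ i, Integrable (fun p => C' i p (f p)) volume := by
    intro i
    refine Continuous.integrable_of_hasCompactSupport ?_ ?_
    · exact (hC' i).continuous.clm_apply hf.continuous
    · exact (hC'c i).mono fun p hp h => hp (by simp [h])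
  simp only [e1]
  rw [integral_finsetSum _ fun i _ => hint1 i]
  simp only [sum_apply, neg_apply]
  rw [integral_finsetSum Finset.univ (f := fun i p =>
    -(fderiv ℝ (C' i) p (LorentzManifold.stdBasis m i) (f p))) fun i _ => (hint2 i).neg]
  refine Finset.sum_congr rfl fun i _ => ?_
  rw [integral_neg]
  exact integral_bilinear_fderiv_right_eq_neg_left_of_integrable
    (B := ContinuousLinearMap.id ℝ (Y →L[ℝ] ℝ)) (hint2 i) (hint1 i) (hint3 i)
    (fun p _ => (hC' i).contDiffAt.differentiableAt (by simp))
    (fun p _ => hf.contDiffAt.differentiableAt (by simp))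

/-- the previous fact, composed with a fixed linear map -/
theorem exists_adjoint_step {Z : Type*} [NormedAddCommGroup Z] [NormedSpace ℝ Z]
    (cur : (EuclideanSpace ℝ (Fin m) →L[ℝ] Y) →L[ℝ] Z)
    (C : EuclideanSpace ℝ (Fin m) → (Z →L[ℝ] ℝ))
    (hC : ContDiff ℝ ∞ C) (hCs : HasCompactSupport C) :
    ∃ w : EuclideanSpace ℝ (Fin m) → (Y →L[ℝ] ℝ),
      ContDiff ℝ ∞ w ∧ tsupport w ⊆ tsupport C ∧
      ∀ f : EuclideanSpace ℝ (Fin m) → Y, ContDiff ℝ ∞ f →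
        ∫ p, C p (cur (fderiv ℝ f p)) = ∫ p, w p (f p) := by
  have hz : tsupport (fun p => (C p).comp cur) ⊆ tsupport C :=
    closure_mono fun p hp h =>
      hp (show (C p).comp cur = 0 by rw [h, ContinuousLinearMap.zero_comp])
  obtain ⟨w, hw, hws, hwf⟩ := exists_adjoint_fderiv (fun p => (C p).comp cur)
    (hC.clm_comp contDiff_const) (hCs.of_isClosed_subset isClosed_closure hz)
  exact ⟨w, hw, hws.trans hz, hwf⟩

theorem exists_adjoint_zero {Z : Type*} [NormedAddCommGroup Z] [NormedSpace ℝ Z] (e : Y →L[ℝ] Z)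
    (C : EuclideanSpace ℝ (Fin m) → (Z →L[ℝ] ℝ)) (hC : ContDiff ℝ ∞ C) :
    ∃ w : EuclideanSpace ℝ (Fin m) → (Y →L[ℝ] ℝ),
      ContDiff ℝ ∞ w ∧ tsupport w ⊆ tsupport C ∧
      ∀ f : EuclideanSpace ℝ (Fin m) → Y, ∫ p, C p (e (f p)) = ∫ p, w p (f p) :=
  ⟨fun p => (C p).comp e, hC.clm_comp contDiff_const,
    closure_mono fun p hp h =>
      hp (show (C p).comp e = 0 by rw [h, ContinuousLinearMap.zero_comp]), fun _ => rfl⟩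

theorem exists_adjoint_euclidean {n : ℕ} (j : ℕ) :
    ∀ C : EuclideanSpace ℝ (Fin m) →
      ((EuclideanSpace ℝ (Fin m) [×j]→L[ℝ] EuclideanSpace ℝ (Fin n)) →L[ℝ] ℝ),
      ContDiff ℝ ∞ C → HasCompactSupport C →
      ∃ w : EuclideanSpace ℝ (Fin m) → (EuclideanSpace ℝ (Fin n) →L[ℝ] ℝ),
        ContDiff ℝ ∞ w ∧ tsupport w ⊆ tsupport C ∧
        ∀ f : EuclideanSpace ℝ (Fin m) → EuclideanSpace ℝ (Fin n), ContDiff ℝ ∞ f →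
          ∫ p, C p (iteratedFDeriv ℝ j f p) = ∫ p, w p (f p) := by
  induction j with
  | zero =>
    intro C hC hCs
    obtain ⟨w, hw, hws, hwf⟩ := exists_adjoint_zero
      (continuousMultilinearCurryFin0 ℝ (EuclideanSpace ℝ (Fin m))
        (EuclideanSpace ℝ (Fin n))).symm.toContinuousLinearEquiv.toContinuousLinearMap C hC
    exact ⟨w, hw, hws, fun f _ => hwf f⟩
  | succ j ih =>
    intro C hC hCs
    obtain ⟨C', hC', hC's, hC'f⟩ := exists_adjoint_step
      (continuousMultilinearCurryLeftEquiv ℝ (fun _ : Fin (j + 1) => EuclideanSpace ℝ (Fin m))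
        (EuclideanSpace ℝ (Fin n))).symm.toContinuousLinearEquiv.toContinuousLinearMap C hC hCs
    obtain ⟨w, hw, hws, hwf⟩ := ih C' hC' (hCs.of_isClosed_subset isClosed_closure hC's)
    refine ⟨w, hw, hws.trans hC's, fun f hf => ?_⟩
    rw [← hwf f hf, ← hC'f _ (contDiff_infty.2 fun n =>
      (contDiff_infty.1 hf (n + j)).iteratedFDeriv_right (by norm_cast))]
    rfl

end euclidean
end HomotopyAQFT

namespace HomotopyAQFT
open scoped TensorProduct DirectSum Manifold ContDiff Topology
open MeasureTheory

variable {m : ℕ}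

theorem contDiff_smul_of_tsupport {W : Type*} [NormedAddCommGroup W] [NormedSpace ℝ W]
    {g : EuclideanSpace ℝ (Fin m) → ℝ} {f : EuclideanSpace ℝ (Fin m) → W}
    {O : Set (EuclideanSpace ℝ (Fin m))} (hO : IsOpen O) (hg : ContDiff ℝ ∞ g)
    (hgO : tsupport g ⊆ O) (hf : ContDiffOn ℝ ∞ f O) : ContDiff ℝ ∞ fun p => g p • f p := by
  rw [contDiff_iff_contDiffAt]
  intro p
  by_cases hp : p ∈ O
  · exact hg.contDiffAt.smul (hf.contDiffAt (hO.mem_nhds hp))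
  · have h : p ∉ tsupport g := fun h => hp (hgO h)
    have h0 : (fun p => g p • f p) =ᶠ[𝓝 p] fun _ => 0 := by
      filter_upwards [notMem_tsupport_iff_eventuallyEq.1 h] with q hq
      simp [hq]
    exact contDiffAt_const.congr_of_eventuallyEq h0

namespace LorentzManifold

open Classical in
/-- Extension by zero of a function in the preferred chart at `x₀`. -/
noncomputable def pull (M : LorentzManifold.{u} m) (x₀ : M) (g : EuclideanSpace ℝ (Fin m) → ℝ)
    (x : M) : ℝ := if x ∈ (chartAt (EuclideanSpace ℝ (Fin m)) x₀).source then
      g (chartAt (EuclideanSpace ℝ (Fin m)) x₀ x) else 0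

variable {M : LorentzManifold.{u} m} {x₀ : M} {g : EuclideanSpace ℝ (Fin m) → ℝ}

theorem pull_of_mem {x : M} (hx : x ∈ (chartAt (EuclideanSpace ℝ (Fin m)) x₀).source) :
    M.pull x₀ g x = g (chartAt (EuclideanSpace ℝ (Fin m)) x₀ x) := if_pos hx

theorem pull_symm {p : EuclideanSpace ℝ (Fin m)}
    (hp : p ∈ (chartAt (EuclideanSpace ℝ (Fin m)) x₀).target) :
    M.pull x₀ g ((chartAt (EuclideanSpace ℝ (Fin m)) x₀).symm p) = g p := by
  rw [pull_of_mem ((chartAt _ x₀).map_target hp), (chartAt _ x₀).right_inv hp]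

theorem tsupport_pull (hgc : HasCompactSupport g)
    (hgt : tsupport g ⊆ (chartAt (EuclideanSpace ℝ (Fin m)) x₀).target) :
    tsupport (M.pull x₀ g) ⊆ (chartAt (EuclideanSpace ℝ (Fin m)) x₀).symm '' tsupport g := by
  have hc : IsCompact ((chartAt (EuclideanSpace ℝ (Fin m)) x₀).symm '' tsupport g) :=
    hgc.image_of_continuousOn ((chartAt _ x₀).continuousOn_symm.mono hgt)
  refine closure_minimal (fun x hx => ?_) hc.isClosed
  by_cases h : x ∈ (chartAt (EuclideanSpace ℝ (Fin m)) x₀).source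
  · refine ⟨chartAt _ x₀ x, subset_tsupport _ ?_, (chartAt _ x₀).left_inv h⟩
    rwa [Function.mem_support, pull_of_mem h] at hx
  · exact absurd (if_neg h) hx

theorem tsupport_pull_subset (hgc : HasCompactSupport g)
    (hgt : tsupport g ⊆ (chartAt (EuclideanSpace ℝ (Fin m)) x₀).target) :
    tsupport (M.pull x₀ g) ⊆ (chartAt (EuclideanSpace ℝ (Fin m)) x₀).source := by
  refine (tsupport_pull hgc hgt).trans ?_
  rintro _ ⟨p, hp, rfl⟩
  exact (chartAt _ x₀).map_target (hgt hp)

theorem contMDiff_pull (hg : ContDiff ℝ ∞ g) (hgc : HasCompactSupport g)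
    (hgt : tsupport g ⊆ (chartAt (EuclideanSpace ℝ (Fin m)) x₀).target) :
    ContMDiff (𝓡 m) 𝓘(ℝ, ℝ) ∞ (M.pull x₀ g) := by
  refine contMDiff_of_tsupport fun x hx => ?_
  have hxs := tsupport_pull_subset hgc hgt hx
  have h1 : ContMDiffAt (𝓡 m) (𝓡 m) ∞ (chartAt (EuclideanSpace ℝ (Fin m)) x₀) x :=
    contMDiffAt_of_mem_maximalAtlas (IsManifold.chart_mem_maximalAtlas x₀) hxs
  have h2 : ContMDiffAt (𝓡 m) 𝓘(ℝ, ℝ) ∞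
      (fun x => g (chartAt (EuclideanSpace ℝ (Fin m)) x₀ x)) x :=
    hg.contMDiff.contMDiffAt.comp x h1
  refine h2.congr_of_eventuallyEq ?_
  filter_upwards [(chartAt (EuclideanSpace ℝ (Fin m)) x₀).open_source.mem_nhds hxs] with y hy
  exact pull_of_mem hy

theorem contDiffOn_comp_symm {W : Type*} [NormedAddCommGroup W] [NormedSpace ℝ W] {f : M → W}
    {S : Set M} (hf : ContMDiffOn (𝓡 m) 𝓘(ℝ, W) ∞ f S) :
    ContDiffOn ℝ ∞ (fun p => f ((chartAt (EuclideanSpace ℝ (Fin m)) x₀).symm p))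
      ((chartAt (EuclideanSpace ℝ (Fin m)) x₀).target ∩
        (chartAt (EuclideanSpace ℝ (Fin m)) x₀).symm ⁻¹' S) := by
  have h1 : ContMDiffOn (𝓡 m) (𝓡 m) ∞ (chartAt (EuclideanSpace ℝ (Fin m)) x₀).symm
      (chartAt (EuclideanSpace ℝ (Fin m)) x₀).target := contMDiffOn_chart_symm
  exact contMDiffOn_iff_contDiffOn.1 (hf.comp' h1)

end LorentzManifold

namespace MetricBundle
open LorentzManifold
variable {M : LorentzManifold.{u} m}

/-- the standard basis of the model fiber -/
noncomputable abbrev modelBasis (F : MetricBundle M) : Module.Basis (Fin F.rank) ℝ F.model :=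
  LorentzManifold.stdBasis F.rank

/-- the open subset of `ℝᵐ` on which the preferred chart and trivialization at `x₀` are defined -/
def dom (F : MetricBundle M) (x₀ : M) : Set (EuclideanSpace ℝ (Fin m)) :=
  (chartAt (EuclideanSpace ℝ (Fin m)) x₀).target ∩
    (chartAt (EuclideanSpace ℝ (Fin m)) x₀).symm ⁻¹' (trivializationAt F.model F.fiber x₀).baseSet

theorem isOpen_dom (F : MetricBundle M) (x₀ : M) : IsOpen (F.dom x₀) :=
  (chartAt _ x₀).isOpen_inter_preimage_symm (trivializationAt F.model F.fiber x₀).open_baseSet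

theorem mem_dom (F : MetricBundle M) (x₀ : M) :
    chartAt (EuclideanSpace ℝ (Fin m)) x₀ x₀ ∈ F.dom x₀ := by
  refine ⟨(chartAt _ x₀).map_source (mem_chart_source _ x₀), ?_⟩
  rw [Set.mem_preimage, (chartAt _ x₀).left_inv (mem_chart_source _ x₀)]
  exact FiberBundle.mem_baseSet_trivializationAt' x₀

theorem contDiffOn_localRep {F : MetricBundle M} (x₀ : M) (s : F.Sections) :
    ContDiffOn ℝ ∞ (localRep x₀ s) (F.dom x₀) := by
  have h := ((trivializationAt F.model F.fiber x₀).contMDiffOn_section_baseSet_iff (IB := 𝓡 m)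
    (n := ∞) (s := s)).1 s.contMDiff.contMDiffOn
  exact contDiffOn_comp_symm h

/-- multiplication of a section by a smooth function -/
noncomputable def mulSec {F : MetricBundle M} (f : M → ℝ) (hf : ContMDiff (𝓡 m) 𝓘(ℝ, ℝ) ∞ f)
    (s : F.Sections) : F.Sections :=
  ⟨fun x => f x • s x, hf.smul_section s.contMDiff⟩

@[simp] theorem mulSec_apply {F : MetricBundle M} (f : M → ℝ) (hf) (s : F.Sections) (x : M) :
    mulSec f hf s x = f x • s x := rfl

theorem supp_mulSec {F : MetricBundle M} (f : M → ℝ) (hf) (s : F.Sections) :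
    supp (mulSec f hf s) ⊆ tsupport f ∩ supp s := by
  refine closure_minimal (fun x hx => ⟨subset_closure ?_, subset_closure ?_⟩)
    ((isClosed_tsupport f).inter (isClosed_supp s))
  · intro h
    exact hx (by simp [h])
  · intro h
    exact hx (by simp [h])

theorem _root_.ContMDiffSection.sum_apply' {F : MetricBundle M} {ι : Type*} (S : Finset ι)
    (f : ι → F.Sections) (x : M) : (∑ i ∈ S, f i) x = ∑ i ∈ S, f i x := by
  have := map_sum (ContMDiffSection.coeAddHom (𝓡 m) F.model ∞ F.fiber) f S
  exact (congrFun this x).trans (Finset.sum_apply _ _ _)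

theorem tsupport_pull_baseSet (F : MetricBundle M) {x₀ : M} {g : EuclideanSpace ℝ (Fin m) → ℝ}
    (hgc : HasCompactSupport g) (hgt : tsupport g ⊆ F.dom x₀) :
    tsupport (M.pull x₀ g) ⊆ (trivializationAt F.model F.fiber x₀).baseSet := by
  refine (tsupport_pull hgc (hgt.trans Set.inter_subset_left)).trans ?_
  rintro _ ⟨p, hp, rfl⟩
  exact (hgt hp).2

/-- a local frame, multiplied by a cutoff function -/
noncomputable def cutFrame (F : MetricBundle M) (x₀ : M) (g : EuclideanSpace ℝ (Fin m) → ℝ)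
    (hg : ContDiff ℝ ∞ g) (hgc : HasCompactSupport g) (hgt : tsupport g ⊆ F.dom x₀)
    (a : Fin F.rank) : F.Sections :=
  ⟨M.pull x₀ g • (trivializationAt F.model F.fiber x₀).localFrame F.modelBasis a,
    ContMDiffOn.smul_section_of_tsupport
      (contMDiff_pull hg hgc (hgt.trans Set.inter_subset_left)).contMDiffOn
      (trivializationAt F.model F.fiber x₀).open_baseSet (F.tsupport_pull_baseSet hgc hgt)
      ((trivializationAt F.model F.fiber x₀).contMDiffOn_localFrame_baseSet ∞ F.modelBasis a)⟩

theorem cutFrame_apply (F : MetricBundle M) (x₀ : M) {g : EuclideanSpace ℝ (Fin m) → ℝ}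
    (hg : ContDiff ℝ ∞ g) (hgc : HasCompactSupport g) (hgt : tsupport g ⊆ F.dom x₀)
    (a : Fin F.rank) {p : EuclideanSpace ℝ (Fin m)} (hp : p ∈ F.dom x₀) (h1 : g p = 1) :
    F.cutFrame x₀ g hg hgc hgt a ((chartAt _ x₀).symm p) =
      ((trivializationAt F.model F.fiber x₀).continuousLinearEquivAt ℝ _ hp.2).symm
        (F.modelBasis a) := by
  change M.pull x₀ g ((chartAt _ x₀).symm p) • (trivializationAt F.model F.fiber x₀).localFrame
    F.modelBasis a ((chartAt _ x₀).symm p) = _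
  rw [pull_symm hp.1, h1, one_smul, Bundle.Trivialization.localFrame_apply_of_mem_baseSet _ _ hp.2]
  simp [Bundle.Trivialization.basisAt]

/-- a section in terms of the local frame -/
theorem eq_sum_cutFrame (F : MetricBundle M) (x₀ : M) {g : EuclideanSpace ℝ (Fin m) → ℝ}
    (hg : ContDiff ℝ ∞ g) (hgc : HasCompactSupport g) (hgt : tsupport g ⊆ F.dom x₀)
    {p : EuclideanSpace ℝ (Fin m)} (hp : p ∈ F.dom x₀) (h1 : g p = 1) (s : F.Sections) :
    s ((chartAt _ x₀).symm p) = ∑ a, (F.modelBasis.repr (localRep x₀ s p) a) •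
      F.cutFrame x₀ g hg hgc hgt a ((chartAt _ x₀).symm p) := by
  simp only [F.cutFrame_apply x₀ hg hgc hgt _ hp h1]
  simp only [← map_smul, ← map_sum]
  rw [F.modelBasis.sum_repr, ContinuousLinearEquiv.eq_symm_apply]
  rfl

theorem metric_eq_sum (F : MetricBundle M) (x₀ : M) {g : EuclideanSpace ℝ (Fin m) → ℝ}
    (hg : ContDiff ℝ ∞ g) (hgc : HasCompactSupport g) (hgt : tsupport g ⊆ F.dom x₀)
    {p : EuclideanSpace ℝ (Fin m)} (hp : p ∈ F.dom x₀) (h1 : g p = 1) (t s : F.Sections) :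
    metric t s ((chartAt _ x₀).symm p) = ∑ a, (F.modelBasis.repr (localRep x₀ s p) a) *
      metric t (F.cutFrame x₀ g hg hgc hgt a) ((chartAt _ x₀).symm p) := by
  rw [metric, F.eq_sum_cutFrame x₀ hg hgc hgt hp h1 s, map_sum]
  simp [metric]

/-- the functional `v ↦ h(t, v)` in local coordinates -/
noncomputable def coFun (F : MetricBundle M) (x₀ : M) (g : EuclideanSpace ℝ (Fin m) → ℝ)
    (hg : ContDiff ℝ ∞ g) (hgc : HasCompactSupport g) (hgt : tsupport g ⊆ F.dom x₀)
    (t : F.Sections) (p : EuclideanSpace ℝ (Fin m)) : F.model →L[ℝ] ℝ :=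
  ∑ a, metric t (F.cutFrame x₀ g hg hgc hgt a) ((chartAt _ x₀).symm p) •
    LinearMap.toContinuousLinearMap (F.modelBasis.coord a)

theorem contDiffOn_metric_symm {F : MetricBundle M} (x₀ : M) (s t : F.Sections) :
    ContDiffOn ℝ ∞ (fun p => metric s t ((chartAt (EuclideanSpace ℝ (Fin m)) x₀).symm p))
      (chartAt (EuclideanSpace ℝ (Fin m)) x₀).target := by
  have := contDiffOn_comp_symm (x₀ := x₀) (F.h_smooth s t).contMDiffOn (S := Set.univ)
  rwa [Set.preimage_univ, Set.inter_univ] at this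

theorem contDiffOn_coFun (F : MetricBundle M) (x₀ : M) {g : EuclideanSpace ℝ (Fin m) → ℝ}
    (hg : ContDiff ℝ ∞ g) (hgc : HasCompactSupport g) (hgt : tsupport g ⊆ F.dom x₀)
    (t : F.Sections) : ContDiffOn ℝ ∞ (F.coFun x₀ g hg hgc hgt t)
      (chartAt (EuclideanSpace ℝ (Fin m)) x₀).target := by
  refine ContDiffOn.sum fun a _ => ?_
  exact (contDiffOn_metric_symm x₀ _ _).smul contDiffOn_const

theorem metric_eq_coFun (F : MetricBundle M) (x₀ : M) {g : EuclideanSpace ℝ (Fin m) → ℝ}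
    (hg : ContDiff ℝ ∞ g) (hgc : HasCompactSupport g) (hgt : tsupport g ⊆ F.dom x₀)
    {p : EuclideanSpace ℝ (Fin m)} (hp : p ∈ F.dom x₀) (h1 : g p = 1) (t s : F.Sections) :
    metric t s ((chartAt _ x₀).symm p) = F.coFun x₀ g hg hgc hgt t p (localRep x₀ s p) := by
  rw [F.metric_eq_sum x₀ hg hgc hgt hp h1 t s, coFun, sum_apply]
  refine Finset.sum_congr rfl fun a _ => ?_
  simp [mul_comm]

/-- Locally, each functional on the fibers is given by the fiber metric. -/
theorem exists_musical (F : MetricBundle M) (x₀ : M) {g : EuclideanSpace ℝ (Fin m) → ℝ}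
    (hg : ContDiff ℝ ∞ g) (hgc : HasCompactSupport g) (hgt : tsupport g ⊆ F.dom x₀)
    (w : EuclideanSpace ℝ (Fin m) → (F.model →L[ℝ] ℝ)) (hw : ContDiff ℝ ∞ w)
    {χ : EuclideanSpace ℝ (Fin m) → ℝ} (hχ : ContDiff ℝ ∞ χ) (hχc : HasCompactSupport χ)
    {O : Set (EuclideanSpace ℝ (Fin m))} (hO : IsOpen O) (hOd : O ⊆ F.dom x₀)
    (hO1 : ∀ p ∈ O, g p = 1) (hχO : tsupport χ ⊆ O) :
    ∃ r : F.Sections, ∀ s : F.Sections, ∀ p ∈ O,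
      metric r s ((chartAt _ x₀).symm p) = χ p * w p (localRep x₀ s p) := by
  let e := F.cutFrame x₀ g hg hgc hgt
  let G : EuclideanSpace ℝ (Fin m) → Matrix (Fin F.rank) (Fin F.rank) ℝ := fun p =>
    .of fun a b => metric (e a) (e b) ((chartAt _ x₀).symm p)
  have hGdet : ∀ p ∈ O, (G p).det ≠ 0 := by
    intro p hp h0
    obtain ⟨v, hv, hGv⟩ := Matrix.exists_mulVec_eq_zero_iff.2 h0
    let L := ((trivializationAt F.model F.fiber x₀).continuousLinearEquivAt ℝ _ (hOd hp).2).symm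
    have hL : ∀ a, e a ((chartAt _ x₀).symm p) = L (F.modelBasis a) := fun a =>
      F.cutFrame_apply x₀ hg hgc hgt a (hOd hp) (hO1 p hp)
    have h2 : L (∑ b, v b • F.modelBasis b) = 0 := by
      refine F.h_nondegenerate _ _ fun y => ?_
      obtain ⟨y, rfl⟩ := L.surjective y
      have h5 : ∀ a, F.h _ (L (F.modelBasis a)) (L (∑ b, v b • F.modelBasis b)) = 0 := by
        intro a
        have h6 : ∑ b, G p a b * v b = 0 := congrFun hGv a
        rw [map_sum, map_sum, ← h6]
        refine Finset.sum_congr rfl fun b _ => ?_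
        rw [map_smul, map_smul, smul_eq_mul, mul_comm, ← hL, ← hL]
        rfl
      rw [F.h_symm, ← F.modelBasis.sum_repr y, map_sum, map_sum, LinearMap.sum_apply]
      refine Finset.sum_eq_zero fun a _ => ?_
      rw [map_smul, map_smul, LinearMap.smul_apply, h5, smul_zero]
    have h3 : ∑ b, v b • F.modelBasis b = 0 := L.injective (h2.trans (map_zero L).symm)
    refine hv (funext fun b => ?_)
    exact Fintype.linearIndependent_iff.1 F.modelBasis.linearIndependent v h3 b
  have hG : ∀ a b, ContDiffOn ℝ ∞ (fun p => G p a b) O := fun a b =>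
    (contDiffOn_metric_symm x₀ (e a) (e b)).mono fun p hp => (hOd hp).1
  have hdet : ∀ A : EuclideanSpace ℝ (Fin m) → Matrix (Fin F.rank) (Fin F.rank) ℝ,
      (∀ a b, ContDiffOn ℝ ∞ (fun p => A p a b) O) → ContDiffOn ℝ ∞ (fun p => (A p).det) O := by
    intro A hA
    simp only [Matrix.det_apply']
    exact ContDiffOn.sum fun σ _ => contDiffOn_const.mul (contDiffOn_prod fun i _ => hA _ _)
  have hGinv : ∀ a b, ContDiffOn ℝ ∞ (fun p => (G p)⁻¹ a b) O := by
    intro a b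
    simp only [Matrix.inv_def, Ring.inverse_eq_inv', Matrix.smul_apply, smul_eq_mul,
      Matrix.adjugate_apply]
    refine ((hdet G hG).inv hGdet).mul (hdet _ fun i j => ?_)
    by_cases hi : i = b
    · subst hi
      simp only [Matrix.updateRow_self]
      exact contDiffOn_const
    · simp only [Matrix.updateRow_ne hi]
      exact hG i j
  let c (a : Fin F.rank) (p : EuclideanSpace ℝ (Fin m)) : ℝ :=
    χ p • ∑ b, w p (F.modelBasis b) * (G p)⁻¹ b a
  have hc : ∀ a, ContDiff ℝ ∞ (c a) := fun a =>
    contDiff_smul_of_tsupport hO hχ hχO (ContDiffOn.sum fun b _ =>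
      (hw.clm_apply contDiff_const).contDiffOn.mul (hGinv b a))
  have hcs : ∀ a, tsupport (c a) ⊆ tsupport χ := fun a =>
    closure_mono fun p hp h => hp (by simp [c, h])
  have hct : ∀ a, tsupport (c a) ⊆ (chartAt (EuclideanSpace ℝ (Fin m)) x₀).target := fun a p hp =>
    (hOd (hχO (hcs a hp))).1
  have hcc : ∀ a, HasCompactSupport (c a) := fun a =>
    hχc.of_isClosed_subset isClosed_closure (hcs a)
  refine ⟨∑ a, mulSec (M.pull x₀ (c a)) (contMDiff_pull (hc a) (hcc a) (hct a)) (e a), ?_⟩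
  intro s p hp
  rw [F.metric_eq_sum x₀ hg hgc hgt (hOd hp) (hO1 p hp) _ s]
  have h1 : ∀ b, metric (∑ a, mulSec (M.pull x₀ (c a))
      (contMDiff_pull (hc a) (hcc a) (hct a)) (e a)) (e b) ((chartAt _ x₀).symm p) =
      χ p * w p (F.modelBasis b) := by
    intro b
    have h2 : metric (∑ a, mulSec (M.pull x₀ (c a))
        (contMDiff_pull (hc a) (hcc a) (hct a)) (e a)) (e b) ((chartAt _ x₀).symm p) =
        ∑ a, c a p * G p a b := by
      rw [metric, ContMDiffSection.sum_apply', map_sum, LinearMap.sum_apply]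
      refine Finset.sum_congr rfl fun a _ => ?_
      rw [mulSec_apply, pull_symm (hOd hp).1, map_smul]
      rfl
    rw [h2]
    simp only [c, smul_eq_mul, mul_assoc, ← Finset.mul_sum, Finset.sum_mul]
    rw [Finset.sum_comm]
    congr 1
    have h4 : ∀ b', ∑ a, (G p)⁻¹ b' a * G p a b = (1 : Matrix (Fin F.rank) (Fin F.rank) ℝ) b' b := by
      intro b'
      rw [← Matrix.nonsing_inv_mul (G p) (isUnit_iff_ne_zero.2 (hGdet p hp)), Matrix.mul_apply]
    simp only [← Finset.mul_sum, h4]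
    simp [Matrix.one_apply]
  have h3 : ∀ b, metric (∑ a, mulSec (M.pull x₀ (c a))
      (contMDiff_pull (hc a) (hcc a) (hct a)) (e a)) (F.cutFrame x₀ g hg hgc hgt b)
        ((chartAt _ x₀).symm p) = χ p * w p (F.modelBasis b) := h1
  simp only [h3]
  conv_rhs => rw [← F.modelBasis.sum_repr (localRep x₀ s p), map_sum, Finset.mul_sum]
  refine Finset.sum_congr rfl fun a _ => ?_
  rw [map_smul, smul_eq_mul]
  ring

end MetricBundle
end HomotopyAQFT

namespace HomotopyAQFT
open scoped TensorProduct DirectSum Manifold ContDiff Topology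
open MeasureTheory
namespace MetricBundle
open LorentzManifold
variable {m : ℕ} {M : LorentzManifold.{u} m}

theorem localRep_eventually_zero {F : MetricBundle M} {x₀ : M} {s : F.Sections}
    {p : EuclideanSpace ℝ (Fin m)} (hp : p ∈ F.dom x₀)
    (hs : ∀ᶠ y in 𝓝 ((chartAt (EuclideanSpace ℝ (Fin m)) x₀).symm p), s y = 0) :
    localRep x₀ s =ᶠ[𝓝 p] fun _ => 0 := by
  have hc := (chartAt (EuclideanSpace ℝ (Fin m)) x₀).continuousAt_symm hp.1
  have hb := (trivializationAt F.model F.fiber x₀).open_baseSet.mem_nhds hp.2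
  filter_upwards [hc.eventually hs, hc.eventually hb] with q hq hqb
  rw [localRep, hq]
  exact ((trivializationAt F.model F.fiber x₀).linear ℝ hqb).map_zero

theorem exists_local_adjoint {F G : MetricBundle M} {D : F.Sections →ₗ[ℝ] G.Sections}
    (hD : IsDiffOp D) (t : G.Sections) (x₀ : M) : ∃ W : Set M, IsOpen W ∧ x₀ ∈ W ∧
      ∃ r : F.Sections, ∀ s : F.Sections, supp s ⊆ W → pairing t (D s) = pairing r s := by
  obtain ⟨k, hk⟩ := id hD
  obtain ⟨U, hU, hxU, A, hA, hDA⟩ := hk x₀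
  set φ := chartAt (EuclideanSpace ℝ (Fin m)) x₀ with hφ
  have hO : IsOpen (U ∩ (F.dom x₀ ∩ G.dom x₀)) :=
    hU.inter ((F.isOpen_dom x₀).inter (G.isOpen_dom x₀))
  obtain ⟨ε, hε, hεO⟩ := Metric.nhds_basis_closedBall.mem_iff.1
    (hO.mem_nhds ⟨hxU, F.mem_dom x₀, G.mem_dom x₀⟩)
  let g : ContDiffBump (φ x₀) := ⟨2 * ε / 3, ε, by positivity, by linarith⟩
  let χ : ContDiffBump (φ x₀) := ⟨ε / 3, ε / 2, by positivity, by linarith⟩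
  have hgs : tsupport g ⊆ U ∩ (F.dom x₀ ∩ G.dom x₀) := by rw [g.tsupport_eq]; exact hεO
  have hgF : tsupport g ⊆ F.dom x₀ := fun p hp => (hgs hp).2.1
  have hgG : tsupport g ⊆ G.dom x₀ := fun p hp => (hgs hp).2.2
  have hχg : tsupport χ ⊆ Metric.ball (φ x₀) (2 * ε / 3) := by
    rw [χ.tsupport_eq]
    exact Metric.closedBall_subset_ball (show ε / 2 < 2 * ε / 3 by linarith)
  have hBO : Metric.ball (φ x₀) (2 * ε / 3) ⊆ U ∩ (F.dom x₀ ∩ G.dom x₀) :=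
    Metric.ball_subset_closedBall.trans
      ((Metric.closedBall_subset_closedBall (by linarith)).trans hεO)
  have hg1 : ∀ p ∈ Metric.ball (φ x₀) (2 * ε / 3), g p = 1 := fun p hp =>
    g.one_of_mem_closedBall (Metric.ball_subset_closedBall hp)
  have hχO : tsupport χ ⊆ U ∩ (F.dom x₀ ∩ G.dom x₀) := hχg.trans hBO
  have hgC : ContDiff ℝ ∞ g := g.contDiff
  have hχC : ContDiff ℝ ∞ χ := χ.contDiff
  have hρ : ContDiffOn ℝ ∞ (fun p => M.density x₀ (φ.symm p)) φ.target := by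
    have := contDiffOn_comp_symm (x₀ := x₀) (M.smoothOn_density x₀)
    refine this.mono fun p hp => ⟨hp, φ.map_target hp⟩
  have hρ0 : ∀ p ∈ φ.target, M.density x₀ (φ.symm p) ≠ 0 := fun p hp =>
    (M.density_pos (φ.map_target hp)).ne'
  let C (j : ℕ) (p : EuclideanSpace ℝ (Fin m)) :
      (EuclideanSpace ℝ (Fin m) [×j]→L[ℝ] F.model) →L[ℝ] ℝ :=
    ((χ p • (M.density x₀ (φ.symm p) • G.coFun x₀ g hgC g.hasCompactSupport hgG t p) :
      G.model →L[ℝ] ℝ)).comp (g p • A j p)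
  have hC : ∀ j, ContDiff ℝ ∞ (C j) := fun j => by
    refine ContDiff.clm_comp (contDiff_smul_of_tsupport hO hχC hχO ?_)
      (contDiff_smul_of_tsupport hO hgC hgs ((hA j).mono fun p hp => hp.1))
    exact (hρ.mono fun p hp => hp.2.1.1).smul
      ((G.contDiffOn_coFun x₀ hgC g.hasCompactSupport hgG t).mono fun p hp => hp.2.1.1)
  have hCs : ∀ j, tsupport (C j) ⊆ tsupport χ := fun j =>
    closure_mono fun p hp h => hp (by simp [C, h])
  have hCc : ∀ j, HasCompactSupport (C j) := fun j =>
    χ.hasCompactSupport.of_isClosed_subset isClosed_closure (hCs j)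
  choose w hw hws hwf using fun j => exists_adjoint_euclidean j (C j) (hC j) (hCc j)
  have hwz : ∀ j, ∀ p ∉ tsupport χ, w j p = 0 := fun j p hp =>
    image_eq_zero_of_notMem_tsupport fun h => hp (hCs j (hws j h))
  have hCz : ∀ j, ∀ p ∉ tsupport χ, C j p = 0 := fun j p hp =>
    image_eq_zero_of_notMem_tsupport fun h => hp (hCs j h)
  let v (p : EuclideanSpace ℝ (Fin m)) : F.model →L[ℝ] ℝ :=
    χ p • ((M.density x₀ (φ.symm p))⁻¹ • ∑ j ∈ Finset.range (k + 1), w j p)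
  have hv : ContDiff ℝ ∞ v := by
    refine contDiff_smul_of_tsupport hO hχC hχO ?_
    exact ((hρ.inv hρ0).mono fun p hp => hp.2.1.1).smul
      (ContDiff.sum fun j _ => hw j).contDiffOn
  obtain ⟨r, hr⟩ := F.exists_musical x₀ hgC g.hasCompactSupport hgF v hv hχC χ.hasCompactSupport
    Metric.isOpen_ball (fun p hp => (hBO hp).2.1) hg1 hχg
  refine ⟨φ.source ∩ φ ⁻¹' Metric.ball (φ x₀) (ε / 3), φ.isOpen_inter_preimage Metric.isOpen_ball,
    ⟨mem_chart_source _ x₀, Metric.mem_ball_self (by positivity)⟩, r, fun s hs => ?_⟩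
  have hoff : ∀ p ∈ φ.target, p ∉ Metric.ball (φ x₀) (ε / 3) → φ.symm p ∉ supp s := by
    intro p hp hpb hps
    refine hpb ?_
    have := (hs hps).2
    rwa [Set.mem_preimage, φ.right_inv hp] at this
  let f (p : EuclideanSpace ℝ (Fin m)) : F.model := χ p • localRep x₀ s p
  have hf : ContDiff ℝ ∞ f := contDiff_smul_of_tsupport (F.isOpen_dom x₀) hχC
    (fun p hp => (hχO hp).2.1) (contDiffOn_localRep x₀ s)
  have hB : Metric.ball (φ x₀) (ε / 3) ⊆ Metric.ball (φ x₀) (2 * ε / 3) :=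
    Metric.ball_subset_ball (by linarith)
  have hχ1 : ∀ p ∈ Metric.ball (φ x₀) (ε / 3), χ p = 1 := fun p hp =>
    χ.one_of_mem_closedBall (Metric.ball_subset_closedBall hp)
  have hf1 : ∀ p ∈ Metric.ball (φ x₀) (ε / 3), f =ᶠ[𝓝 p] localRep x₀ s := fun p hp => by
    filter_upwards [Metric.isOpen_ball.mem_nhds hp] with q hq
    simp [f, hχ1 q hq]
  have hf0 : ∀ p ∈ φ.target, p ∉ Metric.ball (φ x₀) (ε / 3) → p ∈ tsupport χ →
      f =ᶠ[𝓝 p] fun _ => 0 := fun p hp hpb hpχ => by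
    filter_upwards [localRep_eventually_zero (hχO hpχ).2.1 (notMem_supp.1 (hoff p hp hpb))]
      with q hq
    simp [f, hq]
  have e1 : pairing t (D s) = ∫ p, ∑ j ∈ Finset.range (k + 1), C j p (iteratedFDeriv ℝ j f p) := by
    rw [pairing, M.integral_eq_chart x₀ (continuous_metric t (D s))]
    refine Eq.trans ?_ (setIntegral_eq_integral_of_forall_compl_eq_zero (s := φ.target) ?_)
    · refine setIntegral_congr_fun φ.open_target.measurableSet fun p hp => ?_
      change M.density x₀ (φ.symm p) * metric t (D s) (φ.symm p) = _
      by_cases hpb : p ∈ Metric.ball (φ x₀) (ε / 3)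
      · rw [G.metric_eq_coFun x₀ hgC g.hasCompactSupport hgG (hBO (hB hpb)).2.2 (hg1 p (hB hpb)),
          hDA s p (hBO (hB hpb)).1, map_sum, Finset.mul_sum]
        refine Finset.sum_congr rfl fun j _ => ?_
        rw [((hf1 p hpb).iteratedFDeriv ℝ j).self_of_nhds]
        simp [C, hχ1 p hpb, hg1 p (hB hpb)]
      · have h1 : D s (φ.symm p) = 0 :=
          eq_zero_of_notMem fun h => hoff p hp hpb (hD.supp_subset s h)
        rw [metric, h1, map_zero, mul_zero]
        refine (Finset.sum_eq_zero fun j _ => ?_).symm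
        by_cases hpχ : p ∈ tsupport χ
        · rw [((hf0 p hp hpb hpχ).iteratedFDeriv ℝ j).self_of_nhds]
          simp
        · rw [hCz j p hpχ]; rfl
    · intro p hp
      refine Finset.sum_eq_zero fun j _ => ?_
      rw [hCz j p fun h => hp (hχO h).2.1.1]; rfl
    · intro x hx
      rw [metric, eq_zero_of_notMem fun h => hx (hs (hD.supp_subset s h)).1, map_zero]
  have e2 : pairing r s = ∫ p, ∑ j ∈ Finset.range (k + 1), w j p (f p) := by
    rw [pairing, M.integral_eq_chart x₀ (continuous_metric r s)]
    refine Eq.trans ?_ (setIntegral_eq_integral_of_forall_compl_eq_zero (s := φ.target) ?_)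
    · refine setIntegral_congr_fun φ.open_target.measurableSet fun p hp => ?_
      change M.density x₀ (φ.symm p) * metric r s (φ.symm p) = _
      by_cases hpb : p ∈ Metric.ball (φ x₀) (ε / 3)
      · rw [hr s p (hB hpb), hχ1 p hpb, one_mul, (hf1 p hpb).self_of_nhds]
        simp only [v, hχ1 p hpb, one_smul, smul_apply, smul_eq_mul, sum_apply]
        rw [mul_inv_cancel_left₀ (hρ0 p hp)]
      · rw [metric, eq_zero_of_notMem (hoff p hp hpb), map_zero, mul_zero]
        refine (Finset.sum_eq_zero fun j _ => ?_).symm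
        by_cases hpχ : p ∈ tsupport χ
        · rw [(hf0 p hp hpb hpχ).self_of_nhds, map_zero]
        · rw [hwz j p hpχ]; rfl
    · intro p hp
      refine Finset.sum_eq_zero fun j _ => ?_
      rw [hwz j p fun h => hp (hχO h).2.1.1]; rfl
    · intro x hx
      rw [metric, eq_zero_of_notMem fun h => hx (hs h).1, map_zero]
  rw [e1, e2, integral_finsetSum, integral_finsetSum]
  · exact Finset.sum_congr rfl fun j _ => hwf j f hf
  · intro j _
    refine Continuous.integrable_of_hasCompactSupport ((hw j).continuous.clm_apply hf.continuous) ?_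
    exact χ.hasCompactSupport.of_isClosed_subset isClosed_closure
      (closure_minimal (fun p hp => by_contra fun h => hp (by simp [hwz j p h])) isClosed_closure)
  · intro j _
    refine Continuous.integrable_of_hasCompactSupport ((hC j).continuous.clm_apply
      (contDiff_infty.2 fun n => (contDiff_infty.1 hf (n + j)).iteratedFDeriv_right
        (by norm_cast)).continuous) ?_
    exact χ.hasCompactSupport.of_isClosed_subset isClosed_closure
      (closure_minimal (fun p hp => by_contra fun h => hp (by simp [hCz j p h])) isClosed_closure)

end MetricBundle
end HomotopyAQFT

namespace HomotopyAQFT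
open scoped TensorProduct DirectSum Manifold ContDiff Topology
open MeasureTheory
namespace LorentzManifold
variable {m : ℕ} (M : LorentzManifold.{u} m)

instance : SigmaCompactSpace M := sigmaCompactSpace_of_locallyCompact_secondCountable

/-- a compactly supported cutoff function that is one near a compact set and vanishes off a
neighborhood of it -/
theorem exists_cutoff {K W : Set M} (hK : IsCompact K) (hW : IsOpen W) (hKW : K ⊆ W) :
    ∃ χ : M → ℝ, ContMDiff (𝓡 m) 𝓘(ℝ, ℝ) ∞ χ ∧ (∀ x ∈ K, ∀ᶠ y in 𝓝 x, χ y = 1) ∧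
      HasCompactSupport χ ∧ tsupport χ ⊆ W ∧ ∀ x, 0 ≤ χ x := by
  obtain ⟨L, hL, hKL, hLW⟩ := exists_compact_between hK hW hKW
  obtain ⟨χ, h1, h0, h2⟩ := exists_contMDiffMap_one_nhds_of_subset_interior (n := (⊤ : ℕ∞))
    (𝓡 m) hK.isClosed hKL
  have hs : tsupport χ ⊆ L :=
    closure_minimal (fun x hx => by_contra fun h => hx (h0 x h)) hL.isClosed
  exact ⟨χ, χ.contMDiff, fun x hx => h1.filter_mono (nhds_le_nhdsSet hx),
    hL.of_isClosed_subset isClosed_closure hs, hs.trans hLW, fun x => (h2 x).1⟩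

end LorentzManifold

namespace MetricBundle
open LorentzManifold
variable {m : ℕ} {M : LorentzManifold.{u} m}

/-- there is a section through each vector -/
theorem exists_section_through (F : MetricBundle M) (x₀ : M) (w : F.fiber x₀) :
    ∃ s : F.Sections, s x₀ = w := by
  set φ := chartAt (EuclideanSpace ℝ (Fin m)) x₀
  obtain ⟨ε, hε, hεO⟩ := Metric.nhds_basis_closedBall.mem_iff.1
    ((F.isOpen_dom x₀).mem_nhds (F.mem_dom x₀))
  let g : ContDiffBump (φ x₀) := ⟨ε / 2, ε, by positivity, by linarith⟩
  have hgF : tsupport g ⊆ F.dom x₀ := by rw [g.tsupport_eq]; exact hεO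
  have h1 : g (φ x₀) = 1 := g.one_of_mem_closedBall (Metric.mem_closedBall_self (by positivity))
  let L := (trivializationAt F.model F.fiber x₀).continuousLinearEquivAt ℝ _ (F.mem_dom x₀).2
  have hx : φ.symm (φ x₀) = x₀ := φ.left_inv (mem_chart_source _ x₀)
  obtain ⟨s, hs⟩ : ∃ s : F.Sections, ∃ y : M, y = x₀ ∧ ∀ w : F.fiber y, ∃ s : F.Sections,
      s y = w := by
    refine ⟨0, φ.symm (φ x₀), hx, fun w => ?_⟩
    refine ⟨∑ a, F.modelBasis.repr (L w) a • F.cutFrame x₀ g g.contDiff g.hasCompactSupport hgF a,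
      ?_⟩
    rw [ContMDiffSection.sum_apply']
    change ∑ a, F.modelBasis.repr (L w) a •
      (F.cutFrame x₀ g g.contDiff g.hasCompactSupport hgF a) (φ.symm (φ x₀)) = w
    have hcf : ∀ a, F.cutFrame x₀ g g.contDiff g.hasCompactSupport hgF a (φ.symm (φ x₀)) =
        L.symm (F.modelBasis a) := fun a =>
      F.cutFrame_apply x₀ g.contDiff g.hasCompactSupport hgF a (F.mem_dom x₀) h1
    simp only [hcf]
    simp only [← map_smul, ← map_sum]
    rw [F.modelBasis.sum_repr]
    exact L.symm_apply_apply w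
  obtain ⟨y, rfl, h⟩ := hs
  exact h w

/-- The integration pairing is nondegenerate, locally. -/
theorem eq_zero_of_pairing {F : MetricBundle M} {W : Set M} (hW : IsOpen W) {r : F.Sections}
    (h : ∀ s : F.Sections, IsCompact (supp s) → supp s ⊆ W → pairing r s = 0) {x : M}
    (hx : x ∈ W) : r x = 0 := by
  by_contra hr
  obtain ⟨w, hw⟩ : ∃ w, F.h x (r x) w ≠ 0 := by
    by_contra! hw
    exact hr (F.h_nondegenerate x _ hw)
  obtain ⟨s, rfl⟩ := F.exists_section_through x w
  obtain ⟨χ, hχ, hχ1, hχc, hχW, hχ0⟩ := M.exists_cutoff (isCompact_singleton (x := x)) hW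
    (Set.singleton_subset_iff.2 hx)
  have h1 := h (mulSec χ hχ (mulSec (metric r s) (F.h_smooth r s) s))
    (hχc.of_isClosed_subset (isClosed_supp _) ((supp_mulSec _ _ _).trans Set.inter_subset_left))
    ((supp_mulSec _ _ _).trans (Set.inter_subset_left.trans hχW))
  have h2 : 0 < ∫ y, χ y * (metric r s y) ^ 2 ∂M.volumeMeasure := by
    refine Continuous.integral_pos_of_hasCompactSupport_nonneg_nonzero (x := x)
      (hχ.continuous.mul ((continuous_metric r s).pow 2)) hχc.mul_right
      (fun y => mul_nonneg (hχ0 y) (sq_nonneg _)) ?_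
    rw [(hχ1 x rfl).self_of_nhds, one_mul]
    exact pow_ne_zero _ hw
  refine h2.ne' ?_
  rw [← h1, pairing]
  refine integral_congr_ae (ae_of_all _ fun y => ?_)
  change χ y * metric r s y ^ 2 = F.h y (r y) (χ y • (metric r s y • s y))
  rw [map_smul, map_smul, smul_eq_mul, smul_eq_mul, sq]
  rfl

theorem eqOn_of_pairing {F : MetricBundle M} {W : Set M} (hW : IsOpen W) {r r' : F.Sections}
    (h : ∀ s : F.Sections, IsCompact (supp s) → supp s ⊆ W → pairing r s = pairing r' s) {x : M}
    (hx : x ∈ W) : r x = r' x := by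
  have h1 : (r - r') x = 0 := by
    refine eq_zero_of_pairing hW (fun s hs hsW => ?_) hx
    have hc : ∀ t : F.Sections, IsCompact (supp s ∩ supp t) := fun t => hs.inter_right
      (isClosed_supp t)
    rw [pairing_symm, sub_eq_add_neg, ← neg_one_smul ℝ r', pairing_add_right _ _ _ (hc _) (hc _),
      pairing_smul_right, pairing_symm s, pairing_symm s, h s hs hsW]
    ring
  have h2 : (r - r') x = r x - r' x := rfl
  exact sub_eq_zero.1 (h2.symm.trans h1)

/-- `D'` is the formal adjoint of `D`: `⟨t, D s⟩ = ⟨D' t, s⟩` for all sections `t`, `s` with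
compactly overlapping supports. -/
def IsFormalAdjoint {F G : MetricBundle M} (D : F.Sections →ₗ[ℝ] G.Sections)
    (D' : G.Sections →ₗ[ℝ] F.Sections) : Prop :=
  ∀ t s, IsCompact (supp t ∩ supp s) → pairing t (D s) = pairing (D' t) s

theorem exists_adjoint_compact {F G : MetricBundle M} {D : F.Sections →ₗ[ℝ] G.Sections}
    (hD : IsDiffOp D) (t : G.Sections) : ∃ r : F.Sections,
      ∀ s : F.Sections, IsCompact (supp s) → pairing t (D s) = pairing r s := by
  have huniq : ∀ {W W' : Set M} {r r' : F.Sections}, IsOpen W → IsOpen W' →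
      (∀ s : F.Sections, supp s ⊆ W → pairing t (D s) = pairing r s) →
      (∀ s : F.Sections, supp s ⊆ W' → pairing t (D s) = pairing r' s) →
      ∀ y ∈ W ∩ W', r y = r' y := by
    intro W W' r r' hW hW' h h' y hy
    refine eqOn_of_pairing (hW.inter hW') (fun s hs hsW => ?_) hy
    rw [← h s (hsW.trans Set.inter_subset_left), ← h' s (hsW.trans Set.inter_subset_right)]
  choose W hW hxW r hr using exists_local_adjoint hD t
  obtain ⟨R, hR⟩ : ∃ R : F.Sections, ∀ x, R x ∈ {v : F.fiber x | ∀ x₀, x ∈ W x₀ → v = r x₀ x} := by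
    refine exists_contMDiffSection_forall_mem_convex_of_local (𝓡 m) F.fiber _ (fun x => ?_)
      fun x₀ => ⟨W x₀, (hW x₀).mem_nhds (hxW x₀), r x₀, (r x₀).contMDiff.contMDiffOn, ?_⟩
    · intro v hv w hw a b ha hb hab x₀ hx
      rw [hv x₀ hx, hw x₀ hx, ← add_smul, hab, one_smul]
    · intro y hy x₁ hy₁
      exact huniq (hW x₀) (hW x₁) (hr x₀) (hr x₁) y ⟨hy, hy₁⟩
  refine ⟨R, fun s hs => ?_⟩
  obtain ⟨ρ, hρ⟩ := SmoothPartitionOfUnity.exists_isSubordinate (𝓡 m) (isClosed_supp s) W hW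
    (fun x _ => Set.mem_iUnion.2 ⟨x, hxW x⟩)
  have hfin := ρ.locallyFinite.finite_nonempty_inter_compact hs
  have hsum : s = ∑ i ∈ hfin.toFinset, mulSec (ρ i) (ρ i).contMDiff s := by
    ext x
    rw [ContMDiffSection.sum_apply']
    simp only [mulSec_apply, ← Finset.sum_smul]
    by_cases hx : x ∈ supp s
    · have h1 := ρ.sum_eq_one hx
      rw [finsum_eq_sum_of_support_subset (s := hfin.toFinset)] at h1
      · rw [h1, one_smul]
      · intro i hi
        rw [Set.Finite.coe_toFinset]
        exact ⟨x, hi, hx⟩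
    · rw [eq_zero_of_notMem hx, smul_zero]
  have hpc : ∀ i, IsCompact (supp (mulSec (ρ i) (ρ i).contMDiff s)) := fun i =>
    hs.of_isClosed_subset (isClosed_supp _) ((supp_mulSec _ _ _).trans Set.inter_subset_right)
  have hpW : ∀ i, supp (mulSec (ρ i) (ρ i).contMDiff s) ⊆ W i := fun i =>
    (supp_mulSec _ _ _).trans (Set.inter_subset_left.trans (hρ i))
  have hpiece : ∀ i, pairing t (D (mulSec (ρ i) (ρ i).contMDiff s)) =
      pairing R (mulSec (ρ i) (ρ i).contMDiff s) := fun i => by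
    rw [hr i _ (hpW i), pairing, pairing]
    refine integral_congr_ae (ae_of_all _ fun x => ?_)
    by_cases hx : x ∈ W i
    · simp only [metric]
      rw [hR x i hx]
    · simp only [metric]
      rw [eq_zero_of_notMem fun h => hx (hpW i h), map_zero, map_zero]
  have key : ∀ S : Finset M, IsCompact (supp (∑ i ∈ S, mulSec (ρ i) (ρ i).contMDiff s)) ∧
      pairing t (D (∑ i ∈ S, mulSec (ρ i) (ρ i).contMDiff s)) =
      pairing R (∑ i ∈ S, mulSec (ρ i) (ρ i).contMDiff s) := by
    classical
    intro S
    induction S using Finset.induction_on with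
    | empty =>
      rw [Finset.sum_empty, map_zero]
      refine ⟨by simp [supp_zero], ?_⟩
      simp [pairing, metric]
    | insert i S hi ih =>
      rw [Finset.sum_insert hi, map_add]
      have hm : ∀ {H : MetricBundle M} (q : H.Sections) {p : H.Sections}, IsCompact (supp p) →
        IsCompact (supp q ∩ supp p) := fun q p hp => hp.inter_left (isClosed_supp q)
      have hDc : ∀ {p : F.Sections}, IsCompact (supp p) → IsCompact (supp (D p)) := fun hp =>
        hp.of_isClosed_subset (isClosed_supp _) (hD.supp_subset _)
      refine ⟨F.compactSections.add_mem (hpc i) ih.1, ?_⟩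
      rw [pairing_add_right _ _ _ (hm _ (hDc (hpc i))) (hm _ (hDc ih.1)),
        pairing_add_right _ _ _ (hm _ (hpc i)) (hm _ ih.1), ih.2, hpiece]
  have := (key hfin.toFinset).2
  rwa [← hsum] at this

theorem supp_adjoint_subset {F G : MetricBundle M} {D : F.Sections →ₗ[ℝ] G.Sections}
    (hD : IsDiffOp D) {t : G.Sections} {r : F.Sections}
    (h : ∀ s : F.Sections, IsCompact (supp s) → pairing t (D s) = pairing r s) :
    supp r ⊆ supp t := by
  refine closure_minimal (fun x hx => by_contra fun hxt => hx ?_) (isClosed_supp t)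
  refine eq_zero_of_pairing (isClosed_supp t).isOpen_compl (fun s hs hst => ?_) hxt
  rw [← h s hs, pairing, integral_eq_zero_of_ae]
  refine ae_of_all _ fun y => ?_
  change G.h y _ _ = 0
  by_cases hy : y ∈ supp t
  · rw [eq_zero_of_notMem (s := D s) fun h' => hst (hD.supp_subset s h') hy, map_zero]
  · rw [eq_zero_of_notMem hy, map_zero, LinearMap.zero_apply]

/-- Every linear differential operator has a formal adjoint. -/
theorem exists_isFormalAdjoint {F G : MetricBundle M} {D : F.Sections →ₗ[ℝ] G.Sections}
    (hD : IsDiffOp D) : ∃ D', IsFormalAdjoint D D' := by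
  choose r hr using exists_adjoint_compact hD
  have hc : ∀ {H : MetricBundle M} {p : H.Sections} (q : H.Sections), IsCompact (supp p) →
    IsCompact (supp p ∩ supp q) := fun q hp => hp.inter_right (isClosed_supp q)
  have hDc : ∀ {p : F.Sections}, IsCompact (supp p) → IsCompact (supp (D p)) := fun hp =>
    hp.of_isClosed_subset (isClosed_supp _) (hD.supp_subset _)
  refine ⟨{ toFun := r, map_add' := fun t t' => ?_, map_smul' := fun c t => ?_ }, ?_⟩
  · ext x
    refine eqOn_of_pairing isOpen_univ (fun s hs _ => ?_) (Set.mem_univ x)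
    rw [← hr _ s hs, pairing_symm, pairing_add_right _ _ _ (hc _ (hDc hs)) (hc _ (hDc hs)),
      pairing_symm (r t + r t'), pairing_add_right _ _ _ (hc _ hs) (hc _ hs), pairing_symm,
      pairing_symm (D s), hr t s hs, hr t' s hs, pairing_symm s, pairing_symm s]
  · ext x
    refine eqOn_of_pairing isOpen_univ (fun s hs _ => ?_) (Set.mem_univ x)
    rw [← hr _ s hs, pairing_symm, pairing_smul_right, RingHom.id_apply,
      pairing_symm (c • r t), pairing_smul_right, pairing_symm, hr t s hs, pairing_symm]
  · intro t s hts
    change pairing t (D s) = pairing (r t) s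
    obtain ⟨χ, hχ, hχ1, hχc, -, -⟩ := M.exists_cutoff hts isOpen_univ (Set.subset_univ _)
    have hχs : ∀ x ∈ supp t, ∀ᶠ y in 𝓝 x, (s - mulSec χ hχ s) y = 0 := by
      intro x hxt
      by_cases hxs : x ∈ supp s
      · filter_upwards [hχ1 x ⟨hxt, hxs⟩] with y hy
        rw [ContMDiffSection.coe_sub, Pi.sub_apply, mulSec_apply, hy, one_smul, sub_self]
      · filter_upwards [notMem_supp.1 hxs] with y hy
        rw [ContMDiffSection.coe_sub, Pi.sub_apply, mulSec_apply, hy, smul_zero, sub_self]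
    have h1 : pairing t (D s) = pairing t (D (mulSec χ hχ s)) := by
      refine integral_congr_ae (ae_of_all _ fun x => ?_)
      simp only [metric]
      by_cases hx : x ∈ supp t
      · have := hD.local (hχs x hx)
        rw [map_sub, ContMDiffSection.coe_sub, Pi.sub_apply, sub_eq_zero] at this
        rw [this]
      · rw [eq_zero_of_notMem hx, map_zero, LinearMap.zero_apply, LinearMap.zero_apply]
    have h2 : pairing (r t) s = pairing (r t) (mulSec χ hχ s) := by
      refine integral_congr_ae (ae_of_all _ fun x => ?_)
      simp only [metric]
      by_cases hx : x ∈ supp t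
      · have := (hχs x hx).self_of_nhds
        rw [ContMDiffSection.coe_sub, Pi.sub_apply, sub_eq_zero] at this
        rw [this]
      · rw [eq_zero_of_notMem fun h => hx (supp_adjoint_subset hD (hr t) h), map_zero,
          LinearMap.zero_apply, LinearMap.zero_apply]
    rw [h1, h2]
    exact hr t _ (hχc.of_isClosed_subset (isClosed_supp _)
      ((supp_mulSec _ _ _).trans Set.inter_subset_left))

theorem IsFormalAdjoint.unique {F G : MetricBundle M} {D : F.Sections →ₗ[ℝ] G.Sections}
    {D' D'' : G.Sections →ₗ[ℝ] F.Sections} (h' : IsFormalAdjoint D D')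
    (h'' : IsFormalAdjoint D D'') : D' = D'' := by
  ext t x
  refine eqOn_of_pairing isOpen_univ (fun s hs _ => ?_) (Set.mem_univ x)
  have hc := hs.inter_left (isClosed_supp t)
  rw [← h' t s hc, ← h'' t s hc]

/-- The formal adjoint of a differential operator. -/
noncomputable def IsDiffOp.adjoint {F G : MetricBundle M} {D : F.Sections →ₗ[ℝ] G.Sections}
    (hD : IsDiffOp D) : G.Sections →ₗ[ℝ] F.Sections := (exists_isFormalAdjoint hD).choose

theorem IsDiffOp.isFormalAdjoint {F G : MetricBundle M} {D : F.Sections →ₗ[ℝ] G.Sections}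
    (hD : IsDiffOp D) : IsFormalAdjoint D hD.adjoint := (exists_isFormalAdjoint hD).choose_spec

theorem IsDiffOp.supp_adjoint {F G : MetricBundle M} {D : F.Sections →ₗ[ℝ] G.Sections}
    (hD : IsDiffOp D) (t : G.Sections) : supp (hD.adjoint t) ⊆ supp t :=
  supp_adjoint_subset hD fun s hs => hD.isFormalAdjoint t s (hs.inter_left (isClosed_supp t))

end MetricBundle
end HomotopyAQFT

namespace HomotopyAQFT
open scoped Topology

/-! ### Complexes of observables and of solutions -/

section FourTerm
variable {S₀ S₁ T₀ T₁ R₀ R₁ : ModuleCat.{u} ℝ}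

/-- `S₁ ← S₀ ← S₀ ← S₁` in degrees `-1, 0, 1, 2`. -/
def obsX (S₀ S₁ : ModuleCat.{u} ℝ) : ℤ → ModuleCat.{u} ℝ
  | -1 => S₁
  | 0 => S₀
  | 1 => S₀
  | 2 => S₁
  | _ => ModuleCat.of ℝ PUnit

/-- The differential `(-Q^*, P, -Q)`. -/
def obsD (Qs : S₀ ⟶ S₁) (P : S₀ ⟶ S₀) (Q : S₁ ⟶ S₀) : ∀ i j : ℤ, obsX S₀ S₁ i ⟶ obsX S₀ S₁ j
  | 0, -1 => -Qs
  | 1, 0 => P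
  | 2, 1 => -Q
  | _, _ => 0

/-- `S₁ ← S₀ ← S₀ ← S₁` in degrees `-2, -1, 0, 1`. -/
def solX (S₀ S₁ : ModuleCat.{u} ℝ) : ℤ → ModuleCat.{u} ℝ
  | -2 => S₁
  | -1 => S₀
  | 0 => S₀
  | 1 => S₁
  | _ => ModuleCat.of ℝ PUnit

/-- The differential `(Q^*, P, Q)`. -/
def solD (Qs : S₀ ⟶ S₁) (P : S₀ ⟶ S₀) (Q : S₁ ⟶ S₀) : ∀ i j : ℤ, solX S₀ S₁ i ⟶ solX S₀ S₁ j
  | -1, -2 => Qs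
  | 0, -1 => P
  | 1, 0 => Q
  | _, _ => 0

theorem obs_cases {C : ℤ → Prop} (h1 : C (-1)) (h2 : C 0) (h3 : C 1) (h4 : C 2)
    (h : ∀ i, (∀ S₀ S₁ : ModuleCat.{u} ℝ, Subsingleton (obsX S₀ S₁ i)) → C i) (i : ℤ) : C i := by
  match i with
  | -1 => exact h1
  | 0 => exact h2
  | 1 => exact h3
  | 2 => exact h4
  | .ofNat (n + 3) => exact h _ fun S₀ S₁ => inferInstanceAs (Subsingleton PUnit)
  | .negSucc (n + 1) => exact h _ fun S₀ S₁ => inferInstanceAs (Subsingleton PUnit)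

theorem sol_cases {C : ℤ → Prop} (h1 : C (-2)) (h2 : C (-1)) (h3 : C 0) (h4 : C 1)
    (h : ∀ i, (∀ S₀ S₁ : ModuleCat.{u} ℝ, Subsingleton (solX S₀ S₁ i)) → C i) (i : ℤ) : C i := by
  match i with
  | -2 => exact h1
  | -1 => exact h2
  | 0 => exact h3
  | 1 => exact h4
  | .ofNat (n + 2) => exact h _ fun S₀ S₁ => inferInstanceAs (Subsingleton PUnit)
  | .negSucc (n + 2) => exact h _ fun S₀ S₁ => inferInstanceAs (Subsingleton PUnit)

theorem hom_eq_of_subsingleton_left {X Y : ModuleCat.{u} ℝ} (h : Subsingleton X) (f g : X ⟶ Y) :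
    f = g := ModuleCat.hom_ext (LinearMap.ext fun a => by
      rw [Subsingleton.elim a 0, map_zero, map_zero])

theorem hom_eq_of_subsingleton_right {X Y : ModuleCat.{u} ℝ} (h : Subsingleton Y) (f g : X ⟶ Y) :
    f = g := ModuleCat.hom_ext (LinearMap.ext fun _ => Subsingleton.elim _ _)

/-- The chain complex of observables. -/
def obsComplex (Qs : S₀ ⟶ S₁) (P : S₀ ⟶ S₀) (Q : S₁ ⟶ S₀) (h : P ≫ Qs = 0) (h' : Q ≫ P = 0) :
    ChainComplex (ModuleCat.{u} ℝ) ℤ where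
  X := obsX S₀ S₁
  d := obsD Qs P Q
  shape i j := by
    refine obs_cases (C := fun i => ¬ (ComplexShape.down ℤ).Rel i j → obsD Qs P Q i j = 0)
      ?_ ?_ ?_ ?_ (fun i hi _ => hom_eq_of_subsingleton_left (hi _ _) _ _) i <;>
    · refine obs_cases (C := fun j => ¬ (ComplexShape.down ℤ).Rel _ j → obsD Qs P Q _ j = 0)
        ?_ ?_ ?_ ?_ (fun j hj _ => hom_eq_of_subsingleton_right (hj _ _) _ _) j <;>
      intro hr <;> first | rfl | exact absurd (by simp [ComplexShape.down]) hr
  d_comp_d' i j k hij hjk := by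
    obtain rfl : i = j + 1 := hij.symm
    obtain rfl : j = k + 1 := hjk.symm
    refine obs_cases (C := fun k => obsD Qs P Q (k + 1 + 1) (k + 1) ≫ obsD Qs P Q (k + 1) k = 0)
      ?_ ?_ ?_ ?_ (fun i hi => hom_eq_of_subsingleton_right (hi _ _) _ _) k
    · change P ≫ (-Qs) = 0
      rw [Preadditive.comp_neg, h, neg_zero]
    · change (-Q) ≫ P = 0
      rw [Preadditive.neg_comp, h', neg_zero]
    · exact hom_eq_of_subsingleton_left (inferInstanceAs (Subsingleton PUnit)) _ _
    · exact hom_eq_of_subsingleton_left (inferInstanceAs (Subsingleton PUnit)) _ _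

/-- The chain complex of solutions. -/
def solComplex (Qs : S₀ ⟶ S₁) (P : S₀ ⟶ S₀) (Q : S₁ ⟶ S₀) (h : P ≫ Qs = 0) (h' : Q ≫ P = 0) :
    ChainComplex (ModuleCat.{u} ℝ) ℤ where
  X := solX S₀ S₁
  d := solD Qs P Q
  shape i j := by
    refine sol_cases (C := fun i => ¬ (ComplexShape.down ℤ).Rel i j → solD Qs P Q i j = 0)
      ?_ ?_ ?_ ?_ (fun i hi _ => hom_eq_of_subsingleton_left (hi _ _) _ _) i <;>
    · refine sol_cases (C := fun j => ¬ (ComplexShape.down ℤ).Rel _ j → solD Qs P Q _ j = 0)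
        ?_ ?_ ?_ ?_ (fun j hj _ => hom_eq_of_subsingleton_right (hj _ _) _ _) j <;>
      intro hr <;> first | rfl | exact absurd (by simp [ComplexShape.down]) hr
  d_comp_d' i j k hij hjk := by
    obtain rfl : i = j + 1 := hij.symm
    obtain rfl : j = k + 1 := hjk.symm
    refine sol_cases (C := fun k => solD Qs P Q (k + 1 + 1) (k + 1) ≫ solD Qs P Q (k + 1) k = 0)
      ?_ ?_ ?_ ?_ (fun i hi => hom_eq_of_subsingleton_right (hi _ _) _ _) k
    · exact h
    · exact h'
    · exact hom_eq_of_subsingleton_left (inferInstanceAs (Subsingleton PUnit)) _ _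
    · exact hom_eq_of_subsingleton_left (inferInstanceAs (Subsingleton PUnit)) _ _

/-- The maps in each degree induced by a pair of maps. -/
def obsMap (f₀ : S₀ ⟶ T₀) (f₁ : S₁ ⟶ T₁) : ∀ i : ℤ, obsX S₀ S₁ i ⟶ obsX T₀ T₁ i
  | -1 => f₁
  | 0 => f₀
  | 1 => f₀
  | 2 => f₁
  | .ofNat (_ + 3) => 0
  | .negSucc (_ + 1) => 0

/-- The maps in each degree induced by a pair of maps. -/
def solMap (f₀ : S₀ ⟶ T₀) (f₁ : S₁ ⟶ T₁) : ∀ i : ℤ, solX S₀ S₁ i ⟶ solX T₀ T₁ i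
  | -2 => f₁
  | -1 => f₀
  | 0 => f₀
  | 1 => f₁
  | .ofNat (_ + 2) => 0
  | .negSucc (_ + 2) => 0

/-- The components `S_i → T_{i-1}` of the map `j` to the shifted solution complex: up to the sign
`-1` in degrees `1, 2` given by a pair of maps. (They vanish unless `k = i - 1`.) -/
def jMap (f₀ : S₀ ⟶ T₀) (f₁ : S₁ ⟶ T₁) : ∀ i k : ℤ, obsX S₀ S₁ i ⟶ solX T₀ T₁ k
  | -1, -2 => f₁
  | 0, -1 => f₀
  | 1, 0 => -f₀
  | 2, 1 => -f₁
  | _, _ => 0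

/-- The evaluation `S_p ⊗ T_q → ℝ` induced by a pair of pairings. (It vanishes unless
`p + q = 0`.) -/
def evMap (e₀ : S₀ →ₗ[ℝ] T₀ →ₗ[ℝ] ℝ) (e₁ : S₁ →ₗ[ℝ] T₁ →ₗ[ℝ] ℝ) :
    ∀ p q : ℤ, obsX S₀ S₁ p →ₗ[ℝ] solX T₀ T₁ q →ₗ[ℝ] ℝ
  | -1, 1 => e₁
  | 0, 0 => e₀
  | 1, -1 => e₀
  | 2, -2 => e₁
  | _, _ => 0

theorem obsMap_id (i : ℤ) : obsMap (𝟙 S₀) (𝟙 S₁) i = 𝟙 _ :=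
  obs_cases (C := fun i => obsMap (𝟙 S₀) (𝟙 S₁) i = 𝟙 _) rfl rfl rfl rfl
    (fun _ hi => hom_eq_of_subsingleton_left (hi _ _) _ _) i

theorem obsMap_comp (f₀ : S₀ ⟶ T₀) (f₁ : S₁ ⟶ T₁) (g₀ : T₀ ⟶ R₀) (g₁ : T₁ ⟶ R₁) (i : ℤ) :
    obsMap (f₀ ≫ g₀) (f₁ ≫ g₁) i = obsMap f₀ f₁ i ≫ obsMap g₀ g₁ i :=
  obs_cases (C := fun i => obsMap (f₀ ≫ g₀) (f₁ ≫ g₁) i = obsMap f₀ f₁ i ≫ obsMap g₀ g₁ i)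
    rfl rfl rfl rfl (fun _ hi => hom_eq_of_subsingleton_left (hi _ _) _ _) i

/-- The chain map between complexes of observables induced by a pair of maps. -/
def obsHom {Qs : S₀ ⟶ S₁} {P : S₀ ⟶ S₀} {Q : S₁ ⟶ S₀} {h h'}
    {Qs' : T₀ ⟶ T₁} {P' : T₀ ⟶ T₀} {Q' : T₁ ⟶ T₀} {k k'} (f₀ : S₀ ⟶ T₀) (f₁ : S₁ ⟶ T₁)
    (c1 : f₀ ≫ Qs' = Qs ≫ f₁) (c2 : f₀ ≫ P' = P ≫ f₀) (c3 : f₁ ≫ Q' = Q ≫ f₀) :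
    obsComplex Qs P Q h h' ⟶ obsComplex Qs' P' Q' k k' where
  f := obsMap f₀ f₁
  comm' i j hij := by
    obtain rfl : i = j + 1 := hij.symm
    refine obs_cases (C := fun j => obsMap f₀ f₁ (j + 1) ≫ obsD Qs' P' Q' (j + 1) j =
      obsD Qs P Q (j + 1) j ≫ obsMap f₀ f₁ j) ?_ ?_ ?_ ?_
      (fun i hi => hom_eq_of_subsingleton_right (hi _ _) _ _) j
    · change f₀ ≫ (-Qs') = (-Qs) ≫ f₁
      rw [Preadditive.comp_neg, Preadditive.neg_comp, c1]
    · exact c2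
    · change f₁ ≫ (-Q') = (-Q) ≫ f₀
      rw [Preadditive.comp_neg, Preadditive.neg_comp, c3]
    · exact hom_eq_of_subsingleton_left (inferInstanceAs (Subsingleton PUnit)) _ _

/-- The chain map between complexes of solutions induced by a pair of maps. -/
def solHom {Qs : S₀ ⟶ S₁} {P : S₀ ⟶ S₀} {Q : S₁ ⟶ S₀} {h h'}
    {Qs' : T₀ ⟶ T₁} {P' : T₀ ⟶ T₀} {Q' : T₁ ⟶ T₀} {k k'} (f₀ : S₀ ⟶ T₀) (f₁ : S₁ ⟶ T₁)
    (c1 : f₀ ≫ Qs' = Qs ≫ f₁) (c2 : f₀ ≫ P' = P ≫ f₀) (c3 : f₁ ≫ Q' = Q ≫ f₀) :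
    solComplex Qs P Q h h' ⟶ solComplex Qs' P' Q' k k' where
  f := solMap f₀ f₁
  comm' i j hij := by
    obtain rfl : i = j + 1 := hij.symm
    refine sol_cases (C := fun j => solMap f₀ f₁ (j + 1) ≫ solD Qs' P' Q' (j + 1) j =
      solD Qs P Q (j + 1) j ≫ solMap f₀ f₁ j) ?_ ?_ ?_ ?_
      (fun i hi => hom_eq_of_subsingleton_right (hi _ _) _ _) j
    · exact c1
    · exact c2
    · exact c3
    · exact hom_eq_of_subsingleton_left (inferInstanceAs (Subsingleton PUnit)) _ _

/-- `j` is a chain map to the shifted complex. -/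
theorem jMap_d {Qs : S₀ ⟶ S₁} {P : S₀ ⟶ S₀} {Q : S₁ ⟶ S₀}
    {Qs' : T₀ ⟶ T₁} {P' : T₀ ⟶ T₀} {Q' : T₁ ⟶ T₀} (f₀ : S₀ ⟶ T₀) (f₁ : S₁ ⟶ T₁)
    (c1 : f₀ ≫ Qs' = Qs ≫ f₁) (c2 : f₀ ≫ P' = P ≫ f₀) (c3 : f₁ ≫ Q' = Q ≫ f₀) (n : ℤ) :
    jMap f₀ f₁ (n + 1) n ≫ solD Qs' P' Q' n (n - 1) =
      -(obsD Qs P Q (n + 1) n ≫ jMap f₀ f₁ n (n - 1)) := by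
  refine obs_cases (C := fun n => jMap f₀ f₁ (n + 1) n ≫ solD Qs' P' Q' n (n - 1) =
      -(obsD Qs P Q (n + 1) n ≫ jMap f₀ f₁ n (n - 1))) ?_ ?_ ?_ ?_
      (fun i hi => ?_) n
  · change f₀ ≫ Qs' = -((-Qs) ≫ f₁)
    rw [Preadditive.neg_comp, neg_neg, c1]
  · change (-f₀) ≫ P' = -(P ≫ f₀)
    rw [Preadditive.neg_comp, c2]
  · change (-f₁) ≫ Q' = -((-Q) ≫ (-f₀))
    rw [Preadditive.neg_comp, Preadditive.neg_comp, Preadditive.comp_neg, neg_neg, c3]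
  · exact hom_eq_of_subsingleton_left (inferInstanceAs (Subsingleton PUnit)) _ _
  · refine sol_cases (C := fun n => (∀ S₀ S₁ : ModuleCat.{u} ℝ, Subsingleton (obsX S₀ S₁ n)) →
      jMap f₀ f₁ (n + 1) n ≫ solD Qs' P' Q' n (n - 1) =
      -(obsD Qs P Q (n + 1) n ≫ jMap f₀ f₁ n (n - 1))) ?_ ?_ ?_ ?_ (fun i hi hi' => ?_) i hi
    · intro _
      exact hom_eq_of_subsingleton_right (inferInstanceAs (Subsingleton PUnit)) _ _
    · intro h
      change f₀ ≫ Qs' = -((-Qs) ≫ f₁)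
      rw [Preadditive.neg_comp, neg_neg, c1]
    · intro h
      change (-f₀) ≫ P' = -(P ≫ f₀)
      rw [Preadditive.neg_comp, c2]
    · intro h
      change (-f₁) ≫ Q' = -((-Q) ≫ (-f₀))
      rw [Preadditive.neg_comp, Preadditive.neg_comp, Preadditive.comp_neg, neg_neg, c3]
    · rw [hom_eq_of_subsingleton_right (hi _ _) (jMap f₀ f₁ (i + 1) i) 0, Limits.zero_comp,
        hom_eq_of_subsingleton_right (hi' S₀ S₁) (obsD Qs P Q (i + 1) i) 0, Limits.zero_comp, neg_zero]

theorem evMap_degree (e₀ : S₀ →ₗ[ℝ] T₀ →ₗ[ℝ] ℝ) (e₁ : S₁ →ₗ[ℝ] T₁ →ₗ[ℝ] ℝ) (p q : ℤ)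
    (h : p + q ≠ 0) : evMap e₀ e₁ p q = 0 := by
  revert h
  refine obs_cases (C := fun p => p + q ≠ 0 → evMap e₀ e₁ p q = 0) ?_ ?_ ?_ ?_ (fun p hp _ => ?_) p
  rotate_right
  · exact LinearMap.ext fun a => by
      have := hp S₀ S₁
      rw [Subsingleton.elim a 0, map_zero, map_zero]
  all_goals
    refine sol_cases (C := fun q => _ + q ≠ 0 → evMap e₀ e₁ _ q = 0) ?_ ?_ ?_ ?_
      (fun q hq _ => ?_) q
    rotate_right
    · exact LinearMap.ext fun a => LinearMap.ext fun b => by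
        have := hq T₀ T₁
        rw [Subsingleton.elim b 0, map_zero, map_zero]
    all_goals
      intro hr
      first | rfl | exact absurd (by norm_num) hr

/-- The evaluation is a chain map. -/
theorem evMap_d {Qs : S₀ ⟶ S₁} {P : S₀ ⟶ S₀} {Q : S₁ ⟶ S₀}
    {Qs' : T₀ ⟶ T₁} {P' : T₀ ⟶ T₀} {Q' : T₁ ⟶ T₀}
    (e₀ : S₀ →ₗ[ℝ] T₀ →ₗ[ℝ] ℝ) (e₁ : S₁ →ₗ[ℝ] T₁ →ₗ[ℝ] ℝ)
    (c1 : ∀ a b, e₁ (Qs a) b = e₀ a (Q' b)) (c2 : ∀ a b, e₀ (P a) b = e₀ a (P' b))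
    (c3 : ∀ a b, e₀ (Q a) b = e₁ a (Qs' b)) (p q : ℤ) (a : obsX S₀ S₁ p) (b : solX T₀ T₁ q) :
    evMap e₀ e₁ (p - 1) q (obsD Qs P Q p (p - 1) a) b +
      p.negOnePow • evMap e₀ e₁ p (q - 1) a (solD Qs' P' Q' q (q - 1) b) = 0 := by
  by_cases hpq : p + q = 1
  · obtain rfl : q = 1 - p := by omega
    revert a b
    refine obs_cases (C := fun p => ∀ (a : obsX S₀ S₁ p) (b : solX T₀ T₁ (1 - p)),
      evMap e₀ e₁ (p - 1) (1 - p) (obsD Qs P Q p (p - 1) a) b +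
      p.negOnePow • evMap e₀ e₁ p (1 - p - 1) a (solD Qs' P' Q' (1 - p) (1 - p - 1) b) = 0)
      ?_ ?_ ?_ ?_ (fun p hp a b => ?_) p
    · intro a b
      have : b = 0 := Subsingleton.elim (α := PUnit) _ _
      rw [this]
      simp
    · intro (a : S₀) (b : T₁)
      have h1 : (-(e₁ (Qs a) b) : ℝ) + e₀ a (Q' b) = 0 := by rw [c1]; ring
      rw [Int.negOnePow_zero, one_smul]
      refine Eq.trans ?_ h1
      change e₁ (-(Qs a)) b + e₀ a (Q' b) = _
      rw [map_neg, LinearMap.neg_apply]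
    · intro (a : S₀) (b : T₀)
      have h1 : e₀ (P a) b + -(e₀ a (P' b) : ℝ) = 0 := by rw [c2]; ring
      rw [Int.negOnePow_one, Units.neg_smul, one_smul]
      exact h1
    · intro (a : S₁) (b : T₀)
      have h1 : (-(e₀ (Q a) b) : ℝ) + e₁ a (Qs' b) = 0 := by rw [c3]; ring
      rw [show Int.negOnePow 2 = 1 from rfl, one_smul]
      refine Eq.trans ?_ h1
      change e₀ (-(Q a)) b + e₁ a (Qs' b) = _
      rw [map_neg, LinearMap.neg_apply]
    · have := hp S₀ S₁
      rw [Subsingleton.elim a 0]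
      simp
  · rw [evMap_degree e₀ e₁ (p - 1) q (by omega), evMap_degree e₀ e₁ p (q - 1) (by omega)]
    simp

/-- The evaluation is natural. -/
theorem evMap_natural {S₀' S₁' T₀' T₁' : ModuleCat.{u} ℝ} (e₀ : S₀ →ₗ[ℝ] T₀ →ₗ[ℝ] ℝ)
    (e₁ : S₁ →ₗ[ℝ] T₁ →ₗ[ℝ] ℝ) (e₀' : S₀' →ₗ[ℝ] T₀' →ₗ[ℝ] ℝ) (e₁' : S₁' →ₗ[ℝ] T₁' →ₗ[ℝ] ℝ)
    (f₀ : S₀ ⟶ S₀') (f₁ : S₁ ⟶ S₁') (g₀ : T₀' ⟶ T₀) (g₁ : T₁' ⟶ T₁)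
    (c0 : ∀ a b, e₀' (f₀ a) b = e₀ a (g₀ b)) (c1 : ∀ a b, e₁' (f₁ a) b = e₁ a (g₁ b))
    (p q : ℤ) (a : obsX S₀ S₁ p) (b : solX T₀' T₁' q) :
    evMap e₀' e₁' p q (obsMap f₀ f₁ p a) b = evMap e₀ e₁ p q a (solMap g₀ g₁ q b) := by
  by_cases hpq : p + q = 0
  · obtain rfl : q = -p := by omega
    revert a b
    refine obs_cases (C := fun p => ∀ (a : obsX S₀ S₁ p) (b : solX T₀' T₁' (-p)),
      evMap e₀' e₁' p (-p) (obsMap f₀ f₁ p a) b = evMap e₀ e₁ p (-p) a (solMap g₀ g₁ (-p) b))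
      c1 c0 c0 c1 (fun p hp a b => ?_) p
    have := hp S₀ S₁
    rw [Subsingleton.elim a 0]
    simp
  · rw [evMap_degree e₀ e₁ p q hpq, evMap_degree e₀' e₁' p q hpq]
    rfl

end FourTerm
end HomotopyAQFT

namespace HomotopyAQFT
open scoped TensorProduct DirectSum Manifold ContDiff Topology
open MeasureTheory
namespace MetricBundle
open LorentzManifold
variable {m : ℕ} {M N : LorentzManifold.{u} m}

/-- A morphism of vector bundles with fiber metrics covering a morphism `f : M → N`: a smooth family
of fiberwise linear isometries. (For a smooth fiberwise invertible vector bundle map covering an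
open embedding, the map between total spaces is a local diffeomorphism; this is taken as the
formulation of smoothness.) -/
structure Hom (f : LorentzManifold.Hom M N) (F : MetricBundle M) (G : MetricBundle N) where
  map : ∀ x : M, F.fiber x ≃ₗ[ℝ] G.fiber (f.toFun x)
  smooth : IsLocalDiffeomorph ((𝓡 m).prod 𝓘(ℝ, F.model)) ((𝓡 m).prod 𝓘(ℝ, G.model)) ∞
    (fun p : Bundle.TotalSpace F.model F.fiber =>
      (⟨f.toFun p.1, map p.1 p.2⟩ : Bundle.TotalSpace G.model G.fiber))
  metric : ∀ x v w, G.h (f.toFun x) (map x v) (map x w) = F.h x v w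

namespace Hom
variable {f : LorentzManifold.Hom M N} {F : MetricBundle M} {G : MetricBundle N} (A : Hom f F G)

theorem smooth_pullback (t : G.Sections) : ContMDiff (𝓡 m) ((𝓡 m).prod 𝓘(ℝ, F.model)) ∞
    (fun x => Bundle.TotalSpace.mk' F.model x ((A.map x).symm (t (f.toFun x)))) := by
  intro x₀
  let p₀ : Bundle.TotalSpace F.model F.fiber := ⟨x₀, (A.map x₀).symm (t (f.toFun x₀))⟩
  have hl := A.smooth p₀
  have h0 : (⟨f.toFun p₀.1, A.map p₀.1 p₀.2⟩ : Bundle.TotalSpace G.model G.fiber) =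
      ⟨f.toFun x₀, t (f.toFun x₀)⟩ := by
    change (⟨f.toFun x₀, A.map x₀ ((A.map x₀).symm (t (f.toFun x₀)))⟩ :
      Bundle.TotalSpace G.model G.fiber) = _
    rw [LinearEquiv.apply_symm_apply]
  have hinv := hl.localInverse_contMDiffAt
  have hr := hl.localInverse_eventuallyEq_right
  rw [h0] at hinv hr
  have ht : ContMDiff (𝓡 m) ((𝓡 m).prod 𝓘(ℝ, G.model)) ∞
      (fun x => (⟨f.toFun x, t (f.toFun x)⟩ : Bundle.TotalSpace G.model G.fiber)) :=
    t.contMDiff.comp f.contMDiff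
  refine (hinv.comp x₀ (ht x₀)).congr_of_eventuallyEq ?_
  filter_upwards [ht.continuous.continuousAt.eventually hr] with x hx
  have hx' : (⟨f.toFun (hl.localInverse ⟨f.toFun x, t (f.toFun x)⟩).1,
      A.map _ (hl.localInverse ⟨f.toFun x, t (f.toFun x)⟩).2⟩ :
      Bundle.TotalSpace G.model G.fiber) = ⟨f.toFun x, t (f.toFun x)⟩ := hx
  change (⟨x, (A.map x).symm (t (f.toFun x))⟩ : Bundle.TotalSpace F.model F.fiber) =
    hl.localInverse ⟨f.toFun x, t (f.toFun x)⟩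
  generalize hl.localInverse ⟨f.toFun x, t (f.toFun x)⟩ = q at hx'
  obtain ⟨y, w⟩ := q
  obtain rfl : y = x := f.injective (congrArg Bundle.TotalSpace.proj hx')
  have h2 : A.map y w = t (f.toFun y) := by
    simpa using hx'
  rw [← h2, LinearEquiv.symm_apply_apply]

/-- The pullback of sections. -/
noncomputable def pullback : G.Sections →ₗ[ℝ] F.Sections where
  toFun t := ⟨fun x => (A.map x).symm (t (f.toFun x)), A.smooth_pullback t⟩
  map_add' s t := by
    ext x
    exact map_add (A.map x).symm _ _
  map_smul' c t := by
    ext x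
    exact map_smul (A.map x).symm _ _

theorem pullback_apply (t : G.Sections) (x : M) :
    A.pullback t x = (A.map x).symm (t (f.toFun x)) := rfl

theorem map_pullback (t : G.Sections) (x : M) :
    A.map x (A.pullback t x) = t (f.toFun x) := (A.map x).apply_symm_apply _

open Classical in
/-- The extension by zero of (the image of) a section. -/
noncomputable def extend (s : F.Sections) (y : N) : G.fiber y :=
  if h : ∃ x, f.toFun x = y then h.choose_spec ▸ A.map h.choose (s h.choose) else 0

theorem extend_apply (s : F.Sections) (x : M) : A.extend s (f.toFun x) = A.map x (s x) := by
  have h : ∃ x', f.toFun x' = f.toFun x := ⟨x, rfl⟩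
  rw [extend, dif_pos h]
  have key : ∀ (x' : M) (e : f.toFun x' = f.toFun x),
      (e ▸ A.map x' (s x') : G.fiber (f.toFun x)) = A.map x (s x) := by
    intro x' e
    obtain rfl := f.injective e
    rfl
  exact key _ h.choose_spec

theorem extend_of_notMem (s : F.Sections) {y : N} (h : y ∉ f.toFun '' supp s) :
    A.extend s y = 0 := by
  by_cases hy : ∃ x, f.toFun x = y
  · obtain ⟨x, rfl⟩ := hy
    rw [extend_apply, eq_zero_of_notMem fun hx => h ⟨x, hx, rfl⟩, map_zero]
  · rw [extend, dif_neg hy]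

theorem smooth_extend {s : F.Sections} (hs : s ∈ F.compactSections) :
    ContMDiff (𝓡 m) ((𝓡 m).prod 𝓘(ℝ, G.model)) ∞
      (fun y => Bundle.TotalSpace.mk' G.model y (A.extend s y)) := by
  intro y
  by_cases hy : y ∈ f.toFun '' supp s
  · obtain ⟨x, hx, rfl⟩ := hy
    have : Nonempty M := ⟨x⟩
    have h1 : ContMDiffAt (𝓡 m) ((𝓡 m).prod 𝓘(ℝ, G.model)) ∞ (fun y =>
        (⟨f.toFun (f.inv y), A.map (f.inv y) (s (f.inv y))⟩ :
          Bundle.TotalSpace G.model G.fiber)) (f.toFun x) :=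
      (A.smooth.contMDiff.comp s.contMDiff).contMDiffAt.comp _ (f.contMDiffAt_inv x)
    refine h1.congr_of_eventuallyEq ?_
    filter_upwards [f.isOpenEmbedding.isOpen_range.mem_nhds ⟨x, rfl⟩] with z hz
    obtain ⟨w, rfl⟩ := hz
    rw [f.inv_apply, A.extend_apply]
  · have hc : IsClosed (f.toFun '' supp s) :=
      (hs.image f.contMDiff.continuous).isClosed
    refine (Bundle.contMDiff_zeroSection ℝ G.fiber y).congr_of_eventuallyEq ?_
    filter_upwards [hc.isOpen_compl.mem_nhds hy] with z hz
    rw [A.extend_of_notMem s hz]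
    rfl

theorem supp_extend {s : F.Sections} (hs : s ∈ F.compactSections) :
    supp (⟨A.extend s, A.smooth_extend hs⟩ : G.Sections) ⊆ f.toFun '' supp s := by
  refine closure_minimal (fun y hy => by_contra fun h => hy (A.extend_of_notMem s h)) ?_
  exact (hs.image f.contMDiff.continuous).isClosed

/-- The pushforward (extension by zero) of compactly supported sections. -/
noncomputable def pushforward : F.compactSections →ₗ[ℝ] G.compactSections where
  toFun s := ⟨⟨A.extend s.1, A.smooth_extend s.2⟩,
    (s.2.image f.contMDiff.continuous).of_isClosed_subset (isClosed_supp _) (A.supp_extend s.2)⟩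
  map_add' s t := by
    refine Subtype.ext (ContMDiffSection.ext fun y => ?_)
    change A.extend (s.1 + t.1) y = A.extend s.1 y + A.extend t.1 y
    by_cases hy : ∃ x, f.toFun x = y
    · obtain ⟨x, rfl⟩ := hy
      rw [extend_apply, extend_apply, extend_apply]
      exact map_add (A.map x) _ _
    · rw [extend, extend, extend, dif_neg hy, dif_neg hy, dif_neg hy, add_zero]
  map_smul' c t := by
    refine Subtype.ext (ContMDiffSection.ext fun y => ?_)
    change A.extend (c • t.1) y = c • A.extend t.1 y
    by_cases hy : ∃ x, f.toFun x = y
    · obtain ⟨x, rfl⟩ := hy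
      rw [extend_apply, extend_apply]
      exact map_smul (A.map x) _ _
    · rw [extend, extend, dif_neg hy, dif_neg hy, smul_zero]

theorem pushforward_apply (s : F.compactSections) (x : M) :
    (A.pushforward s).1 (f.toFun x) = A.map x (s.1 x) := A.extend_apply s.1 x

theorem pushforward_of_notMem (s : F.compactSections) {y : N} (h : y ∉ f.toFun '' supp s.1) :
    (A.pushforward s).1 y = 0 := A.extend_of_notMem s.1 h

theorem pushforward_ext {s : F.compactSections} {t : G.compactSections}
    (h1 : ∀ x, t.1 (f.toFun x) = A.map x (s.1 x)) (h2 : ∀ y ∉ f.toFun '' supp s.1, t.1 y = 0) :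
    A.pushforward s = t := by
  refine Subtype.ext (ContMDiffSection.ext fun y => ?_)
  by_cases hy : y ∈ f.toFun '' supp s.1
  · obtain ⟨x, -, rfl⟩ := hy
    rw [A.pushforward_apply, h1]
  · rw [A.pushforward_of_notMem s hy, h2 y hy]

theorem pullback_pushforward (s : F.compactSections) : A.pullback (A.pushforward s).1 = s.1 := by
  ext x
  rw [pullback_apply, pushforward_apply, LinearEquiv.symm_apply_apply]

/-- The integration pairing is natural. -/
theorem pairing_pushforward (s : F.compactSections) (t : G.Sections) :
    pairing (A.pushforward s).1 t = pairing s.1 (A.pullback t) := by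
  rw [pairing, pairing, LorentzManifold.integral_image f]
  · refine integral_congr_ae (ae_of_all _ fun x => ?_)
    change G.h _ _ _ = F.h _ _ _
    rw [pushforward_apply, ← A.map_pullback, A.metric]
  · intro y hy
    rw [MetricBundle.metric, A.pushforward_of_notMem s fun ⟨x, _, hx⟩ => hy ⟨x, hx⟩, map_zero,
      LinearMap.zero_apply]

end Hom

end MetricBundle
end HomotopyAQFT

namespace HomotopyAQFT
open scoped Topology
open MeasureTheory

/-- The types of support under consideration: compact, past compact and future compact. -/
inductive SupportType
  | compact
  | past
  | future

namespace MetricBundle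
variable {m : ℕ} {M : LorentzManifold.{u} m}

/-- The sections with a given type of support. -/
noncomputable def sectionsOf (F : MetricBundle M) : SupportType → Submodule ℝ F.Sections
  | .compact => F.compactSections
  | .past => F.pastCompactSections
  | .future => F.futureCompactSections

theorem compact_le_sectionsOf (F : MetricBundle M) (S : SupportType) :
    F.sectionsOf .compact ≤ F.sectionsOf S := by
  cases S
  · exact le_rfl
  · exact le_sup_right
  · exact le_sup_right

theorem map_mem_sectionsOf {F G : MetricBundle M} {D : F.Sections →ₗ[ℝ] G.Sections}
    (hD : ∀ s, supp (D s) ⊆ supp s) (S : SupportType) {s : F.Sections} (hs : s ∈ F.sectionsOf S) :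
    D s ∈ G.sectionsOf S := by
  have hc : F.compactSections ≤ G.compactSections.comap D := fun s hs =>
    IsCompact.of_isClosed_subset hs (isClosed_supp _) (hD s)
  cases S
  · exact hc hs
  · refine (sup_le (Submodule.span_le.2 fun s hs => ?_) (fun s hs => ?_) :
      F.pastCompactSections ≤ G.pastCompactSections.comap D) hs
    · obtain ⟨T, hT, h⟩ := hs
      exact Submodule.mem_sup_left (Submodule.subset_span ⟨T, hT, (hD s).trans h⟩)
    · exact Submodule.mem_sup_right (hc hs)
  · refine (sup_le (Submodule.span_le.2 fun s hs => ?_) (fun s hs => ?_) :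
      F.futureCompactSections ≤ G.futureCompactSections.comap D) hs
    · obtain ⟨T, hT, h⟩ := hs
      exact Submodule.mem_sup_left (Submodule.subset_span ⟨T, hT, (hD s).trans h⟩)
    · exact Submodule.mem_sup_right (hc hs)

/-- The restriction of an operator that does not increase supports. -/
noncomputable def restrictTo {F G : MetricBundle M} (D : F.Sections →ₗ[ℝ] G.Sections)
    (hD : ∀ s, supp (D s) ⊆ supp s) (S : SupportType) :
    ModuleCat.of ℝ (F.sectionsOf S) ⟶ ModuleCat.of ℝ (G.sectionsOf S) :=
  ModuleCat.ofHom (D.restrict fun _ hs => map_mem_sectionsOf hD S hs)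

end MetricBundle

open MetricBundle

/-! ### Natural bundles and natural field theories -/

/-- A natural vector bundle with fiber metric on `Loc`. -/
structure NaturalBundle (m : ℕ) where
  bundle : ∀ M : Loc.{u} m, MetricBundle M.toLorentzManifold
  map : ∀ {M N : Loc.{u} m} (f : M ⟶ N), MetricBundle.Hom f (bundle M) (bundle N)
  map_id : ∀ (M : Loc.{u} m) (x : M.carrier) (v : (bundle M).fiber x), (map (𝟙 M)).map x v = v
  map_comp : ∀ {M N K : Loc.{u} m} (f : M ⟶ N) (g : N ⟶ K) (x : M.carrier)
    (v : (bundle M).fiber x),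
    (map (f ≫ g)).map x v = (map g).map (LorentzManifold.Hom.toFun f x) ((map f).map x v)

/-- The data of a linear gauge field theory on `Loc`: a natural field complex
`𝔉₀ ← 𝔉₁ : Q` and a natural formally self-adjoint linear differential operator `P` on `𝔉₀` with
`P Q = 0`. -/
structure FieldTheory (m : ℕ) where
  F₀ : NaturalBundle.{u} m
  F₁ : NaturalBundle.{u} m
  Q : ∀ M, (F₁.bundle M).Sections →ₗ[ℝ] (F₀.bundle M).Sections
  P : ∀ M, (F₀.bundle M).Sections →ₗ[ℝ] (F₀.bundle M).Sections
  Q_diffOp : ∀ M, IsDiffOp (Q M)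
  P_diffOp : ∀ M, IsDiffOp (P M)
  Q_natural : ∀ {M N : Loc.{u} m} (f : M ⟶ N) (s : (F₁.bundle N).Sections),
    (F₀.map f).pullback (Q N s) = Q M ((F₁.map f).pullback s)
  P_natural : ∀ {M N : Loc.{u} m} (f : M ⟶ N) (s : (F₀.bundle N).Sections),
    (F₀.map f).pullback (P N s) = P M ((F₀.map f).pullback s)
  P_selfAdjoint : ∀ M, IsFormalAdjoint (P M) (P M)
  P_Q : ∀ M s, P M (Q M s) = 0

theorem pushforward_natural {m : ℕ} {M N : LorentzManifold.{u} m} {f : LorentzManifold.Hom M N}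
    {F G : MetricBundle M} {F' G' : MetricBundle N} (A : MetricBundle.Hom f F F')
    (B : MetricBundle.Hom f G G') {D : F.Sections →ₗ[ℝ] G.Sections}
    {D' : F'.Sections →ₗ[ℝ] G'.Sections} (hD' : ∀ s, supp (D' s) ⊆ supp s)
    (h : ∀ s, B.pullback (D' s) = D (A.pullback s)) (s : F.compactSections)
    (t : G.compactSections) (ht : t.1 = D s.1) : (B.pushforward t).1 = D' (A.pushforward s).1 := by
  ext y
  by_cases hy : y ∈ f.toFun '' supp s.1
  · obtain ⟨x, -, rfl⟩ := hy
    rw [B.pushforward_apply, ← B.map_pullback, h, A.pullback_pushforward, ht]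
  · have h1 : D' (A.pushforward s).1 y = 0 :=
      eq_zero_of_notMem fun h' => hy (A.supp_extend s.2 (hD' _ h'))
    rw [h1]
    by_cases hr : ∃ x, f.toFun x = y
    · obtain ⟨x, rfl⟩ := hr
      rw [← B.map_pullback, h, A.pullback_pushforward, ← ht] at h1
      rw [B.pushforward_apply, h1]
    · exact B.pushforward_of_notMem t fun ⟨x, _, hx⟩ => hr ⟨x, hx⟩

namespace FieldTheory
variable {m : ℕ} (𝓕 : FieldTheory.{u} m)

/-- The formal adjoint `Q^*`. -/
noncomputable def Qadj (M : Loc.{u} m) : (𝓕.F₀.bundle M).Sections →ₗ[ℝ] (𝓕.F₁.bundle M).Sections :=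
  (𝓕.Q_diffOp M).adjoint

theorem Qadj_isFormalAdjoint (M : Loc.{u} m) : IsFormalAdjoint (𝓕.Q M) (𝓕.Qadj M) :=
  (𝓕.Q_diffOp M).isFormalAdjoint

theorem Qadj_P (M : Loc.{u} m) (s : (𝓕.F₀.bundle M).Sections) : 𝓕.Qadj M (𝓕.P M s) = 0 := by
  ext x
  refine eq_zero_of_pairing isOpen_univ (fun t ht _ => ?_) (Set.mem_univ x)
  have hc : ∀ s' : (𝓕.F₁.bundle M).Sections, IsCompact (supp s' ∩ supp t) := fun s' =>
    ht.inter_left (isClosed_supp _)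
  have hQ : IsCompact (supp (𝓕.Q M t)) :=
    ht.of_isClosed_subset (isClosed_supp _) ((𝓕.Q_diffOp M).supp_subset t)
  rw [← 𝓕.Qadj_isFormalAdjoint M _ _ (ht.inter_left (isClosed_supp _)),
    ← 𝓕.P_selfAdjoint M _ _ (hQ.inter_left (isClosed_supp _)), 𝓕.P_Q]
  simp [pairing, MetricBundle.metric]

theorem Qadj_natural {M N : Loc.{u} m} (f : M ⟶ N) (s : (𝓕.F₀.bundle N).Sections) :
    (𝓕.F₁.map f).pullback (𝓕.Qadj N s) = 𝓕.Qadj M ((𝓕.F₀.map f).pullback s) := by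
  ext x
  refine eqOn_of_pairing isOpen_univ (fun t ht _ => ?_) (Set.mem_univ x)
  have hQ : IsCompact (supp (𝓕.Q M t)) :=
    ht.of_isClosed_subset (isClosed_supp _) ((𝓕.Q_diffOp M).supp_subset t)
  have e1 := (𝓕.F₁.map f).pairing_pushforward ⟨t, ht⟩ (𝓕.Qadj N s)
  have e2 := (𝓕.F₀.map f).pairing_pushforward ⟨𝓕.Q M t, hQ⟩ s
  have e3 := pushforward_natural (𝓕.F₁.map f) (𝓕.F₀.map f) (𝓕.Q_diffOp N).supp_subset
    (𝓕.Q_natural f) ⟨t, ht⟩ ⟨𝓕.Q M t, hQ⟩ rfl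
  have hpc : IsCompact (supp ((𝓕.F₁.map f).pushforward ⟨t, ht⟩).1) :=
    ((𝓕.F₁.map f).pushforward ⟨t, ht⟩).2
  rw [pairing_symm, ← e1, pairing_symm,
    ← 𝓕.Qadj_isFormalAdjoint N _ _ (hpc.inter_left (isClosed_supp _)), ← e3, pairing_symm, e2,
    pairing_symm, 𝓕.Qadj_isFormalAdjoint M _ _ (ht.inter_left (isClosed_supp _))]

/-! ### The complexes -/

/-- The complex of solutions `𝔖𝔬𝔩(M)`. -/
noncomputable def sol (M : Loc.{u} m) : ChainComplex (ModuleCat.{u} ℝ) ℤ :=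
  solComplex (ModuleCat.ofHom (𝓕.Qadj M)) (ModuleCat.ofHom (𝓕.P M)) (ModuleCat.ofHom (𝓕.Q M))
    (ModuleCat.hom_ext (LinearMap.ext fun s => 𝓕.Qadj_P M s))
    (ModuleCat.hom_ext (LinearMap.ext fun s => 𝓕.P_Q M s))

/-- The complexes `𝔏(M)`, `𝔏_pc(M)` and `𝔏_fc(M)` of linear observables. -/
noncomputable def obs (S : SupportType) (M : Loc.{u} m) : ChainComplex (ModuleCat.{u} ℝ) ℤ :=
  obsComplex (restrictTo (𝓕.Qadj M) (𝓕.Q_diffOp M).supp_adjoint S)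
    (restrictTo (𝓕.P M) (𝓕.P_diffOp M).supp_subset S)
    (restrictTo (𝓕.Q M) (𝓕.Q_diffOp M).supp_subset S)
    (ModuleCat.hom_ext (LinearMap.ext fun s => Subtype.ext (𝓕.Qadj_P M s.1)))
    (ModuleCat.hom_ext (LinearMap.ext fun s => Subtype.ext (𝓕.P_Q M s.1)))

/-- The inclusion `ι : 𝔏(M) → 𝔏_pc(M)`, respectively `ι : 𝔏(M) → 𝔏_fc(M)`. -/
noncomputable def incl (S : SupportType) (M : Loc.{u} m) : 𝓕.obs .compact M ⟶ 𝓕.obs S M :=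
  obsHom (ModuleCat.ofHom (Submodule.inclusion (compact_le_sectionsOf _ S)))
    (ModuleCat.ofHom (Submodule.inclusion (compact_le_sectionsOf _ S))) rfl rfl rfl

/-- The components `𝔏_S(M)_i → 𝔖𝔬𝔩(M)_k = 𝔖𝔬𝔩(M)[1]_i` for `k = i - 1` of the chain map `j`
(for each of the types `S` of supports). -/
noncomputable def j (S : SupportType) (M : Loc.{u} m) (i k : ℤ) :
    (𝓕.obs S M).X i ⟶ (𝓕.sol M).X k :=
  jMap (ModuleCat.ofHom (Submodule.subtype _)) (ModuleCat.ofHom (Submodule.subtype _)) i k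

theorem j_d (S : SupportType) (M : Loc.{u} m) (n : ℤ) :
    𝓕.j S M (n + 1) n ≫ (𝓕.sol M).d n (n - 1) =
      -((𝓕.obs S M).d (n + 1) n ≫ 𝓕.j S M n (n - 1)) :=
  jMap_d (Qs := restrictTo (𝓕.Qadj M) (𝓕.Q_diffOp M).supp_adjoint S)
    (P := restrictTo (𝓕.P M) (𝓕.P_diffOp M).supp_subset S)
    (Q := restrictTo (𝓕.Q M) (𝓕.Q_diffOp M).supp_subset S)
    (Qs' := ModuleCat.ofHom (𝓕.Qadj M)) (P' := ModuleCat.ofHom (𝓕.P M))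
    (Q' := ModuleCat.ofHom (𝓕.Q M))
    (ModuleCat.ofHom (Submodule.subtype _)) (ModuleCat.ofHom (Submodule.subtype _))
    rfl rfl rfl n

theorem incl_j (S : SupportType) (M : Loc.{u} m) (i k : ℤ) :
    (𝓕.incl S M).f i ≫ 𝓕.j S M i k = 𝓕.j .compact M i k := by
  refine obs_cases (C := fun i => (𝓕.incl S M).f i ≫ 𝓕.j S M i k = 𝓕.j .compact M i k)
    ?_ ?_ ?_ ?_ (fun i hi => hom_eq_of_subsingleton_left (hi _ _) _ _) i
  all_goals
    refine sol_cases (C := fun k => (𝓕.incl S M).f _ ≫ 𝓕.j S M _ k = 𝓕.j .compact M _ k)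
      ?_ ?_ ?_ ?_ (fun k hk => hom_eq_of_subsingleton_right (hk _ _) _ _) k
  all_goals rfl

/-- The evaluation `⟨-,-⟩ : 𝔏(M)_p ⊗ 𝔖𝔬𝔩(M)_q → ℝ` given by the integration pairings. -/
noncomputable def ev (M : Loc.{u} m) (p q : ℤ) :
    (𝓕.obs .compact M).X p →ₗ[ℝ] (𝓕.sol M).X q →ₗ[ℝ] ℝ :=
  evMap (pairingL (𝓕.F₀.bundle M)) (pairingL (𝓕.F₁.bundle M)) p q

/-- The evaluation `⟨-,-⟩ : 𝔖𝔬𝔩(M)_p ⊗ 𝔏(M)_q → ℝ`, obtained from the other one through the symmetric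
braiding of chain complexes. -/
noncomputable def ev' (M : Loc.{u} m) (p q : ℤ) (x : (𝓕.sol M).X p)
    (b : (𝓕.obs .compact M).X q) : ℝ :=
  (p * q).negOnePow • 𝓕.ev M q p b x

theorem ev_degree (M : Loc.{u} m) (p q : ℤ) (h : p + q ≠ 0) : 𝓕.ev M p q = 0 :=
  evMap_degree _ _ p q h

theorem ev_d (M : Loc.{u} m) (p q : ℤ) (a : (𝓕.obs .compact M).X p) (x : (𝓕.sol M).X q) :
    𝓕.ev M (p - 1) q ((𝓕.obs .compact M).d p (p - 1) a) x +
      p.negOnePow • 𝓕.ev M p (q - 1) a ((𝓕.sol M).d q (q - 1) x) = 0 := by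
  refine evMap_d _ _ (fun s t => ?_) (fun s t => ?_) (fun s t => ?_) p q a x
  · have hs : IsCompact (supp s.1) := s.2
    exact (𝓕.Qadj_isFormalAdjoint M s.1 t (hs.inter_right (isClosed_supp _))).symm
  · have hs : IsCompact (supp s.1) := s.2
    exact (𝓕.P_selfAdjoint M s.1 t (hs.inter_right (isClosed_supp _))).symm
  · have hs : IsCompact (supp s.1) := s.2
    change pairing (𝓕.Q M s.1) t = pairing s.1 (𝓕.Qadj M t)
    rw [pairing_symm, pairing_symm s.1]
    exact 𝓕.Qadj_isFormalAdjoint M t s.1 (hs.inter_left (isClosed_supp _))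

/-- The pushforward `f_* : 𝔏(M) → 𝔏(N)`. -/
noncomputable def push {M N : Loc.{u} m} (f : M ⟶ N) : 𝓕.obs .compact M ⟶ 𝓕.obs .compact N :=
  obsHom (ModuleCat.ofHom (𝓕.F₀.map f).pushforward) (ModuleCat.ofHom (𝓕.F₁.map f).pushforward)
    (ModuleCat.hom_ext (LinearMap.ext fun s => Subtype.ext
      (pushforward_natural (𝓕.F₀.map f) (𝓕.F₁.map f) (𝓕.Q_diffOp N).supp_adjoint
        (𝓕.Qadj_natural f) s _ rfl).symm))
    (ModuleCat.hom_ext (LinearMap.ext fun s => Subtype.ext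
      (pushforward_natural (𝓕.F₀.map f) (𝓕.F₀.map f) (𝓕.P_diffOp N).supp_subset
        (𝓕.P_natural f) s _ rfl).symm))
    (ModuleCat.hom_ext (LinearMap.ext fun s => Subtype.ext
      (pushforward_natural (𝓕.F₁.map f) (𝓕.F₀.map f) (𝓕.Q_diffOp N).supp_subset
        (𝓕.Q_natural f) s _ rfl).symm))

/-- The pullback `f^* : 𝔖𝔬𝔩(N) → 𝔖𝔬𝔩(M)`. -/
noncomputable def pull {M N : Loc.{u} m} (f : M ⟶ N) : 𝓕.sol N ⟶ 𝓕.sol M :=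
  solHom (ModuleCat.ofHom (𝓕.F₀.map f).pullback) (ModuleCat.ofHom (𝓕.F₁.map f).pullback)
    (ModuleCat.hom_ext (LinearMap.ext fun s => (𝓕.Qadj_natural f s).symm))
    (ModuleCat.hom_ext (LinearMap.ext fun s => (𝓕.P_natural f s).symm))
    (ModuleCat.hom_ext (LinearMap.ext fun s => (𝓕.Q_natural f s).symm))

theorem ev_natural {M N : Loc.{u} m} (f : M ⟶ N) (p q : ℤ) (a : (𝓕.obs .compact M).X p)
    (x : (𝓕.sol N).X q) :
    𝓕.ev N p q ((𝓕.push f).f p a) x = 𝓕.ev M p q a ((𝓕.pull f).f q x) :=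
  evMap_natural _ _ _ _ _ _ _ _ (fun s t => (𝓕.F₀.map f).pairing_pushforward s t)
    (fun s t => (𝓕.F₁.map f).pairing_pushforward s t) p q a x

theorem push_id (M : Loc.{u} m) : 𝓕.push (𝟙 M) = 𝟙 _ := by
  have h0 : ∀ (F : NaturalBundle.{u} m), (F.map (𝟙 M)).pushforward = LinearMap.id := fun F =>
    LinearMap.ext fun s => (F.map (𝟙 M)).pushforward_ext (fun x => (F.map_id M x _).symm)
      fun y hy => eq_zero_of_notMem fun h => hy ⟨y, h, rfl⟩
  refine HomologicalComplex.hom_ext _ _ fun i => ?_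
  change obsMap (ModuleCat.ofHom (𝓕.F₀.map (𝟙 M)).pushforward)
    (ModuleCat.ofHom (𝓕.F₁.map (𝟙 M)).pushforward) i = _
  rw [h0, h0]
  exact obsMap_id i

theorem push_comp {M N K : Loc.{u} m} (f : M ⟶ N) (g : N ⟶ K) :
    𝓕.push (f ≫ g) = 𝓕.push f ≫ 𝓕.push g := by
  have h0 : ∀ (F : NaturalBundle.{u} m), (F.map (f ≫ g)).pushforward =
      (F.map g).pushforward ∘ₗ (F.map f).pushforward := fun F =>
    LinearMap.ext fun s => (F.map (f ≫ g)).pushforward_ext (fun x => by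
      rw [F.map_comp, ← (F.map f).pushforward_apply, ← (F.map g).pushforward_apply]
      rfl) fun y hy => by
      refine (F.map g).pushforward_of_notMem _ fun ⟨z, hz, hzy⟩ => hy ?_
      obtain ⟨x, hx, rfl⟩ := (F.map f).supp_extend s.2 hz
      exact ⟨x, hx, hzy⟩
  refine HomologicalComplex.hom_ext _ _ fun i => ?_
  change obsMap (ModuleCat.ofHom (𝓕.F₀.map (f ≫ g)).pushforward)
    (ModuleCat.ofHom (𝓕.F₁.map (f ≫ g)).pushforward) i = _
  rw [h0, h0, ModuleCat.ofHom_comp, ModuleCat.ofHom_comp]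
  exact obsMap_comp _ _ _ _ i

/-! ### Retarded and advanced trivializations -/

/-- A retarded (`S = past`), respectively advanced (`S = future`), trivialization: a contracting
homotopy of `𝔏_pc(M)`, respectively `𝔏_fc(M)`. -/
abbrev Trivialization (S : SupportType) (M : Loc.{u} m) : Type u :=
  Homotopy (𝟙 (𝓕.obs S M)) 0

/-- The component `𝔏(M)_n → 𝔖𝔬𝔩(M)[1]_{n+1} = 𝔖𝔬𝔩(M)_n` of `j Λ^± ι`. -/
noncomputable def jΛι {S : SupportType} {M : Loc.{u} m} (Λ : 𝓕.Trivialization S M) (n : ℤ) :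
    (𝓕.obs .compact M).X n ⟶ (𝓕.sol M).X n :=
  (𝓕.incl S M).f n ≫ Λ.hom n (n + 1) ≫ 𝓕.j S M (n + 1) n

theorem jΛι_d {S : SupportType} {M : Loc.{u} m} (Λ : 𝓕.Trivialization S M) (k : ℤ) :
    𝓕.jΛι Λ (k + 1) ≫ (𝓕.sol M).d (k + 1) k =
      (𝓕.obs .compact M).d (k + 1) k ≫ 𝓕.jΛι Λ k - 𝓕.j .compact M (k + 1) k := by
  have h1 := 𝓕.j_d S M (k + 1)
  rw [add_sub_cancel_right] at h1
  have h2 := Λ.comm (k + 1)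
  rw [dNext_eq _ (show (ComplexShape.down ℤ).Rel (k + 1) k from rfl),
    prevD_eq _ (show (ComplexShape.down ℤ).Rel (k + 1 + 1) (k + 1) from rfl)] at h2
  have h3 : Λ.hom (k + 1) (k + 1 + 1) ≫ (𝓕.obs S M).d (k + 1 + 1) (k + 1) =
      𝟙 ((𝓕.obs S M).X (k + 1)) - (𝓕.obs S M).d (k + 1) k ≫ Λ.hom k (k + 1) := by
    rw [HomologicalComplex.zero_f, add_zero, HomologicalComplex.id_f] at h2
    rw [h2]
    abel
  rw [jΛι, Category.assoc, Category.assoc, h1, Preadditive.comp_neg, ← Category.assoc (Λ.hom _ _),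
    h3, Preadditive.sub_comp, Category.id_comp, Preadditive.comp_neg, Preadditive.comp_sub,
    incl_j, jΛι, Category.assoc, ← Category.assoc ((𝓕.incl S M).f (k + 1)),
    HomologicalComplex.Hom.comm, Category.assoc]
  abel

/-- The chain map `Λ = j Λ⁺ ι - j Λ⁻ ι : 𝔏(M) → 𝔖𝔬𝔩(M)` of a pair of trivializations. -/
noncomputable def propagator {M : Loc.{u} m} (Λp : 𝓕.Trivialization .past M)
    (Λf : 𝓕.Trivialization .future M) : 𝓕.obs .compact M ⟶ 𝓕.sol M where
  f n := 𝓕.jΛι Λp n - 𝓕.jΛι Λf n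
  comm' i k hik := by
    obtain rfl : i = k + 1 := hik.symm
    rw [Preadditive.sub_comp, jΛι_d, jΛι_d, Preadditive.comp_sub]
    abel

/-- A pair of a retarded and an advanced trivialization is compatible if
`⟨a, Λ b⟩ = -⟨Λ a, b⟩`. -/
def Compatible {M : Loc.{u} m} (Λp : 𝓕.Trivialization .past M)
    (Λf : 𝓕.Trivialization .future M) : Prop :=
  ∀ (p q : ℤ) (a : (𝓕.obs .compact M).X p) (b : (𝓕.obs .compact M).X q),
    𝓕.ev M p q a ((𝓕.propagator Λp Λf).f q b) = -𝓕.ev' M p q ((𝓕.propagator Λp Λf).f p a) b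

/-- The unshifted Poisson structure `τ(a, b) = ⟨a, Λ b⟩` on observables associated with a compatible
pair of trivializations. -/
noncomputable def poisson {M : Loc.{u} m} (Λp : 𝓕.Trivialization .past M)
    (Λf : 𝓕.Trivialization .future M) (h : 𝓕.Compatible Λp Λf) : PoCh.{u} where
  V := 𝓕.obs .compact M
  τ p q := (𝓕.ev M p q).compl₂ ((𝓕.propagator Λp Λf).f q).hom
  τ_degree p q a b hpq := by
    rw [LinearMap.compl₂_apply, 𝓕.ev_degree M p q hpq]
    rfl
  τ_d p q a b := by
    have h1 := 𝓕.ev_d M p q a ((𝓕.propagator Λp Λf).f q b)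
    have h2 := congrArg (fun φ => φ.hom b) ((𝓕.propagator Λp Λf).comm q (q - 1))
    rw [LinearMap.compl₂_apply, LinearMap.compl₂_apply]
    refine Eq.trans ?_ h1
    congr 3
    exact h2.symm
  τ_antisymm p q a b := by
    rw [LinearMap.compl₂_apply, LinearMap.compl₂_apply]
    have := h q p b a
    rw [ev', mul_comm] at this
    exact this

variable (Mbar : Loc.{u} m)

/-- Naturality of a family of retarded, respectively advanced, trivializations on `Loc/M̄`:
`f^* (j Λ_N^± ι) f_* = j Λ_M^± ι` for each morphism `f : M ⟶ N` of `Loc/M̄`. -/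
def IsNatural {S : SupportType} (Λ : ∀ X : Over Mbar, 𝓕.Trivialization S X.left) : Prop :=
  ∀ {X Y : Over Mbar} (f : X ⟶ Y) (n : ℤ),
    (𝓕.push f.left).f n ≫ 𝓕.jΛι (Λ Y) n ≫ (𝓕.pull f.left).f n = 𝓕.jΛι (Λ X) n

/-- A `Loc/M̄`-natural retarded, respectively advanced, trivialization. -/
structure NaturalTrivialization (S : SupportType) where
  Λ : ∀ X : Over Mbar, 𝓕.Trivialization S X.left
  natural : 𝓕.IsNatural Mbar Λ

/-- A `Loc/M̄`-natural compatible pair of retarded/advanced trivializations. -/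
structure NaturalCompatiblePair where
  retarded : 𝓕.NaturalTrivialization Mbar .past
  advanced : 𝓕.NaturalTrivialization Mbar .future
  compatible : ∀ X : Over Mbar, 𝓕.Compatible (retarded.Λ X) (advanced.Λ X)

variable {𝓕 Mbar}

/-- The functor `(𝔏, τ) : Loc/M̄ ⥤ PoCh` associated with a natural compatible pair of
trivializations. -/
noncomputable def NaturalCompatiblePair.poissonFunctor (Λ : 𝓕.NaturalCompatiblePair Mbar) :
    Over Mbar ⥤ PoCh.{u} where
  obj X := 𝓕.poisson (Λ.retarded.Λ X) (Λ.advanced.Λ X) (Λ.compatible X)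
  map {X Y} f := ⟨𝓕.push f.left, fun p q a b => by
    have e : (𝓕.push f.left).f q ≫ (𝓕.propagator (Λ.retarded.Λ Y) (Λ.advanced.Λ Y)).f q ≫
        (𝓕.pull f.left).f q = (𝓕.propagator (Λ.retarded.Λ X) (Λ.advanced.Λ X)).f q := by
      change _ ≫ (𝓕.jΛι (Λ.retarded.Λ Y) q - 𝓕.jΛι (Λ.advanced.Λ Y) q) ≫ _ =
        𝓕.jΛι (Λ.retarded.Λ X) q - 𝓕.jΛι (Λ.advanced.Λ X) q
      rw [Preadditive.sub_comp, Preadditive.comp_sub, Λ.retarded.natural, Λ.advanced.natural]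
    have e2 := congrArg (fun φ => φ.hom b) e
    refine (𝓕.ev_natural f.left p q a _).trans ?_
    exact congrArg (𝓕.ev X.left p q a) e2⟩
  map_id X := PoCh.hom_ext (𝓕.push_id X.left)
  map_comp f g := PoCh.hom_ext (𝓕.push_comp f.left g.left)

end FieldTheory
end HomotopyAQFT

/-!
Two natural compatible pairs of trivializations define homotopic Poisson structures, and homotopic
Poisson structures have weakly equivalent quantizations, naturally in the spacetime.

*The homotopy.* Two contracting homotopies of the same complex differ by a boundary: over a single
spacetime, `j Λ (Λ' - Λ) ι` is a homotopy between `j Λ ι` and `j Λ' ι`. Pairing with the solution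
complex and antisymmetrizing yields a graded antisymmetric form `ρ` of degree one such that
`τ' = τ + ∂ρ` (`FieldTheory.exists_poisson_eq_perturb`, `exists_oddForm`). The products `Λ Λ'` need
not be natural, but the slice category has the terminal object `𝟙`. It suffices to construct `ρ`
over this object and to pull it back along the pushforwards of observables: both `τ` and `τ'` are
natural, so that the relation `τ' = τ + ∂ρ` persists (`natZigzag_of_isTerminal`).

*The zig-zag.* On the cylinder of `V`, the sum of `V` and the cone of `𝟙 V`, there is a Poisson
structure that restricts to `τ + t² ∂ρ` along the inclusion `v ↦ (v, t v, 0)`. The inclusions for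
`t = 0` and `t = 1` yield a zig-zag `(V, τ) → cylinder ← (V, τ')` of deformation retracts, natural
in `V` (`natZigzag_of_perturb`).

*Quantization preserves deformation retracts* (`CCR.weakEquivalences_of_homotopy`). The differential
graded algebra `CCR(V, τ)` depends on `τ`, but as a complex it is naturally isomorphic to the
symmetric algebra `CCR(V, 0)`: letting `v ∈ V` act on `CCR(V, 0)` as multiplication by `v` plus
contraction with `v` by means of `τ / 2` respects the relations of `CCR(V, τ)`, and acting on the
unit yields the isomorphism `CCR.reorder`. For vanishing Poisson structures a homotopy extends to a
derivation whose graded commutator with the differential is the derivation `N` counting the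
generators from the complement of the retract. A cycle `z` is homologous to `(1 - N / j) z`, and for
large `k` the product of these factors over `j ≤ k` projects `z` to the retract
(`CCR.exists_homologous`).
-/

namespace HomotopyAQFT

namespace CCR

/-! ### Graded derivations of CCR algebras -/

section Derivation
variable (P : PoCh.{u})

/-- The automorphism multiplying the degree `n` part by the Koszul sign `(-1)^{pn}`. -/
noncomputable def twist (p : ℤ) : Alg P →ₐ[ℂ] Alg P :=
  lift (fun n => (p * n).negOnePow • gen P n) (fun q r v w => by
    have h2 := gen_ccr P q r v w
    by_cases h : q + r = 0
    · obtain rfl : r = -q := by omega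
      simp only [LinearMap.smul_apply, smul_mul_smul_comm, mul_neg, Int.negOnePow_neg,
        Int.units_mul_self, one_smul] at h2 ⊢
      exact h2
    · have h0 := P.τ_degree q r v w h
      rw [h0] at h2 ⊢
      simp only [Complex.ofReal_zero, mul_zero, map_zero] at h2 ⊢
      simp only [LinearMap.smul_apply, smul_mul_smul_comm]
      rw [sub_eq_zero] at h2
      rw [h2, smul_comm, mul_comm (p * q).negOnePow, sub_self])

@[simp] theorem twist_gen (p n : ℤ) (v : P.V.X n) :
    twist P p (gen P n v) = (p * n).negOnePow • gen P n v := by simp [twist]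

theorem twist_of_mem (p : ℤ) {n : ℤ} {a : Alg P} (h : a ∈ gr P n) :
    twist P p a = (p * n).negOnePow • a := by
  refine gr_induction P (C := fun n a => twist P p a = (p * n).negOnePow • a) ?_ ?_ ?_ ?_ ?_ h
  · simp
  · intro r n v a _ ih
    rw [map_mul, twist_gen, ih, smul_mul_smul_comm, mul_add, Int.negOnePow_add]
  · simp
  · intro n a b h1 h2; rw [map_add, h1, h2, smul_add]
  · intro n c a h1; rw [map_smul, h1, smul_comm]

variable {P} in
theorem units_smul_mem {n : ℤ} (ε : ℤˣ) {a : Alg P} (h : a ∈ gr P n) : ε • a ∈ gr P n := by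
  rw [Units.smul_def]
  exact zsmul_mem h _

theorem one_mem_gr : (1 : Alg P) ∈ gr P 0 := SetLike.GradedOne.one_mem

theorem scal_mem (r : ℝ) : scal P r ∈ gr P 0 := by
  change algebraMap ℂ (Alg P) _ ∈ _
  rw [Algebra.algebraMap_eq_smul_one]
  exact Submodule.smul_mem _ _ (one_mem_gr P)

variable {P} in
theorem mul_mem_gr {k p n : ℤ} {a b : Alg P} (ha : a ∈ gr P p) (hb : b ∈ gr P n)
    (h : p + n = k) : a * b ∈ gr P k := h ▸ SetLike.mul_mem_graded ha hb

theorem scal_smul (r s : ℝ) : scal P (r • s) = r • scal P s := by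
  change algebraMap ℂ (Alg P) _ = r • algebraMap ℂ (Alg P) _
  rw [Algebra.algebraMap_eq_smul_one, Algebra.algebraMap_eq_smul_one, ← Complex.coe_smul,
    smul_smul]
  congr 1
  push_cast [smul_eq_mul]
  ring

theorem scal_comm (r : ℝ) (a : Alg P) : a * scal P r = scal P r * a :=
  (Algebra.commutes (A := Alg P) (Complex.I * (r : ℂ)) a).symm

/-- A graded derivation of degree `p` of a CCR algebra. -/
structure IsGradedDerivation (p : ℤ) (D : Alg P →ₗ[ℂ] Alg P) : Prop where
  mem : ∀ {n : ℤ} {a : Alg P}, a ∈ gr P n → D a ∈ gr P (n + p)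
  leibniz : ∀ {n : ℤ} {a : Alg P} (b : Alg P), a ∈ gr P n →
    D (a * b) = D a * b + (p * n).negOnePow • (a * D b)

variable {P}

theorem linearMap_units (D : Alg P →ₗ[ℂ] Alg P) (ε : ℤˣ) (a : Alg P) : D (ε • a) = ε • D a :=
  map_units_smul D.toAddMonoidHom ε a

namespace IsGradedDerivation
variable {p q : ℤ} {D E : Alg P →ₗ[ℂ] Alg P}

theorem map_one (hD : IsGradedDerivation P p D) : D 1 = 0 := by
  have := hD.leibniz 1 (one_mem_gr P)
  simpa using this

theorem map_scal (hD : IsGradedDerivation P p D) (r : ℝ) : D (scal P r) = 0 := by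
  change D (algebraMap ℂ (Alg P) _) = 0
  rw [Algebra.algebraMap_eq_smul_one, map_smul, hD.map_one, smul_zero]

theorem gen_mul (hD : IsGradedDerivation P p D) (n : ℤ) (v : P.V.X n) (b : Alg P) :
    D (gen P n v * b) = D (gen P n v) * b + (p * n).negOnePow • (gen P n v * D b) :=
  hD.leibniz b (gen_mem P n v)

/-- Graded derivations that agree on generators are equal. -/
theorem ext (hD : IsGradedDerivation P p D) (hE : IsGradedDerivation P p E)
    (h : ∀ (n : ℤ) (v : P.V.X n), D (gen P n v) = E (gen P n v)) : D = E := by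
  refine LinearMap.ext fun a => ?_
  refine ext_of_mem (f := D.toAddMonoidHom) (g := E.toAddMonoidHom) (fun n a ha => ?_) a
  refine gr_induction P (C := fun n a => D a = E a) ?_ ?_ ?_ ?_ ?_ ha
  · rw [hD.map_one, hE.map_one]
  · intro r n v a _ ih
    rw [hD.gen_mul, hE.gen_mul, h, ih]
  · simp
  · intro n a b h1 h2; rw [map_add, map_add, h1, h2]
  · intro n c a h1; rw [map_smul, map_smul, h1]

/-- The graded commutator of graded derivations is a graded derivation. -/
theorem commutator (hD : IsGradedDerivation P p D) (hE : IsGradedDerivation P q E) :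
    IsGradedDerivation P (p + q) (D ∘ₗ E - (p * q).negOnePow • E ∘ₗ D) where
  mem {n a} ha := by
    have h1 := hD.mem (hE.mem ha)
    have h2 := units_smul_mem (p * q).negOnePow (hE.mem (hD.mem ha))
    rw [show n + q + p = n + (p + q) by ring] at h1
    rw [show n + p + q = n + (p + q) by ring] at h2
    exact Submodule.sub_mem _ h1 h2
  leibniz {n a} b ha := by
    have s1 : (p * (n + q)).negOnePow = (p * n).negOnePow * (p * q).negOnePow := by
      rw [mul_add, Int.negOnePow_add]
    have s2 : (q * (n + p)).negOnePow = (q * n).negOnePow * (p * q).negOnePow := by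
      rw [mul_add, Int.negOnePow_add, mul_comm q p]
    have s3 : ((p + q) * n).negOnePow = (p * n).negOnePow * (q * n).negOnePow := by
      rw [add_mul, Int.negOnePow_add]
    have s4 : (p * q).negOnePow * ((q * n).negOnePow * (p * q).negOnePow) =
        (q * n).negOnePow := by
      rw [mul_left_comm, Int.units_mul_self, mul_one]
    simp only [LinearMap.sub_apply, LinearMap.comp_apply, LinearMap.smul_apply]
    rw [hE.leibniz b ha, hD.leibniz b ha, map_add, map_add, linearMap_units, linearMap_units,
      hD.leibniz b (hE.mem ha), hE.leibniz b (hD.mem ha), hD.leibniz _ ha, hE.leibniz _ ha,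
      s1, s2, s3]
    simp only [smul_add, sub_mul, mul_sub, smul_sub, smul_smul, smul_mul_assoc, mul_smul_comm, s4]
    simp only [mul_comm]
    abel

end IsGradedDerivation

theorem isGradedDerivation_d : IsGradedDerivation P (-1) (d P) where
  mem h := d_mem P h
  leibniz {n a} b h := by
    rw [leibniz P b h, neg_one_mul, Int.negOnePow_neg]

/-- A family of maps on generators that is compatible with the commutation relations extends to a
graded derivation `D`; it is read off from the algebra map `a ↦ (± a, D a; 0, a)`. -/
theorem exists_isGradedDerivation (p : ℤ) (θ : ∀ n, P.V.X n →ₗ[ℝ] Alg P)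
    (hθ : ∀ n v, θ n v ∈ gr P (n + p))
    (h : ∀ (q r : ℤ) (v : P.V.X q) (w : P.V.X r),
      θ q v * gen P r w + (p * q).negOnePow • (gen P q v * θ r w) -
        (q * r).negOnePow • (θ r w * gen P q v + (p * r).negOnePow • (gen P r w * θ q v)) = 0) :
    ∃ D : Alg P →ₗ[ℂ] Alg P, IsGradedDerivation P p D ∧
      ∀ (n : ℤ) (v : P.V.X n), D (gen P n v) = θ n v := by
  let F : Alg P →ₐ[ℂ] Matrix (Fin 2) (Fin 2) (Alg P) := lift (fun n =>
    { toFun := fun v => !![(p * n).negOnePow • gen P n v, θ n v; 0, gen P n v]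
      map_add' := fun v w => by
        rw [map_add, map_add, smul_add, upper_add]
      map_smul' := fun r v => by
        rw [map_smul, map_smul, smul_comm (p * n).negOnePow r (gen P n v), upper_smul]
        rfl })
    (fun q r v w => upper_rel (by
        have h5 := congrArg (twist P p) (gen_ccr P q r v w)
        rw [map_sub, map_mul, twist_gen, twist_gen, AlgHom.commutes,
          Units.smul_def (q * r).negOnePow, map_zsmul, map_mul, twist_gen, twist_gen,
          ← Units.smul_def] at h5
        exact h5)
      (by
        rw [← h q r v w, smul_mul_assoc, smul_mul_assoc]
        abel_nf)
      (gen_ccr P q r v w))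
  have hF : ∀ (n : ℤ) (v : P.V.X n), F (gen P n v) =
      !![(p * n).negOnePow • gen P n v, θ n v; 0, gen P n v] := fun n v => lift_gen _ _ n v
  have hFe : ∀ a, F a 0 0 = twist P p a ∧ F a 1 0 = 0 ∧ F a 1 1 = a := by
    intro a
    induction a using CCR.induction with
    | h0 c => simp [Matrix.algebraMap_matrix_apply]
    | hg n v => simp [hF]
    | ha a b iha ihb => simp [iha, ihb]
    | hm a b iha ihb => simp [Matrix.mul_apply, Fin.sum_univ_two, iha, ihb]
  let D : Alg P →ₗ[ℂ] Alg P :=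
    { toFun := fun a => F a 0 1
      map_add' := fun a b => by simp
      map_smul' := fun c a => by simp }
  have hg : ∀ (n : ℤ) (v : P.V.X n), D (gen P n v) = θ n v := fun n v => by
    change F (gen P n v) 0 1 = _
    rw [hF]; rfl
  have hl : ∀ {n : ℤ} {a : Alg P} (b : Alg P), a ∈ gr P n →
      D (a * b) = D a * b + (p * n).negOnePow • (a * D b) := by
    intro n a b ha
    change F (a * b) 0 1 = F a 0 1 * b + _ • (a * F b 0 1)
    rw [map_mul, Matrix.mul_apply, Fin.sum_univ_two, (hFe a).1, (hFe b).2.2, twist_of_mem P p ha,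
      smul_mul_assoc, add_comm]
  refine ⟨D, ⟨fun {n a} ha => ?_, hl⟩, hg⟩
  refine gr_induction P (C := fun n a => D a ∈ gr P (n + p)) ?_ ?_ ?_ ?_ ?_ ha
  · have h1 : D 1 = 0 := by simpa using hl 1 (one_mem_gr P)
    rw [h1]; exact Submodule.zero_mem _
  · intro r n v a ha ih
    rw [hl a (gen_mem P r v), hg]
    exact Submodule.add_mem _ (mul_mem_gr (hθ r v) ha (by ring))
      (units_smul_mem _ (mul_mem_gr (gen_mem P r v) ih (by ring)))
  · intro n; rw [map_zero]; exact Submodule.zero_mem _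
  · intro n a b h1 h2; rw [map_add]; exact Submodule.add_mem _ h1 h2
  · intro n c a h1; rw [map_smul]; exact Submodule.smul_mem _ _ h1

end Derivation

/-! ### Contractions -/

section Contraction

/-- A bilinear form of degree zero on a chain complex (not necessarily a chain map). -/
structure Form (V : ChainComplex (ModuleCat.{u} ℝ) ℤ) where
  κ : ∀ p q : ℤ, V.X p →ₗ[ℝ] V.X q →ₗ[ℝ] ℝ
  degree : ∀ (p q : ℤ) (a : V.X p) (b : V.X q), p + q ≠ 0 → κ p q a b = 0

variable {P : PoCh.{u}} (K : Form P.V)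

/-- A sign in front of the value of a form may be changed to another one that agrees with it in
the degrees where the form does not vanish. -/
theorem Form.smul_scal {p q : ℤ} (a : P.V.X p) (b : P.V.X q) {ε ε' : ℤˣ} (x : Alg P)
    (h : q = -p → ε = ε') : ε • (scal P (K.κ p q a b) * x) = ε' • (scal P (K.κ p q a b) * x) := by
  by_cases hpq : p + q = 0
  · rw [h (by omega)]
  · rw [K.degree p q a b hpq]; simp

theorem exists_contraction (p : ℤ) (v : P.V.X p) :
    ∃ D : Alg P →ₗ[ℂ] Alg P, IsGradedDerivation P p D ∧
      ∀ (n : ℤ) (w : P.V.X n), D (gen P n w) = scal P (K.κ p n v w) := by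
  refine exists_isGradedDerivation p
    (fun n => { toFun := fun w => scal P (K.κ p n v w)
                map_add' := fun w w' => by rw [map_add, map_add]
                map_smul' := fun r w => by rw [map_smul, scal_smul]; rfl })
    (fun n w => ?_) (fun q r w z => ?_)
  · change scal P (K.κ p n v w) ∈ _
    by_cases h : p + n = 0
    · rw [add_comm, h]; exact scal_mem P _
    · rw [K.degree p n v w h, map_zero]; exact Submodule.zero_mem _
  · change scal P (K.κ p q v w) * gen P r z + (p * q).negOnePow • (gen P q w * scal P (K.κ p r v z))
      - (q * r).negOnePow • (scal P (K.κ p r v z) * gen P q w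
        + (p * r).negOnePow • (gen P r z * scal P (K.κ p q v w))) = 0
    rw [scal_comm, scal_comm, smul_add, smul_smul,
      K.smul_scal v z (ε := (p * q).negOnePow) (ε' := (q * r).negOnePow) _
        (by rintro rfl; rw [mul_neg, Int.negOnePow_neg, mul_comm]),
      K.smul_scal v w (ε := (q * r).negOnePow * (p * r).negOnePow) (ε' := 1) _
        (by rintro rfl; rw [neg_mul, Int.negOnePow_neg, Int.units_mul_self]), one_smul]
    abel

/-- The contraction with `v` by means of a form `κ`: the graded derivation with
`w ↦ i κ(v, w) 1`. -/
noncomputable def contraction (p : ℤ) (v : P.V.X p) : Alg P →ₗ[ℂ] Alg P :=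
  (exists_contraction K p v).choose

theorem isGradedDerivation_contraction (p : ℤ) (v : P.V.X p) :
    IsGradedDerivation P p (contraction K p v) := (exists_contraction K p v).choose_spec.1

@[simp] theorem contraction_gen (p n : ℤ) (v : P.V.X p) (w : P.V.X n) :
    contraction K p v (gen P n w) = scal P (K.κ p n v w) :=
  (exists_contraction K p v).choose_spec.2 n w

/-- Contractions commute in the graded sense. -/
theorem contraction_comm (K K' : Form P.V) (p q : ℤ) (v : P.V.X p) (w : P.V.X q) (a : Alg P) :
    contraction K p v (contraction K' q w a) =
      (p * q).negOnePow • contraction K' q w (contraction K p v a) := by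
  have hD := isGradedDerivation_contraction K p v
  have hE := isGradedDerivation_contraction K' q w
  have h0 : IsGradedDerivation P (p + q) 0 :=
    ⟨fun _ => Submodule.zero_mem _, fun _ _ => by simp⟩
  have := (hD.commutator hE).ext h0 fun n u => by
    simp [hD.map_scal, hE.map_scal]
  exact sub_eq_zero.1 (LinearMap.congr_fun this a)

theorem IsGradedDerivation.add {p : ℤ} {D E : Alg P →ₗ[ℂ] Alg P} (hD : IsGradedDerivation P p D)
    (hE : IsGradedDerivation P p E) : IsGradedDerivation P p (D + E) where
  mem h := Submodule.add_mem _ (hD.mem h) (hE.mem h)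
  leibniz b h := by
    simp only [LinearMap.add_apply, hD.leibniz b h, hE.leibniz b h, add_mul, mul_add, smul_add]
    abel

theorem IsGradedDerivation.smul {p : ℤ} {D : Alg P →ₗ[ℂ] Alg P} (hD : IsGradedDerivation P p D)
    (c : ℂ) : IsGradedDerivation P p (c • D) where
  mem h := Submodule.smul_mem _ _ (hD.mem h)
  leibniz b h := by
    simp only [LinearMap.smul_apply, hD.leibniz b h, smul_add, smul_mul_assoc, mul_smul_comm]
    rw [smul_comm c]

theorem contraction_add (p : ℤ) (v w : P.V.X p) :
    contraction K p (v + w) = contraction K p v + contraction K p w :=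
  (isGradedDerivation_contraction K p _).ext ((isGradedDerivation_contraction K p v).add
    (isGradedDerivation_contraction K p w)) fun n u => by simp

theorem contraction_smul (p : ℤ) (r : ℝ) (v : P.V.X p) :
    contraction K p (r • v) = (r : ℂ) • contraction K p v :=
  (isGradedDerivation_contraction K p _).ext ((isGradedDerivation_contraction K p v).smul _)
    fun n u => by
      rw [contraction_gen, LinearMap.smul_apply, contraction_gen, map_smul, LinearMap.smul_apply,
        scal_smul, Complex.coe_smul]

/-- The form `-κ`. -/
@[simps] def Form.neg {V : ChainComplex (ModuleCat.{u} ℝ) ℤ} (K : Form V) : Form V where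
  κ p q := -K.κ p q
  degree p q a b h := by simp [K.degree p q a b h]

theorem contraction_neg (p : ℤ) (v : P.V.X p) :
    contraction K.neg p v = -contraction K p v := by
  rw [← neg_one_smul ℂ]
  exact (isGradedDerivation_contraction K.neg p v).ext
    ((isGradedDerivation_contraction K p v).smul _) fun n u => by simp

end Contraction
end CCR
/-! ### Poisson structures on a fixed complex -/

/-- An unshifted Poisson structure on a fixed chain complex. -/
structure PoissonStructure (V : ChainComplex (ModuleCat.{u} ℝ) ℤ) extends CCR.Form V where
  d_comp : ∀ (p q : ℤ) (a : V.X p) (b : V.X q),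
    κ (p - 1) q (V.d p (p - 1) a) b + p.negOnePow • κ p (q - 1) a (V.d q (q - 1) b) = 0
  antisymm : ∀ (p q : ℤ) (a : V.X p) (b : V.X q),
    κ q p b a = -((p * q).negOnePow • κ p q a b)

namespace PoissonStructure
variable {V : ChainComplex (ModuleCat.{u} ℝ) ℤ}

/-- The unshifted Poisson complex given by a Poisson structure. -/
abbrev toPoCh (S : PoissonStructure V) : PoCh.{u} := ⟨V, S.κ, S.degree, S.d_comp, S.antisymm⟩

/-- The Poisson structure of an unshifted Poisson complex. -/
abbrev ofPoCh (P : PoCh.{u}) : PoissonStructure P.V := ⟨⟨P.τ, P.τ_degree⟩, P.τ_d, P.τ_antisymm⟩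

/-- The zero Poisson structure. -/
@[simps! κ] def zero (V : ChainComplex (ModuleCat.{u} ℝ) ℤ) : PoissonStructure V where
  κ _ _ := 0
  degree _ _ _ _ _ := rfl
  d_comp _ _ _ _ := by simp
  antisymm _ _ _ _ := by simp

/-- Half of the difference of two Poisson structures. -/
@[simps κ] noncomputable def halfDiff (S T : PoissonStructure V) : CCR.Form V where
  κ p q := (2⁻¹ : ℝ) • (S.κ p q - T.κ p q)
  degree p q a b h := by simp [S.degree p q a b h, T.degree p q a b h]

theorem halfDiff_neg (S T : PoissonStructure V) : (S.halfDiff T).neg = T.halfDiff S := by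
  rw [CCR.Form.neg, halfDiff, halfDiff]
  congr 1
  funext p q
  refine LinearMap.ext fun a => LinearMap.ext fun b => ?_
  change -((2⁻¹ : ℝ) * (S.κ p q a b - T.κ p q a b)) = 2⁻¹ * (T.κ p q a b - S.κ p q a b)
  ring

theorem halfDiff_d (S T : PoissonStructure V) (p q : ℤ) (a : V.X p) (b : V.X q) :
    (S.halfDiff T).κ (p - 1) q (V.d p (p - 1) a) b =
      -(p.negOnePow • (S.halfDiff T).κ p (q - 1) a (V.d q (q - 1) b)) := by
  have h1 := eq_neg_of_add_eq_zero_left (S.d_comp p q a b)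
  have h2 := eq_neg_of_add_eq_zero_left (T.d_comp p q a b)
  simp only [halfDiff_κ, LinearMap.smul_apply, LinearMap.sub_apply, h1, h2, Units.smul_def,
    zsmul_eq_mul, smul_eq_mul]
  ring

theorem halfDiff_antisymm (S T : PoissonStructure V) (p q : ℤ) (a : V.X p) (b : V.X q) :
    (S.halfDiff T).κ p q a b - (p * q).negOnePow • (S.halfDiff T).κ q p b a =
      S.κ p q a b - T.κ p q a b := by
  simp only [halfDiff_κ, LinearMap.smul_apply, LinearMap.sub_apply, S.antisymm p q a b,
    T.antisymm p q a b]
  rcases Int.units_eq_one_or (p * q).negOnePow with h | h <;> rw [h] <;>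
  · simp only [Units.neg_smul, one_smul, smul_eq_mul]
    ring

end PoissonStructure

namespace CCR
open PoissonStructure

/-! ### Reordering: independence of the complex `CCR(V, τ)` from `τ` -/

section Reorder
variable {V : ChainComplex (ModuleCat.{u} ℝ) ℤ} (S T : PoissonStructure V)

/-- The representation of `CCR(V, σ)` on `CCR(V, τ)`, where `v ∈ V` acts as multiplication by `v`
plus the contraction with `v` by means of `(σ - τ) / 2`. -/
noncomputable def action : Alg S.toPoCh →ₐ[ℂ] Module.End ℂ (Alg T.toPoCh) :=
  lift (fun n =>
    { toFun := fun v => LinearMap.mulLeft ℂ (gen T.toPoCh n v) +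
        contraction (P := T.toPoCh) (S.halfDiff T) n v
      map_add' := fun v w => by
        refine LinearMap.ext fun a => ?_
        rw [contraction_add (P := T.toPoCh)]
        simp only [map_add, LinearMap.add_apply, LinearMap.mulLeft_apply, add_mul]
        abel
      map_smul' := fun r v => by
        refine LinearMap.ext fun a => ?_
        rw [contraction_smul (P := T.toPoCh)]
        simp only [map_smul, LinearMap.add_apply, LinearMap.mulLeft_apply,
          LinearMap.smul_apply, smul_mul_assoc, RingHom.id_apply, smul_add, Complex.coe_smul] })
    (fun p q v w => by
      refine LinearMap.ext fun a => ?_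
      have e1 := contraction_comm (P := T.toPoCh) (S.halfDiff T) (S.halfDiff T) p q v w a
      have e2 := (isGradedDerivation_contraction (P := T.toPoCh) (S.halfDiff T) p v).gen_mul q w a
      have e3 := (isGradedDerivation_contraction (P := T.toPoCh) (S.halfDiff T) q w).gen_mul p v a
      have e4 := congrArg (· * a) (gen_ccr T.toPoCh p q v w)
      have e5 := congrArg (scal T.toPoCh) (S.halfDiff_antisymm T p q v w)
      rw [contraction_gen] at e2 e3
      rw [map_sub, map_sub, map_units_smul] at e5
      have e6 : algebraMap ℂ (Alg T.toPoCh) (Complex.I * (T.toPoCh.τ p q v w : ℝ)) =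
        scal T.toPoCh (T.κ p q v w) := rfl
      have e7 : (algebraMap ℂ (Module.End ℂ (Alg T.toPoCh))
          (Complex.I * (S.toPoCh.τ p q v w : ℝ))) a = scal T.toPoCh (S.κ p q v w) * a :=
        (Module.algebraMap_end_apply ℂ ℂ _ _ a).trans (Algebra.smul_def _ a)
      simp only [sub_mul, mul_assoc, smul_mul_assoc] at e4
      rw [e7]
      simp only [LinearMap.coe_mk, AddHom.coe_mk, LinearMap.sub_apply, Units.smul_def,
        LinearMap.smul_apply, Module.End.mul_apply, LinearMap.add_apply, LinearMap.mulLeft_apply,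
        mul_add]
      simp only [← Units.smul_def]
      rw [e1, e2, e3, mul_comm q p]
      rw [e6] at e4
      rw [← sub_add_cancel (scal T.toPoCh (S.κ p q v w)) (scal T.toPoCh (T.κ p q v w)), add_mul,
        ← e4, ← e5]
      simp only [smul_add, smul_smul, Int.units_mul_self, one_smul, sub_mul, smul_mul_assoc]
      abel)

/-- The linear map `CCR(V, σ) → CCR(V, τ)` given by the action on the unit. -/
noncomputable def reorder : Alg S.toPoCh →ₗ[ℂ] Alg T.toPoCh where
  toFun a := action S T a 1
  map_add' a b := by rw [map_add]; rfl
  map_smul' c a := by rw [map_smul]; rfl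

theorem reorder_one : reorder S T 1 = 1 := by
  change action S T 1 1 = 1
  rw [map_one (action S T)]; rfl

theorem reorder_gen_mul (n : ℤ) (v : V.X n) (a : Alg S.toPoCh) :
    reorder S T (gen S.toPoCh n v * a) = gen T.toPoCh n v * reorder S T a +
      contraction (P := T.toPoCh) (S.halfDiff T) n v (reorder S T a) := by
  change action S T (gen S.toPoCh n v * a) 1 = _
  rw [map_mul, action, lift_gen]
  rfl

theorem reorder_mem {n : ℤ} {a : Alg S.toPoCh} (h : a ∈ gr S.toPoCh n) :
    reorder S T a ∈ gr T.toPoCh n := by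
  refine gr_induction S.toPoCh (C := fun n a => reorder S T a ∈ gr T.toPoCh n) ?_ ?_ ?_ ?_ ?_ h
  · rw [reorder_one]; exact one_mem_gr _
  · intro p n v a _ ih
    rw [reorder_gen_mul]
    refine Submodule.add_mem _ (mul_mem_gr (gen_mem _ _ _) ih rfl) ?_
    have := (isGradedDerivation_contraction (P := T.toPoCh) (S.halfDiff T) p v).mem ih
    rwa [add_comm] at this
  · intro n; rw [map_zero]; exact Submodule.zero_mem _
  · intro n a b h1 h2; rw [map_add]; exact Submodule.add_mem _ h1 h2
  · intro n c a h1; rw [map_smul]; exact Submodule.smul_mem _ _ h1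

/-- Reordering commutes with contractions. -/
theorem reorder_contraction (K : Form V) (q : ℤ) (w : V.X q) (a : Alg S.toPoCh) :
    reorder S T (contraction (P := S.toPoCh) K q w a) =
      contraction (P := T.toPoCh) K q w (reorder S T a) := by
  refine ext_of_mem (P := S.toPoCh)
    (f := (reorder S T ∘ₗ contraction (P := S.toPoCh) K q w).toAddMonoidHom)
    (g := (contraction (P := T.toPoCh) K q w ∘ₗ reorder S T).toAddMonoidHom) (fun n a ha => ?_) a
  refine gr_induction S.toPoCh (C := fun n a =>
    reorder S T (contraction (P := S.toPoCh) K q w a) =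
      contraction (P := T.toPoCh) K q w (reorder S T a)) ?_ ?_ ?_ ?_ ?_ ha
  · rw [(isGradedDerivation_contraction _ _ _).map_one, reorder_one,
      (isGradedDerivation_contraction _ _ _).map_one, map_zero]
  · intro p n v a _ ih
    have e : ∀ r : ℝ, reorder S T (scal S.toPoCh r * a) = scal T.toPoCh r * reorder S T a :=
      fun r => by
        change reorder S T (algebraMap ℂ _ _ * a) = algebraMap ℂ _ _ * reorder S T a
        rw [← Algebra.smul_def, ← Algebra.smul_def, map_smul]
    have eu : ∀ (ε : ℤˣ) x, reorder S T (ε • x) = ε • reorder S T x :=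
      map_units_smul (reorder S T).toAddMonoidHom
    rw [(isGradedDerivation_contraction (P := S.toPoCh) K q w).gen_mul, contraction_gen, map_add,
      e, eu, reorder_gen_mul, reorder_gen_mul, map_add,
      (isGradedDerivation_contraction (P := T.toPoCh) K q w).gen_mul, contraction_gen, ih,
      contraction_comm (P := T.toPoCh) K, smul_add]
    abel
  · simp
  · intro n a b h1 h2; simp only [map_add, h1, h2]
  · intro n c a h1; simp only [map_smul, h1]

/-- Reordering is invertible: the contraction terms in the two directions are opposite, and they
commute with reordering. -/
theorem reorder_reorder (a : Alg S.toPoCh) : reorder T S (reorder S T a) = a := by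
  refine ext_of_mem (P := S.toPoCh) (f := (reorder T S ∘ₗ reorder S T).toAddMonoidHom)
    (g := AddMonoidHom.id _) (fun n a ha => ?_) a
  refine gr_induction S.toPoCh (C := fun n a => reorder T S (reorder S T a) = a) ?_ ?_ ?_ ?_ ?_ ha
  · rw [reorder_one, reorder_one]
  · intro p n v a _ ih
    rw [reorder_gen_mul, map_add, reorder_gen_mul, reorder_contraction, ih, ← halfDiff_neg,
      contraction_neg (P := S.toPoCh)]
    simp
  · simp
  · intro n a b h1 h2; simp only [map_add, h1, h2]
  · intro n c a h1; simp only [map_smul, h1]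

/-- The graded commutator of the differential with a contraction by means of a difference of
Poisson structures. -/
theorem d_contraction (p : ℤ) (v : V.X p) (a : Alg T.toPoCh) :
    d T.toPoCh (contraction (P := T.toPoCh) (S.halfDiff T) p v a) =
      contraction (P := T.toPoCh) (S.halfDiff T) (p - 1) (V.d p (p - 1) v) a +
        p.negOnePow • contraction (P := T.toPoCh) (S.halfDiff T) p v (d T.toPoCh a) := by
  have hD := isGradedDerivation_d (P := T.toPoCh)
  have hE := isGradedDerivation_contraction (P := T.toPoCh) (S.halfDiff T) p v
  have h0 := isGradedDerivation_contraction (P := T.toPoCh) (S.halfDiff T) (p - 1)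
    (V.d p (p - 1) v)
  have hc := hD.commutator hE
  rw [show -1 + p = p - 1 by ring] at hc
  have := hc.ext h0 fun n u => by
    have e := congrArg (scal T.toPoCh) (S.halfDiff_d T p n v u)
    rw [map_neg, map_units_smul] at e
    simp only [LinearMap.sub_apply, LinearMap.smul_apply, LinearMap.comp_apply]
    rw [contraction_gen, contraction_gen, hD.map_scal, d_gen, contraction_gen, neg_one_mul,
      Int.negOnePow_neg, zero_sub]
    exact e.symm
  rw [← this]
  simp [Int.negOnePow_neg]

theorem reorder_d (a : Alg S.toPoCh) :
    reorder S T (d S.toPoCh a) = d T.toPoCh (reorder S T a) := by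
  refine ext_of_mem (P := S.toPoCh) (f := (reorder S T ∘ₗ d S.toPoCh).toAddMonoidHom)
    (g := (d T.toPoCh ∘ₗ reorder S T).toAddMonoidHom) (fun n a ha => ?_) a
  refine gr_induction S.toPoCh (C := fun n a =>
    reorder S T (d S.toPoCh a) = d T.toPoCh (reorder S T a)) ?_ ?_ ?_ ?_ ?_ ha
  · rw [d_one, map_zero, reorder_one, d_one]
  · intro p n v a _ ih
    have eu : ∀ (ε : ℤˣ) x, reorder S T (ε • x) = ε • reorder S T x :=
      map_units_smul (reorder S T).toAddMonoidHom
    rw [leibniz S.toPoCh a (gen_mem S.toPoCh p v), d_gen, map_add, eu, reorder_gen_mul,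
      reorder_gen_mul, reorder_gen_mul, map_add, leibniz T.toPoCh _ (gen_mem T.toPoCh p v), d_gen,
      d_contraction, ih, smul_add]
    abel
  · simp
  · intro n a b h1 h2; simp only [map_add, h1, h2]
  · intro n c a h1; simp only [map_smul, h1]

end Reorder

section Naturality
variable {V W : ChainComplex (ModuleCat.{u} ℝ) ℤ} {S T : PoissonStructure V}
  {S' T' : PoissonStructure W}

theorem mapAlg_scal {P Q : PoCh.{u}} (f : P ⟶ Q) (r : ℝ) : mapAlg f (scal P r) = scal Q r :=
  (mapAlg f).commutes _

/-- Reordering is natural. -/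
theorem reorder_mapAlg (f : S.toPoCh ⟶ S'.toPoCh) (g : T.toPoCh ⟶ T'.toPoCh)
    (h : f.toChainMap = g.toChainMap) (a : Alg S.toPoCh) :
    reorder S' T' (mapAlg f a) = mapAlg g (reorder S T a) := by
  have hκ : ∀ (p q : ℤ) (v : V.X p) (w : V.X q), (S'.halfDiff T').κ p q
      (g.toChainMap.f p v) (g.toChainMap.f q w) = (S.halfDiff T).κ p q v w := by
    intro p q v w
    have h1 := f.map_τ p q v w
    rw [h] at h1
    have h2 := g.map_τ p q v w
    simp only [halfDiff_κ, LinearMap.smul_apply, LinearMap.sub_apply]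
    exact congrArg₂ (fun x y : ℝ => (2⁻¹ : ℝ) • (x - y)) h1 h2
  have hc : ∀ (p : ℤ) (v : V.X p) (b : Alg T.toPoCh),
      mapAlg g (contraction (P := T.toPoCh) (S.halfDiff T) p v b) =
        contraction (P := T'.toPoCh) (S'.halfDiff T') p (g.toChainMap.f p v) (mapAlg g b) := by
    intro p v b
    have hE := isGradedDerivation_contraction (P := T.toPoCh) (S.halfDiff T) p v
    have hE' := isGradedDerivation_contraction (P := T'.toPoCh) (S'.halfDiff T') p
      (g.toChainMap.f p v)
    refine ext_of_mem (P := T.toPoCh)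
      (f := ((mapAlg g).toLinearMap ∘ₗ
        contraction (P := T.toPoCh) (S.halfDiff T) p v).toAddMonoidHom)
      (g := (contraction (P := T'.toPoCh) (S'.halfDiff T') p (g.toChainMap.f p v) ∘ₗ
        (mapAlg g).toLinearMap).toAddMonoidHom) (fun n b hb => ?_) b
    refine gr_induction T.toPoCh (C := fun n b =>
      mapAlg g (contraction (P := T.toPoCh) (S.halfDiff T) p v b) =
        contraction (P := T'.toPoCh) (S'.halfDiff T') p (g.toChainMap.f p v) (mapAlg g b))
      ?_ ?_ ?_ ?_ ?_ hb
    · rw [hE.map_one, map_zero, map_one (mapAlg g), hE'.map_one]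
    · intro q n w b _ ih
      rw [hE.gen_mul, map_add, map_mul, mapAlg_units, map_mul, map_mul, mapAlg_gen, hE'.gen_mul, ih,
        contraction_gen, mapAlg_scal, contraction_gen, hκ]
    · simp
    · intro n a b h1 h2; simp only [map_add, h1, h2]
    · intro n c a h1; simp only [map_smul, h1]
  refine ext_of_mem (P := S.toPoCh) (f := (reorder S' T' ∘ₗ (mapAlg f).toLinearMap).toAddMonoidHom)
    (g := ((mapAlg g).toLinearMap ∘ₗ reorder S T).toAddMonoidHom) (fun n a ha => ?_) a
  refine gr_induction S.toPoCh (C := fun n a =>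
    reorder S' T' (mapAlg f a) = mapAlg g (reorder S T a)) ?_ ?_ ?_ ?_ ?_ ha
  · rw [map_one (mapAlg f), reorder_one, reorder_one, map_one (mapAlg g)]
  · intro p n v a _ ih
    have e : mapAlg f (gen S.toPoCh p v) = gen S'.toPoCh p (g.toChainMap.f p v) := by
      rw [mapAlg_gen, h]
    rw [map_mul, e, reorder_gen_mul, reorder_gen_mul, map_add, map_mul, mapAlg_gen, hc, ih]
  · simp
  · intro n a b h1 h2; simp only [map_add, h1, h2]
  · intro n c a h1; simp only [map_smul, h1]

end Naturality
end CCR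
/-! ### An elementwise criterion for weak equivalences -/

/-- A chain map of complexes of modules is a quasi-isomorphism if it is injective and surjective
on homology classes, expressed in terms of cycles and boundaries. -/
theorem quasiIso_of_cycles {R : Type*} [Ring R] {K L : ChainComplex (ModuleCat.{u} R) ℤ}
    (φ : K ⟶ L)
    (inj : ∀ (n : ℤ) (x : K.X n), K.d n (n - 1) x = 0 → ∀ y : L.X (n + 1),
      φ.f n x = L.d (n + 1) n y → ∃ z : K.X (n + 1), x = K.d (n + 1) n z)
    (surj : ∀ (n : ℤ) (y : L.X n), L.d n (n - 1) y = 0 → ∃ x : K.X n, K.d n (n - 1) x = 0 ∧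
      ∃ z : L.X (n + 1), y = φ.f n x + L.d (n + 1) n z) : QuasiIso φ := by
  refine ⟨fun n => ?_⟩
  have hp : (ComplexShape.down ℤ).prev n = n + 1 := ComplexShape.prev_eq' _ rfl
  have hn : (ComplexShape.down ℤ).next n = n - 1 :=
    ComplexShape.next_eq' _ (show n - 1 + 1 = n by ring)
  rw [quasiIsoAt_iff_isIso_homologyMap]
  have hmono : Mono (HomologicalComplex.homologyMap φ n) := by
    rw [HomologicalComplex.mono_homologyMap_iff_up_to_refinements φ _ n _ hp hn]
    intro A x hx y hy
    let p : A × K.X (n + 1) →ₗ[R] K.X n :=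
      x.hom ∘ₗ LinearMap.fst R _ _ - (K.d (n + 1) n).hom ∘ₗ LinearMap.snd R _ _
    refine ⟨ModuleCat.of R (LinearMap.ker p),
      ModuleCat.ofHom (LinearMap.fst R _ _ ∘ₗ (LinearMap.ker p).subtype), ?_,
      ModuleCat.ofHom (LinearMap.snd R _ _ ∘ₗ (LinearMap.ker p).subtype), ?_⟩
    · rw [ModuleCat.epi_iff_surjective]
      intro a
      obtain ⟨z, hz⟩ := inj n (x.hom a) (congrArg (fun g => g.hom a) hx) (y.hom a)
        (congrArg (fun g => g.hom a) hy)
      exact ⟨⟨(a, z), sub_eq_zero.2 hz⟩, rfl⟩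
    · exact ModuleCat.hom_ext (LinearMap.ext fun a => sub_eq_zero.1 a.2)
  have hepi : Epi (HomologicalComplex.homologyMap φ n) := by
    rw [HomologicalComplex.epi_homologyMap_iff_up_to_refinements φ _ n _ hp hn]
    intro A y hy
    let p : A × LinearMap.ker (K.d n (n - 1)).hom × L.X (n + 1) →ₗ[R] L.X n :=
      y.hom ∘ₗ LinearMap.fst R _ _ - ((φ.f n).hom ∘ₗ (LinearMap.ker _).subtype ∘ₗ
        LinearMap.fst R _ _ ∘ₗ LinearMap.snd R _ _ + (L.d (n + 1) n).hom ∘ₗ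
        LinearMap.snd R _ _ ∘ₗ LinearMap.snd R _ _)
    refine ⟨ModuleCat.of R (LinearMap.ker p),
      ModuleCat.ofHom (LinearMap.fst R _ _ ∘ₗ (LinearMap.ker p).subtype), ?_,
      ModuleCat.ofHom ((LinearMap.ker _).subtype ∘ₗ LinearMap.fst R _ _ ∘ₗ LinearMap.snd R _ _ ∘ₗ
        (LinearMap.ker p).subtype), ?_,
      ModuleCat.ofHom (LinearMap.snd R _ _ ∘ₗ LinearMap.snd R _ _ ∘ₗ (LinearMap.ker p).subtype), ?_⟩
    · rw [ModuleCat.epi_iff_surjective]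
      intro a
      obtain ⟨x, hx, z, hz⟩ := surj n (y.hom a) (congrArg (fun g => g.hom a) hy)
      exact ⟨⟨(a, ⟨x, hx⟩, z), sub_eq_zero.2 hz⟩, rfl⟩
    · exact ModuleCat.hom_ext (LinearMap.ext fun a => a.1.2.1.2)
    · exact ModuleCat.hom_ext (LinearMap.ext fun a => sub_eq_zero.1 a.2)
  exact isIso_of_mono_of_epi _

theorem DGStarAlg.weakEquivalences_of_cycles {A B : DGStarAlg.{u}} (f : A ⟶ B)
    (inj : ∀ (n : ℤ) (a : A.carrier), a ∈ A.grading n → A.d a = 0 → ∀ b ∈ B.grading (n + 1),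
      f.toAlgHom a = B.d b → ∃ c ∈ A.grading (n + 1), a = A.d c)
    (surj : ∀ (n : ℤ) (b : B.carrier), b ∈ B.grading n → B.d b = 0 →
      ∃ a ∈ A.grading n, A.d a = 0 ∧ ∃ c ∈ B.grading (n + 1), b = f.toAlgHom a + B.d c) :
    DGStarAlg.weakEquivalences f := by
  refine quasiIso_of_cycles (complexMap f) (fun n a ha b hb => ?_) (fun n b hb => ?_)
  · have h1 : A.d a.1 = 0 :=
      (coe_dComp A (show n - 1 + 1 = n by ring) a).symm.trans (congrArg Subtype.val ha)
    have h2 : f.toAlgHom a.1 = B.d b.1 := (congrArg Subtype.val hb).trans (coe_dComp B rfl b)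
    obtain ⟨c, hc, h⟩ := inj n a.1 a.2 h1 b.1 b.2 h2
    exact ⟨⟨c, hc⟩, Subtype.ext (h.trans (coe_dComp A rfl ⟨c, hc⟩).symm)⟩
  · have h1 : B.d b.1 = 0 :=
      (coe_dComp B (show n - 1 + 1 = n by ring) b).symm.trans (congrArg Subtype.val hb)
    obtain ⟨a, ha, h2, c, hc, h⟩ := surj n b.1 b.2 h1
    refine ⟨⟨a, ha⟩, Subtype.ext ((coe_dComp A (show n - 1 + 1 = n by ring) ⟨a, ha⟩).trans h2),
      ⟨c, hc⟩, Subtype.ext (h.trans ?_)⟩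
    exact congrArg (f.toAlgHom a + ·) (coe_dComp B rfl ⟨c, hc⟩).symm

/-! ### Deformation retracts induce weak equivalences of CCR algebras -/

namespace CCR
open PoissonStructure

section Retract
variable {V W : ChainComplex (ModuleCat.{u} ℝ) ℤ} (φ : V ⟶ W) (r : W ⟶ V)

/-- A chain map regarded as a morphism of complexes with the zero Poisson structure. -/
def zeroMap (φ : V ⟶ W) : (zero V).toPoCh ⟶ (zero W).toPoCh := ⟨φ, fun _ _ _ _ => rfl⟩

theorem mapAlg_zeroMap_comp (φ : V ⟶ W) (r : W ⟶ V) (hr : φ ≫ r = 𝟙 V)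
    (a : Alg (zero V).toPoCh) : mapAlg (zeroMap r) (mapAlg (zeroMap φ) a) = a := by
  have : (mapAlg (zeroMap r)).comp (mapAlg (zeroMap φ)) = AlgHom.id ℂ _ :=
    algHom_ext fun n v => by
      rw [AlgHom.comp_apply, mapAlg_gen, mapAlg_gen]
      exact congrArg (gen (zero V).toPoCh n)
        (congrArg (fun ψ : V ⟶ V => ψ.f n v) hr)
  exact AlgHom.congr_fun this a

/-- The derivation extending a homotopy `h` between the identity and the projection to a retract
has as its graded commutator with the differential a derivation that counts the generators from
the complement of this retract. -/
theorem exists_homotopy_derivation (h : Homotopy (𝟙 W) (r ≫ φ)) :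
    ∃ H : Alg (zero W).toPoCh →ₗ[ℂ] Alg (zero W).toPoCh,
      IsGradedDerivation (zero W).toPoCh 1 H ∧ ∀ (n : ℤ) (w : W.X n),
        d (zero W).toPoCh (H (gen (zero W).toPoCh n w)) +
          H (d (zero W).toPoCh (gen (zero W).toPoCh n w)) =
        gen (zero W).toPoCh n (w - φ.f n (r.f n w)) := by
  have hcomm : ∀ (p q : ℤ) (v : W.X p) (w : W.X q),
      gen (zero W).toPoCh p v * gen (zero W).toPoCh q w =
        (p * q).negOnePow • (gen (zero W).toPoCh q w * gen (zero W).toPoCh p v) := by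
    intro p q v w
    have := gen_mul_eq (zero W).toPoCh p q v w
    simpa using this
  obtain ⟨H, hH, hg⟩ := exists_isGradedDerivation (P := (zero W).toPoCh) 1
    (fun n => gen (zero W).toPoCh (n + 1) ∘ₗ (h.hom n (n + 1)).hom)
    (fun n v => gen_mem _ _ _) (fun q s v w => by
      simp only [LinearMap.comp_apply]
      rw [hcomm (q + 1) s, hcomm q (s + 1), add_mul, mul_add, one_mul, mul_one, one_mul,
        Int.negOnePow_add, Int.negOnePow_add, smul_smul, mul_left_comm, Int.units_mul_self, mul_one,
        smul_add, smul_smul]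
      abel)
  refine ⟨H, hH, fun n w => ?_⟩
  have e1 : ∀ k, k = n → gen (zero W).toPoCh k (W.d (n + 1) k (h.hom n (n + 1) w)) =
      gen (zero W).toPoCh n (W.d (n + 1) n (h.hom n (n + 1) w)) := by
    rintro _ rfl; rfl
  have e2 : ∀ k, k = n → gen (zero W).toPoCh k (h.hom (n - 1) k (W.d n (n - 1) w)) =
      gen (zero W).toPoCh n (h.hom (n - 1) n (W.d n (n - 1) w)) := by
    rintro _ rfl; rfl
  have e3 := h.comm n
  rw [dNext_eq _ (show (ComplexShape.down ℤ).Rel n (n - 1) from sub_add_cancel n 1),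
    prevD_eq _ (show (ComplexShape.down ℤ).Rel (n + 1) n from rfl)] at e3
  have e4 : w = h.hom (n - 1) n (W.d n (n - 1) w) + W.d (n + 1) n (h.hom n (n + 1) w) +
      φ.f n (r.f n w) := congrArg (fun g => g.hom w) e3
  have hg' : ∀ (n : ℤ) (w : W.X n), H (gen (zero W).toPoCh n w) =
    gen (zero W).toPoCh (n + 1) (h.hom n (n + 1) w) := hg
  rw [hg', d_gen, d_gen, hg']
  refine (congrArg₂ (· + ·) (e1 (n + 1 - 1) (by ring)) (e2 (n - 1 + 1) (by ring))).trans ?_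
  rw [← map_add]
  congr 1
  rw [eq_sub_iff_add_eq, add_comm (W.d (n + 1) n _)]
  exact e4.symm

/-- A linear operator `∏_{j ≤ k} (1 - N / j)`, which annihilates the eigenvectors of `N` with
eigenvalues `1, …, k` and fixes its kernel. -/
noncomputable def killEigen {A : Type*} [AddCommGroup A] [Module ℂ A] (N : A →ₗ[ℂ] A) :
    ℕ → A →ₗ[ℂ] A
  | 0 => LinearMap.id
  | k + 1 => killEigen N k - ((k : ℂ) + 1)⁻¹ • N ∘ₗ killEigen N k

theorem killEigen_eigenvector {A : Type*} [AddCommGroup A] [Module ℂ A] (N : A →ₗ[ℂ] A) {c : ℕ}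
    {x : A} (hx : N x = (c : ℂ) • x) (k : ℕ) :
    killEigen N k x = (∏ j ∈ Finset.range k, (1 - ((j : ℂ) + 1)⁻¹ * c)) • x := by
  induction k with
  | zero => simp [killEigen]
  | succ k ih =>
    simp only [killEigen, LinearMap.sub_apply, LinearMap.smul_apply, LinearMap.comp_apply, ih,
      map_smul, hx, Finset.prod_range_succ, smul_smul]
    rw [← sub_smul]
    congr 1
    ring

variable {φ r}

/-- Every cycle of `CCR(W, 0)` is homologous to its projection to a deformation retract: with `N`
the counting derivation of the complement, all factors of `∏ (1 - N / j)` are homotopic to the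
identity, while on a given element the product is eventually equal to the projection. -/
theorem exists_homologous (hr : φ ≫ r = 𝟙 V) (h : Homotopy (𝟙 W) (r ≫ φ)) {n : ℤ}
    {z : Alg (zero W).toPoCh} (hz : z ∈ gr (zero W).toPoCh n) (hd : d (zero W).toPoCh z = 0) :
    ∃ c ∈ gr (zero W).toPoCh (n + 1),
      z = mapAlg (zeroMap φ) (mapAlg (zeroMap r) z) + d (zero W).toPoCh c := by
  obtain ⟨H, hH, hg⟩ := exists_homotopy_derivation φ r h
  let q : Alg (zero W).toPoCh →ₐ[ℂ] Alg (zero W).toPoCh :=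
    (mapAlg (zeroMap φ)).comp (mapAlg (zeroMap r))
  have hq : ∀ (n : ℤ) (w : W.X n),
      q (gen (zero W).toPoCh n w) = gen (zero W).toPoCh n (φ.f n (r.f n w)) := fun n w => by
    change mapAlg _ (mapAlg _ _) = _
    rw [mapAlg_gen, mapAlg_gen]
    rfl
  have hrφ : ∀ (n : ℤ) (v : V.X n), r.f n (φ.f n v) = v := fun n v =>
    congrArg (fun ψ : V ⟶ V => ψ.f n v) hr
  let N : Alg (zero W).toPoCh →ₗ[ℂ] Alg (zero W).toPoCh :=
    d (zero W).toPoCh ∘ₗ H + H ∘ₗ d (zero W).toPoCh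
  have hN : IsGradedDerivation (zero W).toPoCh (-1 + 1) N := by
    have := isGradedDerivation_d.commutator hH
    rwa [mul_one, Int.negOnePow_neg, Int.negOnePow_one, Units.neg_smul, one_smul,
      sub_neg_eq_add] at this
  have hNg : ∀ (n : ℤ) (w : W.X n),
      N (gen (zero W).toPoCh n w) = gen (zero W).toPoCh n (w - φ.f n (r.f n w)) := hg
  have hNmul : ∀ a b, N (a * b) = N a * b + a * N b := by
    intro a b
    refine ext_of_mem (P := (zero W).toPoCh)
      (f := (N ∘ₗ LinearMap.mulRight ℂ b).toAddMonoidHom)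
      (g := (LinearMap.mulRight ℂ b ∘ₗ N + LinearMap.mulRight ℂ (N b)).toAddMonoidHom)
      (fun n a ha => ?_) a
    have := hN.leibniz b ha
    rwa [neg_add_cancel, zero_mul, Int.negOnePow_zero, one_smul] at this
  let E : Set (Alg (zero W).toPoCh) :=
    {x | ∃ c : ℕ, N x = (c : ℂ) • x ∧ q x = if c = 0 then x else 0}
  have hE : ∀ a, a ∈ Submodule.span ℂ E := by
    intro a
    induction a using CCR.induction with
    | h0 c =>
      refine Submodule.subset_span ⟨0, ?_, ?_⟩
      · rw [Algebra.algebraMap_eq_smul_one, map_smul, hN.map_one]; simp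
      · rw [if_pos rfl, AlgHom.commutes]
    | hg n w =>
      have e : gen (zero W).toPoCh n w = gen (zero W).toPoCh n (φ.f n (r.f n w)) +
          gen (zero W).toPoCh n (w - φ.f n (r.f n w)) := by
        rw [← map_add]; congr 1; exact (add_sub_cancel _ w).symm
      rw [e]
      refine Submodule.add_mem _ (Submodule.subset_span ⟨0, ?_, ?_⟩)
        (Submodule.subset_span ⟨1, ?_, ?_⟩)
      · rw [hNg, hrφ, sub_self, map_zero, Nat.cast_zero, zero_smul]
      · rw [hq, hrφ, if_pos rfl]
      · rw [hNg, map_sub (r.f n).hom, hrφ, sub_self, map_zero, sub_zero, Nat.cast_one, one_smul]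
      · rw [hq, map_sub (r.f n).hom, hrφ, sub_self, map_zero, map_zero, if_neg one_ne_zero]
    | ha a b iha ihb => exact Submodule.add_mem _ iha ihb
    | hm a b iha ihb =>
      have := Submodule.mul_mem_mul iha ihb
      rw [Submodule.span_mul_span] at this
      refine Submodule.span_mono ?_ this
      rintro _ ⟨x, ⟨c, hx, hx'⟩, y, ⟨c', hy, hy'⟩, rfl⟩
      refine ⟨c + c', ?_, ?_⟩
      · change N (x * y) = _ • (x * y)
        rw [hNmul, hx, hy, smul_mul_assoc, mul_smul_comm, ← add_smul, Nat.cast_add]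
      · change q (x * y) = if _ then x * y else 0
        rw [map_mul, hx', hy']
        by_cases h1 : c = 0 <;> by_cases h2 : c' = 0 <;> simp [h1, h2]
  have hK : ∀ a, ∃ k₀ : ℕ, ∀ k ≥ k₀, killEigen N k a = q a := by
    intro a
    induction hE a using Submodule.span_induction with
    | mem x hx =>
      obtain ⟨c, hx, hx'⟩ := hx
      refine ⟨c, fun k hk => ?_⟩
      rw [killEigen_eigenvector N hx, hx']
      obtain rfl | hc := Nat.eq_zero_or_pos c
      · simp
      · rw [if_neg hc.ne', Finset.prod_eq_zero (i := c - 1) (Finset.mem_range.2 (by omega)),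
          zero_smul]
        rw [Nat.cast_sub hc, Nat.cast_one, sub_add_cancel,
          inv_mul_cancel₀ (Nat.cast_ne_zero.2 hc.ne'), sub_self]
    | zero => exact ⟨0, fun k _ => by rw [map_zero, map_zero]⟩
    | add x y _ _ hx hy =>
      obtain ⟨k, hk⟩ := hx
      obtain ⟨l, hl⟩ := hy
      exact ⟨max k l, fun j hj => by
        rw [map_add, map_add, hk j (le_of_max_le_left hj), hl j (le_of_max_le_right hj)]⟩
    | smul s x _ hx =>
      obtain ⟨k, hk⟩ := hx
      exact ⟨k, fun j hj => by rw [map_smul, map_smul, hk j hj]⟩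
  have hT : ∀ k : ℕ, killEigen N k z ∈ gr (zero W).toPoCh n ∧
      d (zero W).toPoCh (killEigen N k z) = 0 ∧
      ∃ c ∈ gr (zero W).toPoCh (n + 1), z = killEigen N k z + d (zero W).toPoCh c := by
    intro k
    induction k with
    | zero => exact ⟨hz, hd, 0, Submodule.zero_mem _, by simp [killEigen]⟩
    | succ k ih =>
      obtain ⟨h1, h2, c, hc, h3⟩ := ih
      set y := killEigen N k z
      have e : killEigen N (k + 1) z =
          y - ((k : ℂ) + 1)⁻¹ • d (zero W).toPoCh (H y) := by
        have : N y = d (zero W).toPoCh (H y) := by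
          simp only [N, LinearMap.add_apply, LinearMap.comp_apply, h2, map_zero, add_zero]
        rw [← this]; rfl
      have hy := hH.mem h1
      refine ⟨?_, ?_, c + ((k : ℂ) + 1)⁻¹ • H y,
        Submodule.add_mem _ hc (Submodule.smul_mem _ _ hy), ?_⟩
      · rw [e]
        refine Submodule.sub_mem _ h1 (Submodule.smul_mem _ _ ?_)
        have := d_mem _ hy
        rwa [add_sub_cancel_right] at this
      · rw [e, map_sub, map_smul, d_d, h2, smul_zero, sub_zero]
      · rw [e, map_add, map_smul]
        refine h3.trans ?_
        abel
  obtain ⟨k, hk⟩ := hK z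
  obtain ⟨-, -, c, hc, h3⟩ := hT k
  rw [hk k le_rfl] at h3
  exact ⟨c, hc, h3⟩

end Retract

theorem weakEquivalences_of_cycles {P Q : PoCh.{u}} (f : P ⟶ Q)
    (inj : ∀ (n : ℤ) (a : Alg P), a ∈ gr P n → ∀ b ∈ gr Q (n + 1),
      mapAlg f a = d Q b → ∃ c ∈ gr P (n + 1), a = d P c)
    (surj : ∀ (n : ℤ) (b : Alg Q), b ∈ gr Q n → d Q b = 0 →
      ∃ a ∈ gr P n, d P a = 0 ∧ ∃ c ∈ gr Q (n + 1), b = mapAlg f a + d Q c) :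
    DGStarAlg.weakEquivalences (ccrFunctor.map f) :=
  DGStarAlg.weakEquivalences_of_cycles (ccrFunctor.map f) (fun n a ha _ => inj n a ha) surj

/-- A morphism of unshifted Poisson complexes that is the inclusion of a deformation retract of
chain complexes induces a weak equivalence of CCR algebras. -/
theorem weakEquivalences_of_homotopy {P Q : PoCh.{u}} (f : P ⟶ Q) (r : Q.V ⟶ P.V)
    (hr : f.toChainMap ≫ r = 𝟙 P.V) (h : Homotopy (𝟙 Q.V) (r ≫ f.toChainMap)) :
    DGStarAlg.weakEquivalences (ccrFunctor.map f) := by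
  -- Reordering reduces the claim to the case of vanishing Poisson structures.
  have key : ∀ {V W : ChainComplex (ModuleCat.{u} ℝ) ℤ} (S : PoissonStructure V)
      (T : PoissonStructure W) (f : S.toPoCh ⟶ T.toPoCh) (r : W ⟶ V)
      (_ : f.toChainMap ≫ r = 𝟙 V) (_ : Homotopy (𝟙 W) (r ≫ f.toChainMap)),
      DGStarAlg.weakEquivalences (ccrFunctor.map f) := by
    intro V W S T f r hr h
    have n1 : ∀ a, reorder T (zero W) (mapAlg f a) =
        mapAlg (zeroMap f.toChainMap) (reorder S (zero V) a) := reorder_mapAlg f _ rfl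
    have n2 : ∀ a, reorder (zero W) T (mapAlg (zeroMap f.toChainMap) a) =
        mapAlg f (reorder (zero V) S a) := reorder_mapAlg _ f rfl
    refine weakEquivalences_of_cycles f (fun n a ha b hb hab => ?_) (fun n b hb hd => ?_)
    · refine ⟨reorder (zero V) S (mapAlg (zeroMap r) (reorder T (zero W) b)),
        reorder_mem _ _ (mapAlg_mem _ (reorder_mem _ _ hb)), ?_⟩
      rw [← reorder_d, ← mapAlg_d, ← reorder_d, ← hab, n1, mapAlg_zeroMap_comp _ _ hr,
        reorder_reorder]
    · have h0 : d (zero W).toPoCh (reorder T (zero W) b) = 0 := by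
        rw [← reorder_d, hd, map_zero]
      obtain ⟨c, hc, e⟩ := exists_homologous hr h (reorder_mem T (zero W) hb) h0
      refine ⟨reorder (zero V) S (mapAlg (zeroMap r) (reorder T (zero W) b)),
        reorder_mem _ _ (mapAlg_mem _ (reorder_mem _ _ hb)), ?_,
        reorder (zero W) T c, reorder_mem _ _ hc, ?_⟩
      · rw [← reorder_d, ← mapAlg_d, h0, map_zero, map_zero]
      · rw [← n2, ← reorder_d, ← map_add, ← e, reorder_reorder]
  exact key (ofPoCh P) (ofPoCh Q) f r hr h

end CCR

/-! ### Perturbations of Poisson structures -/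

section Perturbation
variable {V W : ChainComplex (ModuleCat.{u} ℝ) ℤ}

theorem d_d_apply (V : ChainComplex (ModuleCat.{u} ℝ) ℤ) (i j k : ℤ) (v : V.X i) :
    V.d j k (V.d i j v) = 0 :=
  congrArg (fun g => g.hom v) (V.d_comp_d i j k)

theorem chainMap_d_apply (f : V ⟶ W) (i j : ℤ) (v : V.X i) :
    f.f j (V.d i j v) = W.d i j (f.f i v) :=
  (congrArg (fun g => g.hom v) (f.comm i j)).symm

/-- A graded antisymmetric form `V ⊗ V → ℝ` of degree one. -/
structure OddForm (V : ChainComplex (ModuleCat.{u} ℝ) ℤ) where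
  ρ : ∀ p q : ℤ, V.X p →ₗ[ℝ] V.X q →ₗ[ℝ] ℝ
  degree : ∀ (p q : ℤ) (a : V.X p) (b : V.X q), p + q ≠ -1 → ρ p q a b = 0
  antisymm : ∀ (p q : ℤ) (a : V.X p) (b : V.X q), ρ q p b a = -((p * q).negOnePow • ρ p q a b)

/-- The pullback of a form along maps that need not commute with the differentials. -/
@[simps ρ] def OddForm.comap (R : OddForm V) (f : ∀ n : ℤ, W.X n →ₗ[ℝ] V.X n) : OddForm W where
  ρ p q := (R.ρ p q).compl₁₂ (f p) (f q)
  degree p q _ _ h := R.degree p q _ _ h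
  antisymm p q _ _ := R.antisymm p q _ _

namespace PoissonStructure

/-- The pullback of a Poisson structure along a chain map. -/
@[simps! κ] def comap (S : PoissonStructure V) (f : W ⟶ V) : PoissonStructure W where
  κ p q := (S.κ p q).compl₁₂ (f.f p).hom (f.f q).hom
  degree p q _ _ h := S.degree p q _ _ h
  d_comp p q a b := by
    have := S.d_comp p q (f.f p a) (f.f q b)
    rw [← chainMap_d_apply, ← chainMap_d_apply] at this
    exact this
  antisymm p q _ _ := S.antisymm p q _ _

/-- The Poisson structure `τ + ∂ρ`. -/
@[simps! κ] def perturb (S : PoissonStructure V) (R : OddForm V) : PoissonStructure V where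
  κ p q := S.κ p q + ((R.ρ (p - 1) q).comp (V.d p (p - 1)).hom +
    p.negOnePow • (R.ρ p (q - 1)).compl₂ (V.d q (q - 1)).hom)
  degree p q a b h := by
    have h1 : p - 1 + q ≠ -1 := by omega
    have h2 : p + (q - 1) ≠ -1 := by omega
    simp [S.degree p q a b h, R.degree (p - 1) q _ b h1, R.degree p (q - 1) a _ h2]
  d_comp p q a b := by
    have h := S.d_comp p q a b
    simp only [LinearMap.add_apply, LinearMap.comp_apply, LinearMap.smul_apply,
      LinearMap.compl₂_apply]
    rw [d_d_apply, d_d_apply, map_zero, map_zero, LinearMap.zero_apply, smul_zero, add_zero,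
      zero_add, smul_add, add_add_add_comm, h, zero_add, Int.negOnePow_sub, Int.negOnePow_one]
    simp
  antisymm p q a b := by
    have s1 : ((p - 1) * q).negOnePow = (p * q).negOnePow * q.negOnePow := by
      rw [sub_mul, one_mul, Int.negOnePow_sub]
    have s2 : (p * (q - 1)).negOnePow = (p * q).negOnePow * p.negOnePow := by
      rw [mul_sub, mul_one, Int.negOnePow_sub]
    simp only [LinearMap.add_apply, LinearMap.comp_apply, LinearMap.smul_apply,
      LinearMap.compl₂_apply]
    rw [S.antisymm p q a b, R.antisymm p (q - 1) a, R.antisymm (p - 1) q _ b, s1, s2]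
    simp only [smul_add, smul_neg, smul_smul]
    rw [mul_left_comm q.negOnePow, Int.units_mul_self, mul_one]
    abel

end PoissonStructure
end Perturbation

/-! ### The cylinder -/

namespace Cylinder
variable (V : ChainComplex (ModuleCat.{u} ℝ) ℤ) {W : ChainComplex (ModuleCat.{u} ℝ) ℤ}

/-- The identification of `V_i` with `V_j` for `i = j` (and zero otherwise). -/
noncomputable def idx (i j : ℤ) : V.X i →ₗ[ℝ] V.X j :=
  if h : i = j then (eqToHom (congrArg V.X h)).hom else 0

@[simp] theorem idx_self (i : ℤ) (v : V.X i) : idx V i i v = v := by simp [idx]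

theorem idx_of_ne {i j : ℤ} (h : i ≠ j) : idx V i j = 0 := dif_neg h

variable {V} in
theorem idx_d {i j : ℤ} (h : i = j) (k : ℤ) (v : V.X i) : V.d j k (idx V i j v) = V.d i k v := by
  subst h; rw [idx_self]

variable {V} in
theorem idx_idx {i j : ℤ} (h : i = j) (k : ℤ) (v : V.X i) :
    idx V j k (idx V i j v) = idx V i k v := by
  subst h; rw [idx_self]

theorem chainMap_idx (f : V ⟶ W) (i j : ℤ) (v : V.X i) :
    f.f j (idx V i j v) = idx W i j (f.f i v) := by
  by_cases h : i = j
  · subst h; simp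
  · simp [idx_of_ne V h, idx_of_ne W h]

/-- The degree `n` part `V_n ⊕ V_n ⊕ V_{n-1}` of the cylinder. -/
abbrev obj (n : ℤ) : Type u := V.X n × V.X n × V.X (n - 1)

/-- The differential `(v, x, y) ↦ (d v, d x + y, - d y)`. -/
noncomputable def diff (i j : ℤ) : obj V i →ₗ[ℝ] obj V j where
  toFun w := (V.d i j w.1, V.d i j w.2.1 + idx V (i - 1) j w.2.2, -V.d (i - 1) (j - 1) w.2.2)
  map_add' w w' := by
    refine Prod.ext ?_ (Prod.ext ?_ ?_)
    · simp
    · simp only [Prod.fst_add, Prod.snd_add, map_add]; abel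
    · simp only [Prod.snd_add, map_add]; abel
  map_smul' r w := by simp

/-- The cylinder of a chain complex, in the form of the direct sum of `V` with the cone of the
identity of `V`. -/
noncomputable def cyl : ChainComplex (ModuleCat.{u} ℝ) ℤ where
  X n := ModuleCat.of ℝ (obj V n)
  d i j := ModuleCat.ofHom (diff V i j)
  shape i j h := by
    have h1 : j + 1 ≠ i := h
    refine ModuleCat.hom_ext (LinearMap.ext fun w => ?_)
    change diff V i j w = 0
    have h2 : ¬ (ComplexShape.down ℤ).Rel (i - 1) (j - 1) := fun e =>
      h1 (by have : j - 1 + 1 = i - 1 := e; omega)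
    simp [diff, V.shape i j h, V.shape _ _ h2, idx_of_ne V (show i - 1 ≠ j by omega)]
  d_comp_d' i j k hij hjk := by
    obtain rfl : j = i - 1 := eq_sub_of_add_eq hij
    obtain rfl : k = i - 1 - 1 := eq_sub_of_add_eq hjk
    refine ModuleCat.hom_ext (LinearMap.ext fun w => ?_)
    change diff V _ _ (diff V _ _ w) = 0
    simp [diff, d_d_apply]

variable {V}

/-- The map of cylinders induced by a chain map. -/
noncomputable def map (f : V ⟶ W) : cyl V ⟶ cyl W where
  f n := ModuleCat.ofHom ((f.f n).hom.prodMap ((f.f n).hom.prodMap (f.f (n - 1)).hom))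
  comm' i j _ := by
    refine ModuleCat.hom_ext (LinearMap.ext fun w => ?_)
    refine Prod.ext ?_ (Prod.ext ?_ ?_)
    · exact (chainMap_d_apply f i j w.1).symm
    · change W.d i j (f.f i w.2.1) + idx W (i - 1) j (f.f (i - 1) w.2.2) =
        f.f j (V.d i j w.2.1 + idx V (i - 1) j w.2.2)
      rw [map_add, chainMap_d_apply, chainMap_idx]
    · change -W.d (i - 1) (j - 1) (f.f (i - 1) w.2.2) = f.f (j - 1) (-V.d (i - 1) (j - 1) w.2.2)
      rw [map_neg, chainMap_d_apply]

/-- The cylinder functor. -/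
noncomputable def functor :
    ChainComplex (ModuleCat.{u} ℝ) ℤ ⥤ ChainComplex (ModuleCat.{u} ℝ) ℤ where
  obj := cyl
  map := map
  map_id _ := rfl
  map_comp _ _ := rfl

/-- The projection of the cylinder to `V`. -/
noncomputable def proj (V : ChainComplex (ModuleCat.{u} ℝ) ℤ) : cyl V ⟶ V where
  f _ := ModuleCat.ofHom (LinearMap.fst ℝ _ _)
  comm' _ _ _ := rfl

/-- The graded projection `(v, x, y) ↦ x`, which is not a chain map. -/
noncomputable def snd (V : ChainComplex (ModuleCat.{u} ℝ) ℤ) (n : ℤ) : (cyl V).X n →ₗ[ℝ] V.X n :=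
  LinearMap.fst ℝ _ _ ∘ₗ LinearMap.snd ℝ (V.X n) (V.X n × V.X (n - 1))

/-- The inclusion `v ↦ (v, t v, 0)`. -/
noncomputable def incl (V : ChainComplex (ModuleCat.{u} ℝ) ℤ) (t : ℝ) : V ⟶ cyl V where
  f n := ModuleCat.ofHom (LinearMap.prod LinearMap.id (LinearMap.prod (t • LinearMap.id) 0))
  comm' i j _ := by
    refine ModuleCat.hom_ext (LinearMap.ext fun v => ?_)
    refine Prod.ext rfl (Prod.ext ?_ ?_)
    · change V.d i j (t • v) + idx V (i - 1) j 0 = t • V.d i j v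
      rw [map_smul, map_zero, add_zero]
    · change -V.d (i - 1) (j - 1) 0 = 0
      rw [map_zero, neg_zero]

theorem incl_proj (t : ℝ) : incl V t ≫ proj V = 𝟙 V := rfl

/-- The homotopy `(v, x, y) ↦ (0, 0, x - t v)`. -/
noncomputable def homotopyHom (V : ChainComplex (ModuleCat.{u} ℝ) ℤ) (t : ℝ) (i j : ℤ) :
    (cyl V).X i ⟶ (cyl V).X j :=
  ModuleCat.ofHom (LinearMap.prod 0 (LinearMap.prod 0 (idx V i (j - 1) ∘ₗ
    (LinearMap.fst ℝ _ _ ∘ₗ LinearMap.snd ℝ (V.X i) (V.X i × V.X (i - 1)) -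
      t • LinearMap.fst ℝ (V.X i) (V.X i × V.X (i - 1))))))

/-- The inclusion `v ↦ (v, t v, 0)` is a deformation retract. -/
noncomputable def homotopy (V : ChainComplex (ModuleCat.{u} ℝ) ℤ) (t : ℝ) :
    Homotopy (𝟙 (cyl V)) (proj V ≫ incl V t) where
  hom := homotopyHom V t
  zero i j h := by
    have h1 : i ≠ j - 1 := fun e => h (show i + 1 = j by omega)
    refine ModuleCat.hom_ext (LinearMap.ext fun w => ?_)
    rw [homotopyHom, idx_of_ne V h1]
    rfl
  comm n := by
    rw [dNext_eq _ (show (ComplexShape.down ℤ).Rel n (n - 1) from sub_add_cancel n 1),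
      prevD_eq _ (show (ComplexShape.down ℤ).Rel (n + 1) n from rfl)]
    refine ModuleCat.hom_ext (LinearMap.ext fun (w : obj V n) => ?_)
    obtain ⟨v, x, y⟩ := w
    refine Prod.ext ?_ (Prod.ext ?_ ?_)
    · change v = 0 + V.d (n + 1) n 0 + v
      rw [map_zero, zero_add, zero_add]
    · change x = 0 + (V.d (n + 1) n 0 + idx V (n + 1 - 1) n (idx V n (n + 1 - 1) (x - t • v))) +
        t • v
      rw [idx_idx (by ring), idx_self, map_zero]
      abel
    · change y = idx V (n - 1) (n - 1) (V.d n (n - 1) x + idx V (n - 1) (n - 1) y -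
        t • V.d n (n - 1) v) + -V.d (n + 1 - 1) (n - 1) (idx V n (n + 1 - 1) (x - t • v)) + 0
      rw [idx_d (by ring), idx_self, idx_self, map_sub, map_smul]
      abel

/-- The Poisson structure on the cylinder that restricts to `τ + t² ∂ρ` along the inclusion
`v ↦ (v, t v, 0)`. -/
noncomputable def poisson (S : PoissonStructure V) (R : OddForm V) :
    PoissonStructure (cyl V) :=
  (S.comap (proj V)).perturb (R.comap (snd V))

theorem poisson_incl (S : PoissonStructure V) (R : OddForm V) (t : ℝ) (p q : ℤ) (a : V.X p)
    (b : V.X q) : (poisson S R).κ p q ((incl V t).f p a) ((incl V t).f q b) =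
      S.κ p q a b + t * t * ((S.perturb R).κ p q a b - S.κ p q a b) := by
  have e : ∀ (i j : ℤ) (v : V.X i), snd V j ((cyl V).d i j ((incl V t).f i v)) = t • V.d i j v := by
    intro i j v
    change V.d i j (t • v) + idx V (i - 1) j 0 = _
    rw [map_smul, map_zero, add_zero]
  have e' : ∀ (i : ℤ) (v : V.X i), snd V i ((incl V t).f i v) = t • v := fun i v => rfl
  have e0 : ∀ (i : ℤ) (v : V.X i), (proj V).f i ((incl V t).f i v) = v := fun i v => rfl
  rw [poisson]
  simp only [PoissonStructure.perturb_κ, PoissonStructure.comap_κ, OddForm.comap_ρ,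
    LinearMap.add_apply, LinearMap.comp_apply, LinearMap.smul_apply, LinearMap.compl₂_apply,
    LinearMap.compl₁₂_apply, e, e', e0, map_smul, Units.smul_def, zsmul_eq_mul, smul_eq_mul]
  ring

theorem poisson_map {S : PoissonStructure V} {R : OddForm V} {S' : PoissonStructure W}
    {R' : OddForm W} (f : V ⟶ W)
    (hS : ∀ p q a b, S'.κ p q (f.f p a) (f.f q b) = S.κ p q a b)
    (hR : ∀ p q a b, R'.ρ p q (f.f p a) (f.f q b) = R.ρ p q a b) (p q : ℤ) (a : (cyl V).X p)
    (b : (cyl V).X q) :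
    (poisson S' R').κ p q ((map f).f p a) ((map f).f q b) = (poisson S R).κ p q a b := by
  have e : ∀ (i : ℤ) (v : (cyl V).X i), snd W i ((map f).f i v) = f.f i (snd V i v) :=
    fun i v => rfl
  have e0 : ∀ (i : ℤ) (v : (cyl V).X i), (proj W).f i ((map f).f i v) = f.f i ((proj V).f i v) :=
    fun i v => rfl
  rw [poisson, poisson]
  simp only [PoissonStructure.perturb_κ, PoissonStructure.comap_κ, OddForm.comap_ρ,
    LinearMap.add_apply, LinearMap.comp_apply, LinearMap.smul_apply, LinearMap.compl₂_apply,
    LinearMap.compl₁₂_apply, ← chainMap_d_apply, e, e0, hS, hR]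

end Cylinder

/-! ### Homotopic Poisson structures have weakly equivalent quantizations -/

section Zigzag
variable {C : Type*} [Category C]

/-- The functor to unshifted Poisson complexes given by a functor to chain complexes and a natural
family of Poisson structures. -/
@[simps] def poissonFunctor (K : C ⥤ ChainComplex (ModuleCat.{u} ℝ) ℤ)
    (S : ∀ X, PoissonStructure (K.obj X))
    (hS : ∀ {X Y : C} (f : X ⟶ Y) (p q : ℤ) (a : (K.obj X).X p) (b : (K.obj X).X q),
      (S Y).κ p q ((K.map f).f p a) ((K.map f).f q b) = (S X).κ p q a b) : C ⥤ PoCh.{u} where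
  obj X := (S X).toPoCh
  map f := ⟨K.map f, hS f⟩
  map_id X := PoCh.hom_ext (K.map_id X)
  map_comp f g := PoCh.hom_ext (K.map_comp f g)

/-- Natural Poisson structures `τ` and `τ + ∂ρ`, with `ρ` natural, are connected through the
cylinder by the inclusions at `t = 0` and `t = 1`. -/
theorem natZigzag_of_perturb (K : C ⥤ ChainComplex (ModuleCat.{u} ℝ) ℤ)
    (S S' : ∀ X, PoissonStructure (K.obj X))
    (hS : ∀ {X Y : C} (f : X ⟶ Y) (p q : ℤ) (a : (K.obj X).X p) (b : (K.obj X).X q),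
      (S Y).κ p q ((K.map f).f p a) ((K.map f).f q b) = (S X).κ p q a b)
    (hS' : ∀ {X Y : C} (f : X ⟶ Y) (p q : ℤ) (a : (K.obj X).X p) (b : (K.obj X).X q),
      (S' Y).κ p q ((K.map f).f p a) ((K.map f).f q b) = (S' X).κ p q a b)
    (R : ∀ X, OddForm (K.obj X))
    (hR : ∀ {X Y : C} (f : X ⟶ Y) (p q : ℤ) (a : (K.obj X).X p) (b : (K.obj X).X q),
      (R Y).ρ p q ((K.map f).f p a) ((K.map f).f q b) = (R X).ρ p q a b)
    (h : ∀ X p q a b, (S' X).κ p q a b = ((S X).perturb (R X)).κ p q a b) :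
    NatZigzag (poissonFunctor K S hS ⋙ ccrFunctor) (poissonFunctor K S' hS' ⋙ ccrFunctor) := by
  let G := poissonFunctor (K ⋙ Cylinder.functor) (fun X => Cylinder.poisson (S X) (R X))
    (fun f => Cylinder.poisson_map (K.map f) (hS f) (hR f))
  let η (t : ℝ) (T : ∀ X, PoissonStructure (K.obj X)) (hT) (hκ : ∀ X p q a b, (T X).κ p q a b =
      (S X).κ p q a b + t * t * (((S X).perturb (R X)).κ p q a b - (S X).κ p q a b)) :
      poissonFunctor K T hT ⟶ G :=
    { app := fun X => ⟨Cylinder.incl (K.obj X) t, fun p q a b =>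
        (Cylinder.poisson_incl (S X) (R X) t p q a b).trans (hκ X p q a b).symm⟩
      naturality := fun X Y f => PoCh.hom_ext (HomologicalComplex.hom_ext _ _ fun n =>
        ModuleCat.hom_ext (LinearMap.ext fun v => Prod.ext rfl (Prod.ext
          (map_smul ((K.map f).f n).hom t v).symm (map_zero ((K.map f).f (n - 1)).hom).symm))) }
  have hη : ∀ t T hT hκ, natWeakEquivalences C (Functor.whiskerRight (η t T hT hκ) ccrFunctor) :=
    fun t T hT hκ X => CCR.weakEquivalences_of_homotopy _ (Cylinder.proj _)
      (Cylinder.incl_proj t) (Cylinder.homotopy _ t)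
  refine Relation.EqvGen.trans _ (G ⋙ ccrFunctor) _ (Relation.EqvGen.rel _ _ ⟨_, hη 0 S hS ?_⟩)
    (Relation.EqvGen.symm _ _ (Relation.EqvGen.rel _ _ ⟨_, hη 1 S' hS' ?_⟩))
  · intro X p q a b
    ring
  · intro X p q a b
    rw [h]
    ring

/-- If two Poisson structures differ by the boundary of a form of degree one, then this form may be
chosen graded antisymmetric. -/
theorem exists_oddForm {V : ChainComplex (ModuleCat.{u} ℝ) ℤ} (S S' : PoissonStructure V)
    (β : ∀ p q : ℤ, V.X p →ₗ[ℝ] V.X q →ₗ[ℝ] ℝ)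
    (hβ : ∀ (p q : ℤ) (a : V.X p) (b : V.X q), p + q ≠ -1 → β p q a b = 0)
    (h : ∀ (p q : ℤ) (a : V.X p) (b : V.X q), S'.κ p q a b = S.κ p q a b +
      (β (p - 1) q (V.d p (p - 1) a) b + p.negOnePow • β p (q - 1) a (V.d q (q - 1) b))) :
    ∃ R : OddForm V, ∀ (p q : ℤ) (a : V.X p) (b : V.X q),
      S'.κ p q a b = (S.perturb R).κ p q a b := by
  let R : OddForm V :=
    { ρ := fun p q => (2⁻¹ : ℝ) • (β p q - (p * q).negOnePow • (β q p).flip)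
      degree := fun p q a b hpq => by
        simp [hβ p q a b hpq, hβ q p b a (by rwa [add_comm])]
      antisymm := fun p q a b => by
        simp only [LinearMap.smul_apply, LinearMap.sub_apply, LinearMap.flip_apply, mul_comm q p]
        rcases Int.units_eq_one_or (p * q).negOnePow with e | e <;> rw [e] <;>
        · simp only [Units.neg_smul, one_smul, smul_eq_mul]
          ring }
  refine ⟨R, fun p q a b => ?_⟩
  have e1 := h p q a b
  have e2 := h q p b a
  rw [S.antisymm p q, S'.antisymm p q] at e2
  have s1 : ((p - 1) * q).negOnePow = (p * q).negOnePow * q.negOnePow := by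
    rw [sub_mul, one_mul, Int.negOnePow_sub]
  have s2 : (p * (q - 1)).negOnePow = (p * q).negOnePow * p.negOnePow := by
    rw [mul_sub, mul_one, Int.negOnePow_sub]
  change _ = S.κ p q a b + ((2⁻¹ : ℝ) • (β (p - 1) q (V.d p (p - 1) a) b -
      ((p - 1) * q).negOnePow • β q (p - 1) b (V.d p (p - 1) a)) +
    p.negOnePow • (2⁻¹ : ℝ) • (β p (q - 1) a (V.d q (q - 1) b) -
      (p * (q - 1)).negOnePow • β (q - 1) p (V.d q (q - 1) b) a))
  rw [s1, s2]
  clear s1 s2 h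
  generalize β (p - 1) q (V.d p (p - 1) a) b = x₁ at *
  generalize β p (q - 1) a (V.d q (q - 1) b) = x₂ at *
  generalize β (q - 1) p (V.d q (q - 1) b) a = x₃ at *
  generalize β q (p - 1) b (V.d p (p - 1) a) = x₄ at *
  generalize S.κ p q a b = s at *
  generalize S'.κ p q a b = s' at *
  rcases Int.units_eq_one_or (p * q).negOnePow with e | e <;>
  rcases Int.units_eq_one_or p.negOnePow with e' | e' <;>
  rcases Int.units_eq_one_or q.negOnePow with e'' | e'' <;>
  · simp only [e, e', e'', Units.neg_smul, one_smul, smul_eq_mul, mul_one, mul_neg,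
      neg_neg] at e1 e2 ⊢
    linarith

/-- In a category with a terminal object, a homotopy of natural Poisson structures may be chosen
naturally as soon as it exists over the terminal object. -/
theorem natZigzag_of_isTerminal (K : C ⥤ ChainComplex (ModuleCat.{u} ℝ) ℤ) {T : C}
    (hT : Limits.IsTerminal T) (S S' : ∀ X, PoissonStructure (K.obj X))
    (hS : ∀ {X Y : C} (f : X ⟶ Y) (p q : ℤ) (a : (K.obj X).X p) (b : (K.obj X).X q),
      (S Y).κ p q ((K.map f).f p a) ((K.map f).f q b) = (S X).κ p q a b)
    (hS' : ∀ {X Y : C} (f : X ⟶ Y) (p q : ℤ) (a : (K.obj X).X p) (b : (K.obj X).X q),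
      (S' Y).κ p q ((K.map f).f p a) ((K.map f).f q b) = (S' X).κ p q a b)
    (R : OddForm (K.obj T))
    (h : ∀ p q a b, (S' T).κ p q a b = ((S T).perturb R).κ p q a b) :
    NatZigzag (poissonFunctor K S hS ⋙ ccrFunctor) (poissonFunctor K S' hS' ⋙ ccrFunctor) := by
  refine natZigzag_of_perturb K S S' hS hS'
    (fun X => R.comap fun n => ((K.map (hT.from X)).f n).hom) (fun {X Y} f p q a b => ?_)
    (fun X p q a b => ?_)
  · have e : ∀ (n : ℤ) (v : (K.obj X).X n),
        (K.map (hT.from Y)).f n ((K.map f).f n v) = (K.map (hT.from X)).f n v := by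
      intro n v
      rw [← hT.comp_from f, K.map_comp]
      rfl
    exact congrArg₂ (fun x y => R.ρ p q x y) (e p a) (e q b)
  · rw [← hS' (hT.from X), h]
    simp only [PoissonStructure.perturb_κ, OddForm.comap_ρ, LinearMap.add_apply,
      LinearMap.comp_apply, LinearMap.smul_apply, LinearMap.compl₂_apply,
      LinearMap.compl₁₂_apply, hS, chainMap_d_apply]

end Zigzag
namespace FieldTheory
variable {m : ℕ} (𝓕 : FieldTheory.{u} m)

/-! ### Any two trivializations are homotopic -/

section Comparison
variable {S : SupportType} {M : Loc.{u} m}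

/-- The identity `dΛ + Λd = id` in a fixed degree. -/
theorem Trivialization.comm_apply (Λ : 𝓕.Trivialization S M) (q : ℤ) :
    𝟙 ((𝓕.obs S M).X q) = (𝓕.obs S M).d q (q - 1) ≫ Λ.hom (q - 1) q +
      Λ.hom q (q + 1) ≫ (𝓕.obs S M).d (q + 1) q := by
  have h := Λ.comm q
  rw [dNext_eq _ (show (ComplexShape.down ℤ).Rel q (q - 1) from sub_add_cancel q 1),
    prevD_eq _ (show (ComplexShape.down ℤ).Rel (q + 1) q from rfl)] at h
  simpa using h

/-- The components of `j Λ (Λ' - Λ) ι`, a homotopy between `j Λ ι` and `j Λ' ι`. -/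
noncomputable def comparison (Λ Λ' : 𝓕.Trivialization S M) (n k : ℤ) :
    (𝓕.obs .compact M).X n ⟶ (𝓕.sol M).X k :=
  (𝓕.incl S M).f n ≫ (Λ'.hom n k - Λ.hom n k) ≫ Λ.hom k (k + 1) ≫ 𝓕.j S M (k + 1) k

/-- The composites `j Λ ι` and `j Λ' ι` are homotopic: `Λ' - Λ` anticommutes with the differential,
so inserting `dΛ + Λd = id` after it exhibits it as a boundary. -/
theorem jΛι_sub (Λ Λ' : 𝓕.Trivialization S M) (q : ℤ) :
    𝓕.jΛι Λ' q - 𝓕.jΛι Λ q = -(𝓕.comparison Λ Λ' q (q + 1) ≫ (𝓕.sol M).d (q + 1) q +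
      (𝓕.obs .compact M).d q (q - 1) ≫ 𝓕.comparison Λ Λ' (q - 1) q) := by
  have hj := 𝓕.j_d S M (q + 1)
  rw [add_sub_cancel_right] at hj
  have hc := (Trivialization.comm_apply 𝓕 Λ q).symm.trans (Trivialization.comm_apply 𝓕 Λ' q)
  have hc1 := Trivialization.comm_apply 𝓕 Λ (q + 1)
  rw [add_sub_cancel_right] at hc1
  set δ := Λ'.hom q (q + 1) - Λ.hom q (q + 1) with hδ
  set δ' := Λ'.hom (q - 1) q - Λ.hom (q - 1) q with hδ'
  have h1 : δ ≫ (𝓕.obs S M).d (q + 1) q = -((𝓕.obs S M).d q (q - 1) ≫ δ') := by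
    rw [hδ, hδ', Preadditive.sub_comp, Preadditive.comp_sub]
    rw [← sub_eq_zero] at hc
    rw [← sub_eq_zero, ← neg_eq_zero, ← hc]
    abel
  have h2 : δ = -((𝓕.obs S M).d q (q - 1) ≫ δ' ≫ Λ.hom q (q + 1)) +
      δ ≫ Λ.hom (q + 1) (q + 1 + 1) ≫ (𝓕.obs S M).d (q + 1 + 1) (q + 1) := by
    conv_lhs => rw [← Category.comp_id δ, hc1]
    rw [Preadditive.comp_add, ← Category.assoc, h1, Preadditive.neg_comp, Category.assoc]
  have h3 : 𝓕.jΛι Λ' q - 𝓕.jΛι Λ q = (𝓕.incl S M).f q ≫ δ ≫ 𝓕.j S M (q + 1) q := by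
    rw [jΛι, jΛι, hδ, Preadditive.sub_comp, Preadditive.comp_sub]
  rw [h3, h2, comparison, comparison, ← hδ, ← hδ']
  simp only [Category.assoc, hj, Preadditive.add_comp, Preadditive.comp_add, Preadditive.neg_comp,
    Preadditive.comp_neg, neg_add, neg_neg]
  rw [← HomologicalComplex.Hom.comm_assoc]
  abel

end Comparison

/-! ### Comparison of the Poisson structures -/

section
variable {M : Loc.{u} m} {Λp Λp' : 𝓕.Trivialization .past M} {Λf Λf' : 𝓕.Trivialization .future M}

/-- Any two compatible pairs of trivializations define homotopic Poisson structures. -/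
theorem exists_poisson_eq_perturb (h : 𝓕.Compatible Λp Λf) (h' : 𝓕.Compatible Λp' Λf') :
    ∃ R : OddForm (𝓕.obs .compact M), ∀ p q a b,
      (𝓕.poisson Λp' Λf' h').τ p q a b =
        ((PoissonStructure.ofPoCh (𝓕.poisson Λp Λf h)).perturb R).κ p q a b := by
  let E (n k : ℤ) := 𝓕.comparison Λp Λp' n k - 𝓕.comparison Λf Λf' n k
  have hE : ∀ q, (𝓕.propagator Λp' Λf').f q = (𝓕.propagator Λp Λf).f q -
      (E q (q + 1) ≫ (𝓕.sol M).d (q + 1) q + (𝓕.obs .compact M).d q (q - 1) ≫ E (q - 1) q) := by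
    intro q
    have h1 := 𝓕.jΛι_sub Λp Λp' q
    have h2 := 𝓕.jΛι_sub Λf Λf' q
    change 𝓕.jΛι Λp' q - 𝓕.jΛι Λf' q = 𝓕.jΛι Λp q - 𝓕.jΛι Λf q - _
    rw [sub_eq_iff_eq_add] at h1 h2
    rw [h1, h2]
    simp only [E, Preadditive.sub_comp, Preadditive.comp_sub]
    abel
  refine exists_oddForm (PoissonStructure.ofPoCh (𝓕.poisson Λp Λf h))
    (PoissonStructure.ofPoCh (𝓕.poisson Λp' Λf' h'))
    (fun p q => (p + 1).negOnePow • (𝓕.ev M p (q + 1)).compl₂ (E q (q + 1)).hom)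
    (fun p q a b hpq => ?_) (fun p q a b => ?_)
  · have : p + (q + 1) ≠ 0 := by omega
    change (p + 1).negOnePow • 𝓕.ev M p (q + 1) a (E q (q + 1) b) = 0
    rw [𝓕.ev_degree M p (q + 1) this]
    exact smul_zero _
  · have e1 : ∀ k, k = q → 𝓕.ev M p k a (E (q - 1) k ((𝓕.obs .compact M).d q (q - 1) b)) =
        𝓕.ev M p q a (E (q - 1) q ((𝓕.obs .compact M).d q (q - 1) b)) := by
      rintro _ rfl; rfl
    have e2 := 𝓕.ev_d M p (q + 1) a (E q (q + 1) b)
    rw [add_sub_cancel_right] at e2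
    have e3 : (𝓕.propagator Λp' Λf').f q b = (𝓕.propagator Λp Λf).f q b -
      ((𝓕.sol M).d (q + 1) q (E q (q + 1) b) + E (q - 1) q ((𝓕.obs .compact M).d q (q - 1) b)) :=
      congrArg (fun g => g.hom b) (hE q)
    change 𝓕.ev M p q a ((𝓕.propagator Λp' Λf').f q b) =
      𝓕.ev M p q a ((𝓕.propagator Λp Λf).f q b) + ((p - 1 + 1).negOnePow •
        𝓕.ev M (p - 1) (q + 1) ((𝓕.obs .compact M).d p (p - 1) a) (E q (q + 1) b) +
        p.negOnePow • (p + 1).negOnePow • 𝓕.ev M p (q - 1 + 1) a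
          (E (q - 1) (q - 1 + 1) ((𝓕.obs .compact M).d q (q - 1) b)))
    rw [e1 _ (sub_add_cancel q 1), e3, map_sub, map_add, sub_add_cancel,
      eq_neg_of_add_eq_zero_left e2, Int.negOnePow_succ, smul_neg, smul_smul, smul_smul,
      mul_neg, Int.units_mul_self, one_smul, Units.neg_smul, one_smul]
    ring

end

end FieldTheory
end HomotopyAQFT

theorem mainTheorem11 (m : ℕ) (hm : 2 ≤ m) (𝓕 : HomotopyAQFT.FieldTheory.{u} m)
    (Mbar : HomotopyAQFT.Loc.{u} m) (Λ Λ' : 𝓕.NaturalCompatiblePair Mbar) :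
    HomotopyAQFT.NatZigzag (Λ.poissonFunctor ⋙ HomotopyAQFT.ccrFunctor)
      (Λ'.poissonFunctor ⋙ HomotopyAQFT.ccrFunctor) := by
  let K : Over Mbar ⥤ ChainComplex (ModuleCat.{u} ℝ) ℤ :=
    { obj := fun X => 𝓕.obs .compact X.left
      map := fun f => 𝓕.push f.left
      map_id := fun X => 𝓕.push_id X.left
      map_comp := fun f g => 𝓕.push_comp f.left g.left }
  obtain ⟨R, hR⟩ := 𝓕.exists_poisson_eq_perturb (Λ.compatible (Over.mk (𝟙 Mbar)))
    (Λ'.compatible (Over.mk (𝟙 Mbar)))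
  exact HomotopyAQFT.natZigzag_of_isTerminal K Over.mkIdTerminal
    (fun X => HomotopyAQFT.PoissonStructure.ofPoCh (Λ.poissonFunctor.obj X))
    (fun X => HomotopyAQFT.PoissonStructure.ofPoCh (Λ'.poissonFunctor.obj X))
    (fun f => (Λ.poissonFunctor.map f).map_τ) (fun f => (Λ'.poissonFunctor.map f).map_τ) R hR
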